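/- Write $\mathbb{T}=\mathbb{R}/\mathbb{Z}$. For a finite Borel measure $\mu$ on $\mathbb{T}$ let $\widehat{\mu}(\xi)=\int_{\mathbb{T}} e^{-2\pi i\xi x}\,d\mu(x)$ for $\xi\in\mathbb{Z}$, and let $\dim_{\mathbb{F}}(\mu)$ be the supremum of all $s\in[0,1]$ such that $\sup_{\xi\in\mathbb{Z}}|\widehat{\mu}(\xi)|\,|\xi|^{s/2}<\infty$. The Fourier dimension $\dim_{\mathbb{F}}(A)$ of a Borel set $A\subset\mathbb{T}$ is the supremum of $\dim_{\mathbb{F}}(\mu)$ over all Borel probability measures $\mu$ on $\mathbb{T}$ with $\operatorname{supp}(\mu)\subset A$, and $A$ is a Salem set if $\dim_{\mathbb{F}}(A)$ equals the Hausdorff dimension of $A$. A set $E\subset[0,1]$ is called a Salem set, and its Fourier dimension is defined, through its image in $\mathbb{T}$. Theorem. Let $\gamma:[0,1]\to\mathbb{R}^d$ be a smooth ($C^\infty$) map with $\gamma'(t)\neq 0$ for all $t\in[0,1]$. Then there exists a Salem set $E\subset[0,1]$ with $\dim_{\mathbb{F}}(E)=4/9$ which avoids isosceles triangles on $\gamma$,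 that is, $|\gamma(t_1)-\gamma(t_2)|\neq|\gamma(t_2)-\gamma(t_3)|$ for all distinct $t_1,t_2,t_3\in E$, where $|\cdot|$ is the Euclidean norm. -/

import Mathlib

/-! Near a point where the derivative of `γ` does not vanish the distances along `γ` grow at a
definite rate, so that two vertices of an isosceles triangle determine the third one up to their own
precision. Sample `N` random points in each of three separated intervals, and `N` more in the rest
of the circle, and call a triple forbidden if it is isosceles up to precision `r = N ^ (-9 / 4)`.
A point of the third interval completes one of the `N ^ 2` pairs from the first two intervals to a
forbidden triple with probability `η = O(N ^ 2 * r) = O(N ^ (-1 / 4))`. Sampling the third interval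
last, from a density vanishing at all such points, avoids every forbidden triple. A compensating
factor makes the loss of mass harmless to first order, so that the Fourier coefficients of the
sample change by `O(η ^ 2) = O(N ^ (-1 / 2))` only, which is the size of the sampling error.

Smoothing the sample by tents of radius `r` gives a multiplier `F` of mean one whose Fourier
coefficients are at most `δ |n| ^ (-s)` for any `s < (1 / 2) / (9 / 4) = 2 / 9`, supported on `O(N)`
balls of radius `N ^ (-9 / 4)`, hence of dimension `4 / 9`. A weak limit of the products of such
multipliers, one for each of countably many triples of intervals, has Fourier dimension at least
`4 / 9` and a support of Hausdorff dimension at most `4 / 9`. The two dimensions coincide because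
the Fourier dimension never exceeds the Hausdorff dimension, by energy estimates and the mass
distribution principle. -/

open scoped ENNReal ContDiff
open MeasureTheory Set

/-- The Fourier coefficient `∫ exp (-2 π i ξ x) dμ(x)` of a measure on the circle `ℝ / ℤ`. -/
noncomputable def measureFourierCoeff (μ : Measure UnitAddCircle) (ξ : ℤ) : ℂ :=
  ∫ x, fourier (-ξ) x ∂μ

/-- The exponents `s ∈ [0, 1]` such that `|μ̂(ξ)| |ξ| ^ (s / 2)` is bounded over `ξ ∈ ℤ`. -/
def fourierDecayExponents (μ : Measure UnitAddCircle) : Set ℝ :=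
  {s | s ∈ Icc (0 : ℝ) 1 ∧
    ∃ C : ℝ, ∀ ξ : ℤ, ‖measureFourierCoeff μ ξ‖ * |(ξ : ℝ)| ^ (s / 2) ≤ C}

/-- The Fourier dimension of a measure on the circle. -/
noncomputable def measureFourierDim (μ : Measure UnitAddCircle) : ℝ≥0∞ :=
  ⨆ s ∈ fourierDecayExponents μ, ENNReal.ofReal s

/-- The Fourier dimension of a subset of the circle: the supremum of the Fourier dimensions of the
Borel probability measures whose (closed) support is contained in the set. -/
noncomputable def setFourierDim (A : Set UnitAddCircle) : ℝ≥0∞ :=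
  ⨆ (μ : ProbabilityMeasure UnitAddCircle) (_ : (μ : Measure UnitAddCircle).support ⊆ A),
    measureFourierDim (μ : Measure UnitAddCircle)

/-- A Salem set: a Borel set whose Fourier dimension agrees with its Hausdorff dimension. -/
def IsSalemSet (A : Set UnitAddCircle) : Prop :=
  MeasurableSet A ∧ setFourierDim A = dimH A

/-- The set of points of the circle `ℝ / ℤ` represented by a set of real numbers. -/
def circleImage (E : Set ℝ) : Set UnitAddCircle :=
  (fun t : ℝ => (t : UnitAddCircle)) '' E

/-- The parameter set `E` avoids isosceles triangles on the curve `γ`. -/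
def AvoidsIsoscelesTriangles {d : ℕ} (γ : ℝ → EuclideanSpace ℝ (Fin d)) (E : Set ℝ) : Prop :=
  ∀ t₁ ∈ E, ∀ t₂ ∈ E, ∀ t₃ ∈ E, t₁ ≠ t₂ → t₂ ≠ t₃ → t₁ ≠ t₃ →
    ‖γ t₁ - γ t₂‖ ≠ ‖γ t₂ - γ t₃‖

section Sampling

variable {Ω : Type*} [MeasurableSpace Ω] {μ : Measure Ω} [IsProbabilityMeasure μ]

theorem measureReal_le_average_sub_le {f : Ω → ℝ} (hf : Measurable f) (hf1 : ∀ a, |f a| ≤ 1)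
    {N : ℕ} (hN : 0 < N) {ε : ℝ} (hε : 0 ≤ ε) :
    (Measure.pi fun _ : Fin N ↦ μ).real {y | ε ≤ (∑ j, f (y j)) / N - ∫ a, f a ∂μ} ≤
      Real.exp (-(N * ε ^ 2 / 2)) := by
  have hsub : ∀ j ∈ Finset.univ, ProbabilityTheory.HasSubgaussianMGF
      (fun y : Fin N → Ω ↦ f (y j) - ∫ a, f a ∂μ) 1 (Measure.pi fun _ ↦ μ) := by
    intro j _
    have h := ProbabilityTheory.hasSubgaussianMGF_of_mem_Icc (μ := μ) hf.aemeasurable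
      (.of_forall fun a ↦ mem_Icc.2 (abs_le.1 (hf1 a)))
    have hc : (‖(1 : ℝ) - -1‖₊ / 2) ^ 2 = 1 := by
      rw [← NNReal.coe_inj]
      norm_num
    rw [hc] at h
    refine ProbabilityTheory.HasSubgaussianMGF.of_map (X := fun a ↦ f a - ∫ a, f a ∂μ)
      (measurable_pi_apply j).aemeasurable ?_
    rwa [(measurePreserving_eval (fun _ : Fin N ↦ μ) j).map_eq]
  have htail := ProbabilityTheory.HasSubgaussianMGF.measure_sum_ge_le_of_iIndepFun
    (ProbabilityTheory.iIndepFun_pi (μ := fun _ : Fin N ↦ μ)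
      fun _ ↦ (hf.sub_const (∫ a, f a ∂μ)).aemeasurable) hsub (mul_nonneg N.cast_nonneg hε)
  have hN0 : (0 : ℝ) < N := Nat.cast_pos.2 hN
  refine (measureReal_mono fun y hy ↦ ?_).trans (htail.trans_eq ?_)
  · have h : (N : ℝ) * ε ≤ N * ((∑ j, f (y j)) / N - ∫ a, f a ∂μ) :=
      mul_le_mul_of_nonneg_left hy hN0.le
    simpa [mul_sub, mul_div_cancel₀, hN0.ne'] using h
  · congr 1
    simp
    field_simp

theorem measureReal_le_abs_average_sub_le {f : Ω → ℝ} (hf : Measurable f) (hf1 : ∀ a, |f a| ≤ 1)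
    {N : ℕ} (hN : 0 < N) {ε : ℝ} (hε : 0 ≤ ε) :
    (Measure.pi fun _ : Fin N ↦ μ).real {y | ε ≤ |(∑ j, f (y j)) / N - ∫ a, f a ∂μ|} ≤
      2 * Real.exp (-(N * ε ^ 2 / 2)) := by
  have hneg := measureReal_le_average_sub_le (μ := μ) hf.neg (by simpa using hf1) hN hε
  have hunion : {y : Fin N → Ω | ε ≤ |(∑ j, f (y j)) / N - ∫ a, f a ∂μ|} ⊆
      {y | ε ≤ (∑ j, f (y j)) / N - ∫ a, f a ∂μ} ∪
        {y | ε ≤ (∑ j, (-f) (y j)) / N - ∫ a, (-f) a ∂μ} := by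
    intro y hy
    simp only [mem_union, mem_ofPred_eq, Pi.neg_apply, Finset.sum_neg_distrib, integral_neg,
      neg_div]
    exact (le_abs.1 hy).imp id fun h ↦ by linarith
  linarith [(measureReal_mono (μ := Measure.pi fun _ ↦ μ) hunion).trans (measureReal_union_le _ _),
    measureReal_le_average_sub_le (μ := μ) hf hf1 hN hε]

theorem measureReal_lt_norm_average_sub_le {g : Ω → ℂ} (hg : Measurable g) (hg1 : ∀ a, ‖g a‖ ≤ 1)
    {N : ℕ} (hN : 0 < N) {ε : ℝ} (hε : 0 ≤ ε) :
    (Measure.pi fun _ : Fin N ↦ μ).real {y | ε < ‖(∑ j, g (y j)) / N - ∫ a, g a ∂μ‖} ≤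
      4 * Real.exp (-(N * ε ^ 2 / 8)) := by
  have hint : Integrable g μ := .of_bound hg.aestronglyMeasurable 1 (.of_forall hg1)
  have hexp : N * (ε / 2) ^ 2 / 2 = N * ε ^ 2 / 8 := by ring
  have hre := measureReal_le_abs_average_sub_le (μ := μ) (Complex.measurable_re.comp hg)
    (fun a ↦ (Complex.abs_re_le_norm _).trans (hg1 a)) hN (div_nonneg hε zero_le_two)
  have him := measureReal_le_abs_average_sub_le (μ := μ) (Complex.measurable_im.comp hg)
    (fun a ↦ (Complex.abs_im_le_norm _).trans (hg1 a)) hN (div_nonneg hε zero_le_two)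
  have hunion : {y : Fin N → Ω | ε < ‖(∑ j, g (y j)) / N - ∫ a, g a ∂μ‖} ⊆
      {y | ε / 2 ≤ |(∑ j, (Complex.re ∘ g) (y j)) / N - ∫ a, (Complex.re ∘ g) a ∂μ|} ∪
        {y | ε / 2 ≤ |(∑ j, (Complex.im ∘ g) (y j)) / N - ∫ a, (Complex.im ∘ g) a ∂μ|} := by
    intro y hy
    have hreal : (∫ a, g a ∂μ).re = ∫ a, (g a).re ∂μ := (integral_re hint).symm
    have himag : (∫ a, g a ∂μ).im = ∫ a, (g a).im ∂μ := (integral_im hint).symm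
    have hsum := hy.trans_le (Complex.norm_le_abs_re_add_abs_im _)
    rw [Complex.sub_re, Complex.sub_im, Complex.div_natCast_re, Complex.div_natCast_im,
      Complex.re_sum, Complex.im_sum, hreal, himag] at hsum
    by_contra! h
    simp only [mem_union, mem_ofPred_eq, not_or, not_le, Function.comp_apply] at h
    linarith [h.1, h.2]
  rw [hexp] at hre him
  linarith [(measureReal_mono (μ := Measure.pi fun _ ↦ μ) hunion).trans (measureReal_union_le _ _)]

/-- The factor by which the sampling error for `n` tests may exceed `N ^ (-1 / 2)`. -/
noncomputable def samplingFactor (n : ℕ) : ℝ := 2 * (Real.log (8 * n) + 1)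

theorem samplingFactor_nonneg (n : ℕ) : 0 ≤ samplingFactor n := by
  have hlog : 0 ≤ Real.log (8 * n) := by exact_mod_cast Real.log_natCast_nonneg (8 * n)
  unfold samplingFactor
  positivity

theorem samplingFactor_mono {m n : ℕ} (hm : 0 < m) (hmn : m ≤ n) :
    samplingFactor m ≤ samplingFactor n := by
  unfold samplingFactor
  gcongr

theorem card_mul_exp_samplingFactor_le (n : ℕ) :
    n * (4 * Real.exp (-(samplingFactor n ^ 2 / 8))) ≤ 1 / 2 := by
  rcases n.eq_zero_or_pos with rfl | hn
  · norm_num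
  have hexp : Real.exp (-(samplingFactor n ^ 2 / 8)) ≤ (8 * n : ℝ)⁻¹ := by
    rw [← Real.exp_log (inv_pos.2 (by positivity : (0 : ℝ) < 8 * n)), Real.log_inv, samplingFactor]
    gcongr
    nlinarith [sq_nonneg (Real.log (8 * n))]
  calc n * (4 * Real.exp (-(samplingFactor n ^ 2 / 8))) ≤ n * (4 * (8 * n : ℝ)⁻¹) := by gcongr
    _ = 1 / 2 := by field_simp; norm_num

theorem measureReal_exists_lt_norm_average_sub_le {ι : Type*} (T : Finset ι) {g : ι → Ω → ℂ}
    (hg : ∀ m ∈ T, Measurable (g m)) (hg1 : ∀ m ∈ T, ∀ a, ‖g m a‖ ≤ 1) {N : ℕ} (hN : 0 < N) :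
    (Measure.pi fun _ : Fin N ↦ μ).real {y | ∃ m ∈ T,
      samplingFactor T.card / √N < ‖(∑ j, g m (y j)) / N - ∫ a, g m a ∂μ‖} ≤ 1 / 2 := by
  have hexp : (N : ℝ) * (samplingFactor T.card / √N) ^ 2 / 8 = samplingFactor T.card ^ 2 / 8 := by
    rw [div_pow, Real.sq_sqrt N.cast_nonneg]
    field_simp
  have hunion : {y : Fin N → Ω | ∃ m ∈ T,
      samplingFactor T.card / √N < ‖(∑ j, g m (y j)) / N - ∫ a, g m a ∂μ‖} =
      ⋃ m ∈ T, {y | samplingFactor T.card / √N < ‖(∑ j, g m (y j)) / N - ∫ a, g m a ∂μ‖} := by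
    ext y
    simp only [mem_ofPred_eq, mem_iUnion, exists_prop]
  calc
    _ ≤ ∑ m ∈ T, (Measure.pi fun _ : Fin N ↦ μ).real
        {y | samplingFactor T.card / √N < ‖(∑ j, g m (y j)) / N - ∫ a, g m a ∂μ‖} := by
      rw [hunion]
      exact measureReal_biUnion_finset_le _ _
    _ ≤ T.card * (4 * Real.exp (-(samplingFactor T.card ^ 2 / 8))) := by
      rw [← nsmul_eq_mul, ← hexp]
      exact Finset.sum_le_card_nsmul _ _ _ fun m hm ↦
        measureReal_lt_norm_average_sub_le (hg m hm) (hg1 m hm) hN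
          (div_nonneg (samplingFactor_nonneg _) (Real.sqrt_nonneg _))
    _ ≤ 1 / 2 := card_mul_exp_samplingFactor_le _

theorem measurable_apply_pair {ι : Type*} {O : Ω → Ω → ℝ≥0∞} (hO : Measurable (Function.uncurry O))
    (i j : ι) : Measurable fun y : ι → Ω ↦ O (y i) (y j) :=
  hO.comp (by fun_prop : Measurable fun y : ι → Ω ↦ (y i, y j))

theorem lintegral_pi_apply_pair {ι : Type*} [Fintype ι] {i j : ι} (hij : i ≠ j)
    {O : Ω → Ω → ℝ≥0∞} (hO : Measurable (Function.uncurry O)) :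
    ∫⁻ y, O (y i) (y j) ∂Measure.pi (fun _ : ι ↦ μ) = ∫⁻ a, ∫⁻ b, O a b ∂μ ∂μ := by
  have hindep := (ProbabilityTheory.iIndepFun_pi (μ := fun _ : ι ↦ μ) (X := fun _ ↦ id)
    fun _ ↦ aemeasurable_id).indepFun hij
  have hmap : (Measure.pi fun _ : ι ↦ μ).map (fun y ↦ (y i, y j)) = μ.prod μ := by
    have h := (ProbabilityTheory.indepFun_iff_map_prod_eq_prod_map_map
      (measurable_pi_apply i).aemeasurable (measurable_pi_apply j).aemeasurable).1 hindep
    simpa only [id_eq, (measurePreserving_eval (fun _ : ι ↦ μ) _).map_eq] using h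
  calc ∫⁻ y, O (y i) (y j) ∂Measure.pi (fun _ : ι ↦ μ)
      = ∫⁻ q, Function.uncurry O q ∂μ.prod μ := by
        rw [← hmap, lintegral_map hO (by fun_prop)]
        rfl
    _ = ∫⁻ a, ∫⁻ b, O a b ∂μ ∂μ := lintegral_prod _ hO.aemeasurable

theorem measurable_sum_offDiag {O : Ω → Ω → ℝ≥0∞} (hO : Measurable (Function.uncurry O)) (N : ℕ) :
    Measurable fun y : Fin N → Ω ↦ ∑ q ∈ Finset.univ.offDiag, O (y q.1) (y q.2) :=
  Finset.measurable_sum _ fun q _ ↦ measurable_apply_pair hO q.1 q.2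

theorem lintegral_pi_sum_offDiag_le {O : Ω → Ω → ℝ≥0∞} (hO : Measurable (Function.uncurry O))
    {o : ℝ≥0∞} (ho : ∀ a, ∫⁻ b, O a b ∂μ ≤ o) (N : ℕ) :
    ∫⁻ y, ∑ q ∈ Finset.univ.offDiag, O (y q.1) (y q.2) ∂Measure.pi (fun _ : Fin N ↦ μ) ≤
      N ^ 2 * o := by
  have hpair : ∀ q ∈ Finset.univ.offDiag,
      ∫⁻ y, O (y q.1) (y q.2) ∂Measure.pi (fun _ : Fin N ↦ μ) ≤ o := by
    intro q hq
    rw [lintegral_pi_apply_pair (Finset.mem_offDiag.1 hq).2.2 hO]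
    exact (lintegral_mono ho).trans_eq (by simp)
  have hcard : ((Finset.univ : Finset (Fin N)).offDiag.card : ℝ≥0∞) ≤ N ^ 2 := by
    rw [Finset.offDiag_card, Finset.card_univ, Fintype.card_fin, sq]
    exact_mod_cast Nat.sub_le _ _
  rw [lintegral_finsetSum _ fun q _ ↦ measurable_apply_pair hO q.1 q.2]
  calc _ ≤ (Finset.univ : Finset (Fin N)).offDiag.card • o := Finset.sum_le_card_nsmul _ _ _ hpair
    _ ≤ N ^ 2 * o := by
      rw [nsmul_eq_mul]
      gcongr

theorem exists_sample_of_norm_le_one {ι : Type*} (T : Finset ι) {g : ι → Ω → ℂ}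
    (hg : ∀ m ∈ T, Measurable (g m)) (hg1 : ∀ m ∈ T, ∀ a, ‖g m a‖ ≤ 1)
    {O : Ω → Ω → ℝ≥0∞} (hO : Measurable (Function.uncurry O)) {o : ℝ≥0∞}
    (ho : ∀ a, ∫⁻ b, O a b ∂μ ≤ o) {p : Ω → Prop} (hp : ∀ᵐ a ∂μ, p a) {N : ℕ} (hN : 0 < N) :
    ∃ y : Fin N → Ω, (∀ j, p (y j)) ∧
      (∀ m ∈ T, ‖(∑ j, g m (y j)) / N - ∫ a, g m a ∂μ‖ ≤ samplingFactor T.card / √N) ∧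
      ∑ q ∈ Finset.univ.offDiag, O (y q.1) (y q.2) ≤ 2 * N ^ 2 * o := by
  set P := Measure.pi fun _ : Fin N ↦ μ
  set bad : Set (Fin N → Ω) := {y | ∃ m ∈ T,
    samplingFactor T.card / √N < ‖(∑ j, g m (y j)) / N - ∫ a, g m a ∂μ‖}
  have hp' : ∀ᵐ y ∂P, y ∈ {y : Fin N → Ω | ∀ j, p (y j)} := ae_all_iff.2 fun j ↦
    (Measure.quasiMeasurePreserving_eval (fun _ : Fin N ↦ μ) j).ae hp
  have hbad : P bad ≤ 2⁻¹ := by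
    have h := measureReal_exists_lt_norm_average_sub_le (μ := μ) T hg hg1 hN
    rw [one_div, ← ENNReal.ofReal_le_ofReal_iff (by norm_num), ofReal_measureReal,
      ENNReal.ofReal_inv_of_pos zero_lt_two, ENNReal.ofReal_ofNat] at h
    exact h
  have hgood : 2⁻¹ ≤ P ({y | ∀ j, p (y j)} ∩ badᶜ) := by
    rw [Measure.measure_inter_eq_of_ae hp', ← ENNReal.add_le_add_iff_left (a := 2⁻¹) (by simp),
      ENNReal.inv_two_add_inv_two, ← measure_univ (μ := P), ← union_compl_self bad]
    exact (measure_union_le _ _).trans (add_le_add_left hbad _)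
  obtain ⟨y, ⟨hyp, hybad⟩, hy⟩ := exists_le_setLAverage (μ := P)
    (s := {y | ∀ j, p (y j)} ∩ badᶜ) (f := fun y ↦ ∑ q ∈ Finset.univ.offDiag, O (y q.1) (y q.2))
    (ne_of_gt (lt_of_lt_of_le (by simp) hgood)) (measure_ne_top _ _)
    (measurable_sum_offDiag hO N).aemeasurable
  refine ⟨y, hyp, fun m hm ↦ not_lt.1 fun h ↦ hybad ⟨m, hm, h⟩, hy.trans ?_⟩
  calc ⨍⁻ y in {y | ∀ j, p (y j)} ∩ badᶜ, ∑ q ∈ Finset.univ.offDiag, O (y q.1) (y q.2) ∂P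
      ≤ (N ^ 2 * o) / 2⁻¹ := by
        rw [setLAverage_eq]
        exact ENNReal.div_le_div ((setLIntegral_le_lintegral _ _).trans
          (lintegral_pi_sum_offDiag_le hO ho N)) hgood
    _ = 2 * N ^ 2 * o := by rw [div_eq_mul_inv, inv_inv]; ring

theorem exists_sample {ι : Type*} (T : Finset ι) {g : ι → Ω → ℂ} {c : ι → ℝ}
    (hg : ∀ m ∈ T, Measurable (g m)) (hc : ∀ m ∈ T, ∀ a, ‖g m a‖ ≤ c m)
    {O : Ω → Ω → ℝ≥0∞} (hO : Measurable (Function.uncurry O)) {o : ℝ≥0∞}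
    (ho : ∀ a, ∫⁻ b, O a b ∂μ ≤ o) {p : Ω → Prop} (hp : ∀ᵐ a ∂μ, p a) {N : ℕ} (hN : 0 < N) :
    ∃ y : Fin N → Ω, (∀ j, p (y j)) ∧
      (∀ m ∈ T, ‖(∑ j, g m (y j)) / N - ∫ a, g m a ∂μ‖ ≤ c m * (samplingFactor T.card / √N)) ∧
      ∑ q ∈ Finset.univ.offDiag, O (y q.1) (y q.2) ≤ 2 * N ^ 2 * o := by
  have hc0 : ∀ m ∈ T, 0 ≤ c m := fun m hm ↦
    (norm_nonneg _).trans (hc m hm (nonempty_of_isProbabilityMeasure μ).some)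
  obtain ⟨y, hyp, hy, hcost⟩ := exists_sample_of_norm_le_one T (g := fun m a ↦ (c m)⁻¹ • g m a)
    (fun m hm ↦ (hg m hm).const_smul (c m)⁻¹) (fun m hm a ↦ by
      rw [norm_smul, Real.norm_of_nonneg (inv_nonneg.2 (hc0 m hm))]
      exact inv_mul_le_one_of_le₀ (hc m hm a) (hc0 m hm)) hO ho hp hN
  refine ⟨y, hyp, fun m hm ↦ ?_, hcost⟩
  have hscale (a : Ω) : c m • (c m)⁻¹ • g m a = g m a := by
    rcases (hc0 m hm).eq_or_lt with h0 | hpos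
    · rw [norm_le_zero_iff.1 ((hc m hm a).trans_eq h0.symm), smul_zero, smul_zero]
    · exact smul_inv_smul₀ hpos.ne' _
  calc ‖(∑ j, g m (y j)) / N - ∫ a, g m a ∂μ‖
      = ‖c m • ((∑ j, (c m)⁻¹ • g m (y j)) / N - ∫ a, (c m)⁻¹ • g m a ∂μ)‖ := by
        simp only [smul_sub, ← integral_smul, ← smul_div_assoc, Finset.smul_sum, hscale]
    _ ≤ c m * (samplingFactor T.card / √N) := by
        rw [norm_smul, Real.norm_of_nonneg (hc0 m hm)]
        exact mul_le_mul_of_nonneg_left (hy m hm) (hc0 m hm)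

end Sampling

section Thinning

variable {Ω : Type*} [MeasurableSpace Ω] {μ : Measure Ω} {S : Ω → ℕ} {h : Ω → ℝ} {η : ℝ}

/-- A random count `S`, usually zero, together with a small compensator `h` for it: the first
moment of `S` is at most `η`, and its second factorial moment is at most `2 * η ^ 2`. -/
structure IsSparseCount (μ : Measure Ω) (S : Ω → ℕ) (h : Ω → ℝ) (η : ℝ) : Prop where
  measurable_count : Measurable S
  measurable_compensator : Measurable h
  compensator_mem : ∀ z, h z ∈ Icc 0 η
  integrable_sq : Integrable (fun z ↦ (S z : ℝ) ^ 2) μ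
  integral_count_le : ∫ z, (S z : ℝ) ∂μ ≤ η
  integral_factorial_moment_le : ∫ z, ((S z : ℝ) ^ 2 - S z) ∂μ ≤ 2 * η ^ 2

/-- The density `1 + h` restricted to the zeros of the count `S`; the summand `h` makes up for the
deleted mass to first order. -/
noncomputable def thinnedDensity (S : Ω → ℕ) (h : Ω → ℝ) (z : Ω) : ℝ :=
  if S z = 0 then 1 + h z else 0

theorem abs_indicator_zero_sub_le (s : ℕ) :
    |(if s = 0 then 1 else 0) - 1 + (s : ℝ)| ≤ ((s : ℝ) ^ 2 - s) / 2 := by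
  rcases s with _ | s
  · simp
  · have h : (0 : ℝ) ≤ s ^ 2 - s := by
      rw [sub_nonneg]
      exact_mod_cast Nat.le_self_pow two_ne_zero s
    simp only [Nat.add_eq_zero_iff, one_ne_zero, and_false, ↓reduceIte, Nat.cast_add, Nat.cast_one]
    rw [abs_of_nonneg (by linarith [s.cast_nonneg (α := ℝ)])]
    linarith

namespace IsSparseCount

theorem nonneg (hS : IsSparseCount μ S h η) : 0 ≤ η :=
  (integral_nonneg fun _ ↦ Nat.cast_nonneg _).trans hS.integral_count_le

theorem integrable_count [IsFiniteMeasure μ] (hS : IsSparseCount μ S h η) :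
    Integrable (fun z ↦ (S z : ℝ)) μ := by
  refine (hS.integrable_sq.add (integrable_const 1)).mono'
    (measurable_from_nat.comp hS.measurable_count).aestronglyMeasurable (.of_forall fun z ↦ ?_)
  rw [Real.norm_of_nonneg (Nat.cast_nonneg _)]
  simp only [Pi.add_apply]
  nlinarith [sq_nonneg ((S z : ℝ) - 1)]

theorem measurable_thinnedDensity (hS : IsSparseCount μ S h η) :
    Measurable (thinnedDensity S h) :=
  Measurable.ite (hS.measurable_count (measurableSet_singleton 0))
    (hS.measurable_compensator.const_add 1) measurable_const

theorem thinnedDensity_mem (hS : IsSparseCount μ S h η) (z : Ω) :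
    thinnedDensity S h z ∈ Icc 0 (1 + η) := by
  have hz := hS.compensator_mem z
  unfold thinnedDensity
  split_ifs <;> constructor <;> linarith [hz.1, hz.2]

theorem integrable_thinnedDensity [IsFiniteMeasure μ] (hS : IsSparseCount μ S h η) :
    Integrable (thinnedDensity S h) μ :=
  .of_mem_Icc 0 (1 + η) hS.measurable_thinnedDensity.aemeasurable
    (.of_forall hS.thinnedDensity_mem)

theorem integrable_compensator [IsFiniteMeasure μ] (hS : IsSparseCount μ S h η) :
    Integrable h μ :=
  .of_mem_Icc 0 η hS.measurable_compensator.aemeasurable (.of_forall hS.compensator_mem)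

theorem abs_thinnedDensity_sub_le (hS : IsSparseCount μ S h η) (z : Ω) :
    |thinnedDensity S h z - 1 - (h z - S z)| ≤ ((S z : ℝ) ^ 2 - S z) / 2 + η * S z := by
  have hsplit : thinnedDensity S h z - 1 - (h z - S z) =
      ((if S z = 0 then 1 else 0) - 1 + (S z : ℝ)) - h z * (if S z = 0 then 0 else 1) := by
    unfold thinnedDensity
    split_ifs <;> ring
  have hdeleted : |h z * (if S z = 0 then 0 else 1)| ≤ η * S z := by
    obtain ⟨h0, hη⟩ := hS.compensator_mem z
    split_ifs with hz
    · simp [hz]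
    · rw [mul_one, abs_of_nonneg h0]
      have hone : (1 : ℝ) ≤ S z := Nat.one_le_cast.2 (Nat.one_le_iff_ne_zero.2 hz)
      nlinarith
  rw [hsplit]
  exact (abs_sub _ _).trans (add_le_add (abs_indicator_zero_sub_le _) hdeleted)

theorem norm_integral_thinnedDensity_smul_sub_le [IsFiniteMeasure μ] (hS : IsSparseCount μ S h η)
    {e : Ω → ℂ} (he : Measurable e) (he1 : ∀ z, ‖e z‖ ≤ 1) {k : ℝ}
    (hk : ‖∫ z, (h z - S z) • e z ∂μ‖ ≤ k) :
    ‖∫ z, thinnedDensity S h z • e z ∂μ - ∫ z, e z ∂μ‖ ≤ k + 2 * η ^ 2 := by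
  have hsmul {f : Ω → ℝ} (hf : Integrable f μ) : Integrable (fun z ↦ f z • e z) μ :=
    hf.smul_bdd 1 he.aestronglyMeasurable (.of_forall he1)
  have hdiff : Integrable (fun z ↦ h z - (S z : ℝ)) μ :=
    hS.integrable_compensator.sub hS.integrable_count
  have hfact : Integrable (fun z ↦ (S z : ℝ) ^ 2 - S z) μ :=
    hS.integrable_sq.sub hS.integrable_count
  have hrem : Integrable (fun z ↦ thinnedDensity S h z - 1 - (h z - S z)) μ :=
    (hS.integrable_thinnedDensity.sub (integrable_const 1)).sub hdiff
  have he_int : Integrable e μ := .of_bound he.aestronglyMeasurable 1 (.of_forall he1)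
  have hsplit : ∫ z, thinnedDensity S h z • e z ∂μ - ∫ z, e z ∂μ =
      ∫ z, (h z - S z) • e z ∂μ + ∫ z, (thinnedDensity S h z - 1 - (h z - S z)) • e z ∂μ := by
    rw [← integral_add (hsmul hdiff) (hsmul hrem),
      ← integral_sub (hsmul hS.integrable_thinnedDensity) he_int]
    congr 1 with z
    module
  have hrest : ‖∫ z, (thinnedDensity S h z - 1 - (h z - S z)) • e z ∂μ‖ ≤ 2 * η ^ 2 := calc
    _ ≤ ∫ z, (((S z : ℝ) ^ 2 - S z) / 2 + η * S z) ∂μ := by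
      refine norm_integral_le_of_norm_le ((hfact.div_const 2).add
        (hS.integrable_count.const_mul η)) (.of_forall fun z ↦ ?_)
      rw [norm_smul, Real.norm_eq_abs]
      exact (mul_le_of_le_one_right (abs_nonneg _) (he1 z)).trans (hS.abs_thinnedDensity_sub_le z)
    _ = (∫ z, ((S z : ℝ) ^ 2 - S z) ∂μ) / 2 + η * ∫ z, (S z : ℝ) ∂μ := by
      rw [integral_add (hfact.div_const 2) (hS.integrable_count.const_mul η), integral_div,
        integral_const_mul]
    _ ≤ 2 * η ^ 2 := by
      nlinarith [hS.nonneg, hS.integral_count_le, hS.integral_factorial_moment_le]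
  rw [hsplit]
  exact (norm_add_le _ _).trans (add_le_add hk hrest)

end IsSparseCount

/-- The probability measure with density proportional to `thinnedDensity S h`. -/
noncomputable def thinnedMeasure (μ : Measure Ω) (S : Ω → ℕ) (h : Ω → ℝ) : Measure Ω :=
  μ.withDensity fun z ↦ ENNReal.ofReal (thinnedDensity S h z / ∫ z, thinnedDensity S h z ∂μ)

theorem thinnedMeasure_absolutelyContinuous : thinnedMeasure μ S h ≪ μ :=
  withDensity_absolutelyContinuous _ _

namespace IsSparseCount

theorem integral_thinnedMeasure (hS : IsSparseCount μ S h η) (e : Ω → ℂ) :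
    ∫ z, e z ∂thinnedMeasure μ S h =
      (∫ z, thinnedDensity S h z ∂μ)⁻¹ • ∫ z, thinnedDensity S h z • e z ∂μ := by
  have hnonneg (z : Ω) : 0 ≤ thinnedDensity S h z / ∫ z, thinnedDensity S h z ∂μ :=
    div_nonneg (hS.thinnedDensity_mem z).1 (integral_nonneg fun z ↦ (hS.thinnedDensity_mem z).1)
  rw [thinnedMeasure, integral_withDensity_eq_integral_toReal_smul
    (hS.measurable_thinnedDensity.div_const _).ennreal_ofReal (by simp), ← integral_smul]
  congr 1 with z
  rw [ENNReal.toReal_ofReal (hnonneg z), smul_smul, div_eq_inv_mul]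

theorem isProbabilityMeasure_thinnedMeasure [IsFiniteMeasure μ] (hS : IsSparseCount μ S h η)
    (hpos : 0 < ∫ z, thinnedDensity S h z ∂μ) : IsProbabilityMeasure (thinnedMeasure μ S h) := by
  refine ⟨?_⟩
  rw [thinnedMeasure, withDensity_apply _ .univ, Measure.restrict_univ,
    ← ofReal_integral_eq_lintegral_ofReal (hS.integrable_thinnedDensity.div_const _)
      (.of_forall fun z ↦ div_nonneg (hS.thinnedDensity_mem z).1 hpos.le),
    integral_div, div_self hpos.ne', ENNReal.ofReal_one]

theorem ae_thinnedMeasure_count_eq_zero (hS : IsSparseCount μ S h η) :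
    ∀ᵐ z ∂thinnedMeasure μ S h, S z = 0 := by
  rw [thinnedMeasure, ae_withDensity_iff (hS.measurable_thinnedDensity.div_const _).ennreal_ofReal]
  refine .of_forall fun z hz ↦ ?_
  by_contra h0
  simp [thinnedDensity, h0] at hz

theorem abs_integral_thinnedDensity_sub_one_le [IsProbabilityMeasure μ]
    (hS : IsSparseCount μ S h η) {k : ℝ} (hk : |∫ z, (h z - S z) ∂μ| ≤ k) :
    |∫ z, thinnedDensity S h z ∂μ - 1| ≤ k + 2 * η ^ 2 := by
  have hnorm : ‖∫ z, (h z - S z) • (1 : ℂ) ∂μ‖ ≤ k := by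
    rwa [integral_smul_const, norm_smul, norm_one, mul_one]
  have hcomplex := hS.norm_integral_thinnedDensity_smul_sub_le measurable_const (by simp) hnorm
  rwa [integral_smul_const, integral_const, probReal_univ, ← sub_smul, norm_smul, norm_one,
    mul_one] at hcomplex

theorem norm_integral_thinnedMeasure_sub_le [IsProbabilityMeasure μ]
    (hS : IsSparseCount μ S h η) {k : ℝ} (hk : |∫ z, (h z - S z) ∂μ| ≤ k)
    (hpos : 0 < ∫ z, thinnedDensity S h z ∂μ) {e : Ω → ℂ} (he : Measurable e)
    (he1 : ∀ z, ‖e z‖ ≤ 1) (hke : ‖∫ z, (h z - S z) • e z ∂μ‖ ≤ k) :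
    ‖∫ z, e z ∂thinnedMeasure μ S h - ∫ z, e z ∂μ‖ ≤ 2 * (k + 2 * η ^ 2) := by
  set W := ∫ z, thinnedDensity S h z ∂μ
  set A := ∫ z, thinnedDensity S h z • e z ∂μ
  have hA : ‖A‖ ≤ W := norm_integral_le_of_norm_le hS.integrable_thinnedDensity
    (.of_forall fun z ↦ by
      rw [norm_smul, Real.norm_of_nonneg (hS.thinnedDensity_mem z).1]
      exact mul_le_of_le_one_right (hS.thinnedDensity_mem z).1 (he1 z))
  have hnormalize : ‖W⁻¹ • A - A‖ ≤ k + 2 * η ^ 2 := calc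
    ‖W⁻¹ • A - A‖ = W⁻¹ * ‖A‖ * |W - 1| := by
      have hfactor : W⁻¹ • A - A = (W⁻¹ * (1 - W)) • A := by
        rw [mul_one_sub, inv_mul_cancel₀ hpos.ne', sub_smul, one_smul]
      rw [hfactor, norm_smul, norm_mul, Real.norm_of_nonneg (inv_nonneg.2 hpos.le),
        Real.norm_eq_abs, abs_sub_comm]
      ring
    _ ≤ 1 * |W - 1| := by
      gcongr
      exact inv_mul_le_one_of_le₀ hA hpos.le
    _ ≤ k + 2 * η ^ 2 := by
      rw [one_mul]
      exact hS.abs_integral_thinnedDensity_sub_one_le hk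
  rw [hS.integral_thinnedMeasure e, two_mul]
  exact (norm_sub_le_norm_sub_add_norm_sub _ A _).trans
    (add_le_add hnormalize (hS.norm_integral_thinnedDensity_smul_sub_le he he1 hke))

theorem exists_sample [IsProbabilityMeasure μ] (hS : IsSparseCount μ S h η) {k : ℝ}
    (hk : |∫ z, (h z - S z) ∂μ| ≤ k) (hkη : k + 2 * η ^ 2 < 1) {ι : Type*} (T : Finset ι)
    {e : ι → Ω → ℂ} (he : ∀ m ∈ T, Measurable (e m)) (he1 : ∀ m ∈ T, ∀ z, ‖e m z‖ ≤ 1)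
    (hke : ∀ m ∈ T, ‖∫ z, (h z - S z) • e m z ∂μ‖ ≤ k) {p : Ω → Prop} (hp : ∀ᵐ z ∂μ, p z)
    {N : ℕ} (hN : 0 < N) :
    ∃ z : Fin N → Ω, (∀ j, p (z j)) ∧ (∀ j, S (z j) = 0) ∧
      ∀ m ∈ T, ‖(∑ j, e m (z j)) / N - ∫ z, e m z ∂μ‖ ≤
        samplingFactor T.card / √N + 2 * (k + 2 * η ^ 2) := by
  have hpos : 0 < ∫ z, thinnedDensity S h z ∂μ := by
    linarith [(abs_le.1 (hS.abs_integral_thinnedDensity_sub_one_le hk)).1]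
  have := hS.isProbabilityMeasure_thinnedMeasure hpos
  have hae : ∀ᵐ z ∂thinnedMeasure μ S h, p z ∧ S z = 0 := by
    filter_upwards [thinnedMeasure_absolutelyContinuous.ae_le hp,
      hS.ae_thinnedMeasure_count_eq_zero] with z hpz hSz using ⟨hpz, hSz⟩
  obtain ⟨z, hz, hsample, -⟩ := exists_sample_of_norm_le_one (μ := thinnedMeasure μ S h) T he he1
    (O := fun _ _ ↦ 0) measurable_const (o := 0) (by simp) hae hN
  exact ⟨z, fun j ↦ (hz j).1, fun j ↦ (hz j).2, fun m hm ↦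
    (norm_sub_le_norm_sub_add_norm_sub _ (∫ z, e m z ∂thinnedMeasure μ S h) _).trans
      (add_le_add (hsample m hm)
        (hS.norm_integral_thinnedMeasure_sub_le hk hpos (he m hm) (he1 m hm) (hke m hm)))⟩

end IsSparseCount

end Thinning

section AvoidingSamples

open scoped NNReal

variable {α β γ : Type*} [MeasurableSpace α] [MeasurableSpace β] [MeasurableSpace γ]
  {μ₁ : Measure α} {μ₂ : Measure β} {μ₃ : Measure γ} {B : Set (α × β × γ)} {near : Set (α × α)}
  {σ : ℝ≥0} {N : ℕ}

/-- A set `B` of forbidden triples all of whose sections have measure at most `σ`; the sections in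
the first coordinate have to consist of points which are pairwise `near`. -/
structure IsSparseRelation (μ₁ : Measure α) (μ₂ : Measure β) (μ₃ : Measure γ)
    (B : Set (α × β × γ)) (near : Set (α × α)) (σ : ℝ≥0) : Prop where
  measurableSet : MeasurableSet B
  measurableSet_near : MeasurableSet near
  measure_near_le : ∀ x, μ₁ {x' | (x, x') ∈ near} ≤ σ
  measure_snd_le : ∀ x z, μ₂ {y | (x, y, z) ∈ B} ≤ σ
  measure_thd_le : ∀ x y, μ₃ {z | (x, y, z) ∈ B} ≤ σ
  near_of_mem : ∀ {x x' y z}, (x, y, z) ∈ B → (x', y, z) ∈ B → (x, x') ∈ near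

/-- The number of sample points `x i` for which `(x i, y, z)` is forbidden. -/
noncomputable def hitCount (B : Set (α × β × γ)) (x : Fin N → α) (y : β) (z : γ) : ℕ :=
  ∑ i, B.indicator 1 (x i, y, z)

/-- The integral of `e z` over those `z` for which `(x, y, z)` is forbidden. -/
noncomputable def hitIntegral (μ₃ : Measure γ) (B : Set (α × β × γ)) (e : γ → ℂ) (x : α) (y : β) :
    ℂ :=
  ∫ z, B.indicator (fun p ↦ e p.2.2) (x, y, z) ∂μ₃

theorem integral_natCast_le_of_lintegral_le {μ : Measure α} {f : α → ℕ} (hf : Measurable f)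
    {c : ℝ≥0} (hc : ∫⁻ a, (f a : ℝ≥0∞) ∂μ ≤ c) : ∫ a, (f a : ℝ) ∂μ ≤ c := by
  have h := integral_toReal (μ := μ) (f := fun a ↦ (f a : ℝ≥0∞))
    (Measurable.of_discrete.comp hf).aemeasurable (.of_forall fun a ↦ ENNReal.natCast_lt_top _)
  simp only [ENNReal.toReal_natCast] at h
  rw [h]
  exact ENNReal.toReal_le_coe_of_le_coe hc

theorem sum_sq_sub_sum_eq_sum_offDiag {ι R : Type*} [CommRing R] (s : Finset ι)
    {a : ι → R} (ha : ∀ j ∈ s, IsIdempotentElem (a j)) :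
    (∑ j ∈ s, a j) ^ 2 - ∑ j ∈ s, a j = ∑ q ∈ s.offDiag, a q.1 * a q.2 := by
  classical
  have hdiag : ∑ q ∈ s.diag, a q.1 * a q.2 = ∑ j ∈ s, a j := by
    rw [Finset.sum_diag]
    exact Finset.sum_congr rfl ha
  rw [sq, Finset.sum_mul_sum, ← Finset.sum_product', ← Finset.diag_union_offDiag,
    Finset.sum_union s.disjoint_diag_offDiag, hdiag, add_sub_cancel_left]

namespace IsSparseRelation

theorem measurableSet_fst_snd (hB : IsSparseRelation μ₁ μ₂ μ₃ B near σ) (x : α) (y : β) :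
    MeasurableSet {z | (x, y, z) ∈ B} :=
  hB.measurableSet.preimage (by fun_prop)

theorem measurableSet_thd (hB : IsSparseRelation μ₁ μ₂ μ₃ B near σ) (z : γ) :
    MeasurableSet {p : α × β | (p.1, p.2, z) ∈ B} :=
  hB.measurableSet.preimage (by fun_prop)

theorem measurable_hitCount (hB : IsSparseRelation μ₁ μ₂ μ₃ B near σ) {Ω : Type*}
    [MeasurableSpace Ω] {y : Ω → β} {z : Ω → γ} (hy : Measurable y) (hz : Measurable z)
    (x : Fin N → α) : Measurable fun a ↦ hitCount B x (y a) (z a) :=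
  Finset.measurable_sum _ fun _ _ ↦
    (measurable_one.indicator hB.measurableSet).comp (by fun_prop)

theorem measurable_cast_hitCount (hB : IsSparseRelation μ₁ μ₂ μ₃ B near σ) {Ω : Type*}
    [MeasurableSpace Ω] {y : Ω → β} {z : Ω → γ} (hy : Measurable y) (hz : Measurable z)
    (x : Fin N → α) : Measurable fun a ↦ (hitCount B x (y a) (z a) : ℝ≥0∞) :=
  (Measurable.of_discrete (f := fun n : ℕ ↦ (n : ℝ≥0∞))).comp (hB.measurable_hitCount hy hz x)

theorem lintegral_hitCount (hB : IsSparseRelation μ₁ μ₂ μ₃ B near σ) {Ω : Type*}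
    [MeasurableSpace Ω] {μ : Measure Ω} {y : Ω → β} {z : Ω → γ} (hy : Measurable y)
    (hz : Measurable z) (x : Fin N → α) :
    ∫⁻ a, (hitCount B x (y a) (z a) : ℝ≥0∞) ∂μ = ∑ i, μ {a | (x i, y a, z a) ∈ B} := by
  have hmeas (i : Fin N) : MeasurableSet {a | (x i, y a, z a) ∈ B} :=
    hB.measurableSet.preimage (by fun_prop)
  have hcast (a : Ω) : (hitCount B x (y a) (z a) : ℝ≥0∞) =
      ∑ i, {a | (x i, y a, z a) ∈ B}.indicator 1 a := by
    classical
    simp [hitCount, indicator_apply]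
  simp_rw [hcast]
  rw [lintegral_finsetSum _ fun i _ ↦ measurable_one.indicator (hmeas i)]
  exact Finset.sum_congr rfl fun i _ ↦ lintegral_indicator_one (hmeas i)

theorem lintegral_hitCount_snd_le (hB : IsSparseRelation μ₁ μ₂ μ₃ B near σ) (x : Fin N → α)
    (z : γ) : ∫⁻ y, (hitCount B x y z : ℝ≥0∞) ∂μ₂ ≤ N * σ := by
  calc _ = ∑ i, μ₂ {y | (x i, y, z) ∈ B} :=
        hB.lintegral_hitCount measurable_id' measurable_const x
    _ ≤ ∑ _i : Fin N, (σ : ℝ≥0∞) := Finset.sum_le_sum fun i _ ↦ hB.measure_snd_le (x i) z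
    _ = N * σ := by simp

theorem lintegral_hitCount_thd_le (hB : IsSparseRelation μ₁ μ₂ μ₃ B near σ) (x : Fin N → α)
    (y : β) : ∫⁻ z, (hitCount B x y z : ℝ≥0∞) ∂μ₃ ≤ N * σ := by
  calc _ = ∑ i, μ₃ {z | (x i, y, z) ∈ B} :=
        hB.lintegral_hitCount measurable_const measurable_id' x
    _ ≤ ∑ _i : Fin N, (σ : ℝ≥0∞) := Finset.sum_le_sum fun i _ ↦ hB.measure_thd_le (x i) y
    _ = N * σ := by simp

theorem lintegral_lintegral_hitCount_mul_le (hB : IsSparseRelation μ₁ μ₂ μ₃ B near σ)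
    [SFinite μ₂] [SFinite μ₃] (x : Fin N → α) (y : β) :
    ∫⁻ y', ∫⁻ z, (hitCount B x y z * hitCount B x y' z : ℝ≥0∞) ∂μ₃ ∂μ₂ ≤ (N * σ) ^ 2 := by
  have hprod : Measurable fun p : β × γ ↦ (hitCount B x y p.2 * hitCount B x p.1 p.2 : ℝ≥0∞) :=
    (hB.measurable_cast_hitCount measurable_const measurable_snd x).mul
      (hB.measurable_cast_hitCount measurable_fst measurable_snd x)
  rw [lintegral_lintegral_swap hprod.aemeasurable]
  calc ∫⁻ z, ∫⁻ y', (hitCount B x y z * hitCount B x y' z : ℝ≥0∞) ∂μ₂ ∂μ₃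
      ≤ ∫⁻ z, hitCount B x y z * (N * σ) ∂μ₃ := by
        refine lintegral_mono fun z ↦ ?_
        rw [lintegral_const_mul _ (hB.measurable_cast_hitCount measurable_id' measurable_const x)]
        gcongr
        exact hB.lintegral_hitCount_snd_le x z
    _ ≤ (N * σ) ^ 2 := by
        rw [lintegral_mul_const _ (hB.measurable_cast_hitCount measurable_const measurable_id' x),
          sq]
        gcongr
        exact hB.lintegral_hitCount_thd_le x y

theorem hitCount_le_one (hB : IsSparseRelation μ₁ μ₂ μ₃ B near σ) {x : Fin N → α}
    (hx : ∀ i j, i ≠ j → (x i, x j) ∉ near) (y : β) (z : γ) : hitCount B x y z ≤ 1 := by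
  classical
  simp only [hitCount, indicator_apply, Pi.one_apply, Finset.sum_boole, Nat.cast_id]
  refine Finset.card_le_one.2 fun i hi j hj ↦ ?_
  by_contra hij
  exact hx i j hij (hB.near_of_mem (Finset.mem_filter.1 hi).2 (Finset.mem_filter.1 hj).2)

theorem measurable_hitIntegral (hB : IsSparseRelation μ₁ μ₂ μ₃ B near σ) [SFinite μ₃] {e : γ → ℂ}
    (he : Measurable e) : Measurable fun p : α × β ↦ hitIntegral μ₃ B e p.1 p.2 := by
  have hmeas : Measurable fun q : (α × β) × γ ↦
      B.indicator (fun p ↦ e p.2.2) (q.1.1, q.1.2, q.2) :=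
    ((by fun_prop : Measurable fun p : α × β × γ ↦ e p.2.2).indicator hB.measurableSet).comp
      (by fun_prop)
  exact hmeas.stronglyMeasurable.integral_prod_right.measurable

theorem norm_hitIntegral_le (hB : IsSparseRelation μ₁ μ₂ μ₃ B near σ) {e : γ → ℂ}
    (he1 : ∀ z, ‖e z‖ ≤ 1) (x : α) (y : β) : ‖hitIntegral μ₃ B e x y‖ ≤ σ := by
  have hfin : μ₃ {z | (x, y, z) ∈ B} < ⊤ := (hB.measure_thd_le x y).trans_lt ENNReal.coe_lt_top
  calc ‖hitIntegral μ₃ B e x y‖ = ‖∫ z in {z | (x, y, z) ∈ B}, e z ∂μ₃‖ := by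
        rw [← integral_indicator (hB.measurableSet_fst_snd x y)]
        rfl
    _ ≤ 1 * μ₃.real {z | (x, y, z) ∈ B} :=
        norm_setIntegral_le_of_norm_le_const hfin fun z _ ↦ he1 z
    _ ≤ σ := by
        rw [one_mul]
        exact ENNReal.toReal_le_coe_of_le_coe (hB.measure_thd_le x y)

theorem integrable_hitIntegral (hB : IsSparseRelation μ₁ μ₂ μ₃ B near σ) [IsFiniteMeasure μ₂]
    [SFinite μ₃] {e : γ → ℂ} (he : Measurable e) (he1 : ∀ z, ‖e z‖ ≤ 1) (x : α) :
    Integrable (fun y ↦ hitIntegral μ₃ B e x y) μ₂ :=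
  .of_bound ((hB.measurable_hitIntegral he).comp
    (by fun_prop : Measurable fun y : β ↦ (x, y))).aestronglyMeasurable σ
    (.of_forall fun y ↦ hB.norm_hitIntegral_le he1 x y)

theorem integrable_hitCount (hB : IsSparseRelation μ₁ μ₂ μ₃ B near σ) [IsFiniteMeasure μ₃]
    (x : Fin N → α) (y : β) : Integrable (fun z ↦ (hitCount B x y z : ℝ)) μ₃ := by
  have hmeas : Measurable fun z ↦ hitCount B x y z :=
    hB.measurable_hitCount measurable_const measurable_id' x
  refine .of_bound (measurable_from_nat.comp hmeas).aestronglyMeasurable N (.of_forall fun z ↦ ?_)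
  rw [Real.norm_of_nonneg (Nat.cast_nonneg _), Nat.cast_le]
  refine (Finset.sum_le_card_nsmul _ _ 1 fun i _ ↦ ?_).trans (by simp)
  exact indicator_le_self' (by simp) _

theorem integral_hitCount_smul (hB : IsSparseRelation μ₁ μ₂ μ₃ B near σ) [IsFiniteMeasure μ₃]
    {e : γ → ℂ} (he : Measurable e) (he1 : ∀ z, ‖e z‖ ≤ 1) (x : Fin N → α) (y : β) :
    ∫ z, (hitCount B x y z : ℝ) • e z ∂μ₃ = ∑ i, hitIntegral μ₃ B e (x i) y := by
  have hint (i : Fin N) : Integrable (fun z ↦ B.indicator (fun p ↦ e p.2.2) (x i, y, z)) μ₃ :=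
    (Integrable.of_bound he.aestronglyMeasurable 1 (.of_forall he1)).indicator
      (hB.measurableSet_fst_snd (x i) y)
  simp only [hitIntegral]
  rw [← integral_finsetSum _ fun i _ ↦ hint i]
  congr 1 with z
  classical
  simp [hitCount, indicator_apply, Finset.sum_ite]

theorem measureReal_prod_le (hB : IsSparseRelation μ₁ μ₂ μ₃ B near σ) [IsProbabilityMeasure μ₁]
    [SFinite μ₂] (z : γ) : (μ₁.prod μ₂).real {p | (p.1, p.2, z) ∈ B} ≤ σ := by
  refine ENNReal.toReal_le_coe_of_le_coe ?_
  rw [Measure.prod_apply (hB.measurableSet_thd z)]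
  exact (lintegral_mono fun x ↦ hB.measure_snd_le x z).trans (by simp)

theorem integral_measureReal_smul (hB : IsSparseRelation μ₁ μ₂ μ₃ B near σ) [IsFiniteMeasure μ₁]
    [IsFiniteMeasure μ₂] [IsFiniteMeasure μ₃] {e : γ → ℂ} (he : Measurable e)
    (he1 : ∀ z, ‖e z‖ ≤ 1) :
    ∫ z, (μ₁.prod μ₂).real {p | (p.1, p.2, z) ∈ B} • e z ∂μ₃ =
      ∫ x, ∫ y, hitIntegral μ₃ B e x y ∂μ₂ ∂μ₁ := by
  have hmeas : Measurable fun q : γ × α × β ↦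
      B.indicator (fun p ↦ e p.2.2) (q.2.1, q.2.2, q.1) :=
    ((by fun_prop : Measurable fun p : α × β × γ ↦ e p.2.2).indicator hB.measurableSet).comp
      (by fun_prop)
  have hint : Integrable (Function.uncurry fun z (p : α × β) ↦
      B.indicator (fun p ↦ e p.2.2) (p.1, p.2, z)) (μ₃.prod (μ₁.prod μ₂)) :=
    .of_bound hmeas.aestronglyMeasurable 1 (.of_forall fun q ↦
      (norm_indicator_le_norm_self (fun p : α × β × γ ↦ e p.2.2) _).trans (he1 q.1))
  have hslice (z : γ) : ∫ p : α × β, B.indicator (fun p ↦ e p.2.2) (p.1, p.2, z) ∂μ₁.prod μ₂ =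
      (μ₁.prod μ₂).real {p | (p.1, p.2, z) ∈ B} • e z := by
    rw [← setIntegral_const, ← integral_indicator (hB.measurableSet_thd z)]
    rfl
  simp_rw [← hslice]
  rw [integral_integral_swap hint]
  exact integral_prod _ hint.integral_prod_right


theorem measurable_measureReal_prod (hB : IsSparseRelation μ₁ μ₂ μ₃ B near σ)
    [SFinite μ₁] [SFinite μ₂] :
    Measurable fun z ↦ (μ₁.prod μ₂).real {p | (p.1, p.2, z) ∈ B} := by
  have hswap : MeasurableSet {q : γ × α × β | (q.2.1, q.2.2, q.1) ∈ B} :=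
    hB.measurableSet.preimage (by fun_prop)
  exact (measurable_measure_prodMk_left hswap).ennreal_toReal

theorem exists_separated_sample (hB : IsSparseRelation μ₁ μ₂ μ₃ B near σ)
    [IsProbabilityMeasure μ₁] {ι : Type*} (T : Finset ι) {g : ι → α → ℂ} {c : ι → ℝ}
    (hg : ∀ m ∈ T, Measurable (g m)) (hc : ∀ m ∈ T, ∀ x, ‖g m x‖ ≤ c m) {p : α → Prop}
    (hp : ∀ᵐ x ∂μ₁, p x) (hN : 0 < N) (hσ : 2 * N ^ 2 * σ < 1) :
    ∃ x : Fin N → α, (∀ i, p (x i)) ∧ (∀ i j, i ≠ j → (x i, x j) ∉ near) ∧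
      ∀ m ∈ T, ‖(∑ i, g m (x i)) / N - ∫ a, g m a ∂μ₁‖ ≤
        c m * (samplingFactor T.card / √N) := by
  have hnear (x : α) : ∫⁻ x', near.indicator 1 (x, x') ∂μ₁ ≤ σ := by
    refine le_of_eq_of_le ?_ (hB.measure_near_le x)
    exact lintegral_indicator_one (hB.measurableSet_near.preimage (by fun_prop))
  obtain ⟨x, hxp, hxT, hcost⟩ := exists_sample T hg hc
    (O := fun x x' ↦ near.indicator 1 (x, x')) (measurable_one.indicator hB.measurableSet_near)
    hnear hp hN
  refine ⟨x, hxp, fun i j hij hmem ↦ ?_, hxT⟩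
  have hone : near.indicator 1 (x i, x j) ≤
      ∑ q ∈ Finset.univ.offDiag, near.indicator (1 : α × α → ℝ≥0∞) (x q.1, x q.2) :=
    Finset.single_le_sum (f := fun q : Fin N × Fin N ↦ near.indicator 1 (x q.1, x q.2))
      (fun _ _ ↦ zero_le) (a := (i, j)) (by simpa using hij)
  rw [indicator_of_mem hmem, Pi.one_apply] at hone
  have hsmall : (2 * N ^ 2 * σ : ℝ≥0∞) < 1 := by exact_mod_cast hσ
  exact absurd (hone.trans hcost) (not_le.2 hsmall)

theorem exists_sample_sum_offDiag_le (hB : IsSparseRelation μ₁ μ₂ μ₃ B near σ)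
    [IsProbabilityMeasure μ₂] [SFinite μ₃] (x : Fin N → α) {ι : Type*} (T : Finset ι)
    {g : ι → β → ℂ} {c : ι → ℝ} (hg : ∀ m ∈ T, Measurable (g m))
    (hc : ∀ m ∈ T, ∀ y, ‖g m y‖ ≤ c m) {p : β → Prop} (hp : ∀ᵐ y ∂μ₂, p y) (hN : 0 < N) :
    ∃ y : Fin N → β, (∀ j, p (y j)) ∧
      (∀ m ∈ T, ‖(∑ j, g m (y j)) / N - ∫ a, g m a ∂μ₂‖ ≤
        c m * (samplingFactor T.card / √N)) ∧
      ∑ q ∈ Finset.univ.offDiag,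
        ∫⁻ z, (hitCount B x (y q.1) z * hitCount B x (y q.2) z : ℝ≥0∞) ∂μ₃ ≤
          2 * N ^ 2 * (N * σ) ^ 2 := by
  have hmeas : Measurable fun q : (β × β) × γ ↦
      (hitCount B x q.1.1 q.2 * hitCount B x q.1.2 q.2 : ℝ≥0∞) :=
    (hB.measurable_cast_hitCount (by fun_prop) (by fun_prop) x).mul
      (hB.measurable_cast_hitCount (by fun_prop) (by fun_prop) x)
  exact exists_sample T hg hc
    (O := fun y y' ↦ ∫⁻ z, (hitCount B x y z * hitCount B x y' z : ℝ≥0∞) ∂μ₃)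
    hmeas.lintegral_prod_right' (hB.lintegral_lintegral_hitCount_mul_le x) hp hN

theorem isSparseCount (hB : IsSparseRelation μ₁ μ₂ μ₃ B near σ) [IsProbabilityMeasure μ₁]
    [SFinite μ₂] [IsFiniteMeasure μ₃] {x : Fin N → α} (hx : ∀ i j, i ≠ j → (x i, x j) ∉ near)
    {y : Fin N → β} (hy : ∑ q ∈ Finset.univ.offDiag,
      ∫⁻ z, (hitCount B x (y q.1) z * hitCount B x (y q.2) z : ℝ≥0∞) ∂μ₃ ≤
        2 * N ^ 2 * (N * σ) ^ 2) :
    IsSparseCount μ₃ (fun z ↦ ∑ j, hitCount B x (y j) z)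
      (fun z ↦ N ^ 2 * (μ₁.prod μ₂).real {p | (p.1, p.2, z) ∈ B}) (N ^ 2 * σ) := by
  have hhit (j : Fin N) : Measurable fun z ↦ hitCount B x (y j) z :=
    hB.measurable_hitCount measurable_const measurable_id' x
  have hhit' (j : Fin N) : Measurable fun z ↦ (hitCount B x (y j) z : ℝ≥0∞) :=
    hB.measurable_cast_hitCount measurable_const measurable_id' x
  have hS : Measurable fun z ↦ ∑ j, hitCount B x (y j) z :=
    Finset.measurable_sum _ fun j _ ↦ hhit j
  have hle (z : γ) : ∑ j, hitCount B x (y j) z ≤ N :=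
    (Finset.sum_le_card_nsmul _ _ 1 fun j _ ↦ hB.hitCount_le_one hx (y j) z).trans (by simp)
  have hfact (z : γ) : ((∑ j, hitCount B x (y j) z : ℕ) : ℝ) ^ 2 - (∑ j, hitCount B x (y j) z : ℕ) =
      (∑ q ∈ Finset.univ.offDiag, hitCount B x (y q.1) z * hitCount B x (y q.2) z : ℕ) := by
    push_cast
    refine sum_sq_sub_sum_eq_sum_offDiag _ fun j _ ↦ ?_
    have hj := hB.hitCount_le_one hx (y j) z
    interval_cases hitCount B x (y j) z <;> simp [IsIdempotentElem]
  refine ⟨hS, hB.measurable_measureReal_prod.const_mul _, fun z ↦ ⟨by positivity,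
    mul_le_mul_of_nonneg_left (hB.measureReal_prod_le z) (by positivity)⟩, ?_, ?_, ?_⟩
  · refine .of_bound ((measurable_from_nat.comp hS).pow_const 2).aestronglyMeasurable (N ^ 2)
      (.of_forall fun z ↦ ?_)
    rw [Real.norm_of_nonneg (by positivity)]
    exact_mod_cast Nat.pow_le_pow_left (hle z) 2
  · refine (integral_natCast_le_of_lintegral_le (c := N ^ 2 * σ) hS ?_).trans_eq (by simp)
    push_cast
    rw [lintegral_finsetSum _ fun j _ ↦ hhit' j]
    refine (Finset.sum_le_card_nsmul _ _ _ fun j _ ↦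
      hB.lintegral_hitCount_thd_le x (y j)).trans_eq ?_
    simp [sq, mul_assoc]
  · simp only [hfact]
    refine (integral_natCast_le_of_lintegral_le (c := 2 * (N ^ 2 * σ) ^ 2)
      (Finset.measurable_sum _ fun q _ ↦ (hhit q.1).mul (hhit q.2)) ?_).trans_eq (by simp)
    push_cast
    rw [lintegral_finsetSum _ fun q _ ↦ (hhit' q.1).mul (hhit' q.2)]
    refine hy.trans_eq ?_
    ring

theorem norm_hitIntegral_average_le (hB : IsSparseRelation μ₁ μ₂ μ₃ B near σ) {e : γ → ℂ}
    (he1 : ∀ z, ‖e z‖ ≤ 1) (x : Fin N → α) (y : β) :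
    ‖(∑ i, hitIntegral μ₃ B e (x i) y) / N‖ ≤ σ := by
  rw [norm_div, Complex.norm_natCast]
  refine div_le_of_le_mul₀ N.cast_nonneg σ.coe_nonneg ?_
  refine (norm_sum_le_of_le _ fun i _ ↦ hB.norm_hitIntegral_le he1 (x i) y).trans_eq ?_
  simp [mul_comm]

theorem norm_integral_compensator_sub_count_le (hB : IsSparseRelation μ₁ μ₂ μ₃ B near σ)
    [IsProbabilityMeasure μ₁] [IsFiniteMeasure μ₂] [IsFiniteMeasure μ₃] {x : Fin N → α}
    {y : Fin N → β} (hS : IsSparseCount μ₃ (fun z ↦ ∑ j, hitCount B x (y j) z)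
      (fun z ↦ N ^ 2 * (μ₁.prod μ₂).real {p | (p.1, p.2, z) ∈ B}) (N ^ 2 * σ))
    {e : γ → ℂ} (he : Measurable e) (he1 : ∀ z, ‖e z‖ ≤ 1) (hN : 0 < N) {τ : ℝ}
    (hx : ‖(∑ i, ∫ y, hitIntegral μ₃ B e (x i) y ∂μ₂) / N -
      ∫ x, ∫ y, hitIntegral μ₃ B e x y ∂μ₂ ∂μ₁‖ ≤ σ * τ)
    (hy : ‖(∑ j, (∑ i, hitIntegral μ₃ B e (x i) (y j)) / N) / N -
      ∫ y, (∑ i, hitIntegral μ₃ B e (x i) y) / N ∂μ₂‖ ≤ σ * τ) :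
    ‖∫ z, (N ^ 2 * (μ₁.prod μ₂).real {p | (p.1, p.2, z) ∈ B} -
      (∑ j, hitCount B x (y j) z : ℕ)) • e z ∂μ₃‖ ≤ 2 * (N ^ 2 * σ) * τ := by
  have hsmul {f : γ → ℝ} (hf : Integrable f μ₃) : Integrable (fun z ↦ f z • e z) μ₃ :=
    hf.smul_bdd 1 he.aestronglyMeasurable (.of_forall he1)
  have hcompensator : ∫ z, (N ^ 2 * (μ₁.prod μ₂).real {p | (p.1, p.2, z) ∈ B}) • e z ∂μ₃ =
      N ^ 2 * ∫ x, ∫ y, hitIntegral μ₃ B e x y ∂μ₂ ∂μ₁ := by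
    rw [← hB.integral_measureReal_smul he he1]
    simp_rw [mul_smul]
    rw [integral_smul, Complex.real_smul]
    push_cast
    rfl
  have hcount : ∫ z, ((∑ j, hitCount B x (y j) z : ℕ) : ℝ) • e z ∂μ₃ =
      ∑ j, ∑ i, hitIntegral μ₃ B e (x i) (y j) := by
    push_cast
    simp_rw [Finset.sum_smul]
    rw [integral_finsetSum _ fun j _ ↦ hsmul (hB.integrable_hitCount x (y j))]
    exact Finset.sum_congr rfl fun j _ ↦ hB.integral_hitCount_smul he he1 x (y j)
  have hmean : ∫ y, (∑ i, hitIntegral μ₃ B e (x i) y) / N ∂μ₂ =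
      (∑ i, ∫ y, hitIntegral μ₃ B e (x i) y ∂μ₂) / N := by
    rw [integral_div, integral_finsetSum _ fun i _ ↦ hB.integrable_hitIntegral he he1 (x i)]
  have hN0 : (N : ℂ) ≠ 0 := Nat.cast_ne_zero.2 hN.ne'
  rw [hmean, ← Finset.sum_div] at hy
  simp_rw [sub_smul]
  rw [integral_sub (hsmul hS.integrable_compensator) (hsmul hS.integrable_count), hcompensator,
    hcount, norm_sub_rev]
  set D := ∑ j, ∑ i, hitIntegral μ₃ B e (x i) (y j)
  set I := ∫ x, ∫ y, hitIntegral μ₃ B e x y ∂μ₂ ∂μ₁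
  calc ‖D - N ^ 2 * I‖ = N ^ 2 * ‖D / N / N - I‖ := by
        rw [← Complex.norm_natCast, ← norm_pow, ← norm_mul]
        congr 1
        field_simp
    _ ≤ N ^ 2 * (σ * τ + σ * τ) := by
        gcongr
        exact (norm_sub_le_norm_sub_add_norm_sub _ _ _).trans (add_le_add hy hx)
    _ = 2 * (N ^ 2 * σ) * τ := by ring

theorem exists_balanced_samples (hB : IsSparseRelation μ₁ μ₂ μ₃ B near σ)
    [IsProbabilityMeasure μ₁] [IsProbabilityMeasure μ₂] [IsFiniteMeasure μ₃]
    {ι : Type*} (Q : Finset ι) {e₁ : ι → α → ℂ} {e₂ : ι → β → ℂ} {e₃ : ι → γ → ℂ}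
    (he₁ : ∀ m, Measurable (e₁ m)) (he₁' : ∀ m x, ‖e₁ m x‖ ≤ 1)
    (he₂ : ∀ m, Measurable (e₂ m)) (he₂' : ∀ m y, ‖e₂ m y‖ ≤ 1)
    (he₃ : ∀ m, Measurable (e₃ m)) (he₃' : ∀ m z, ‖e₃ m z‖ ≤ 1)
    {p₁ : α → Prop} {p₂ : β → Prop} (hp₁ : ∀ᵐ x ∂μ₁, p₁ x) (hp₂ : ∀ᵐ y ∂μ₂, p₂ y) (hN : 0 < N)
    (hσ : 2 * N ^ 2 * σ < 1) :
    ∃ (x : Fin N → α) (y : Fin N → β), (∀ i, p₁ (x i)) ∧ (∀ j, p₂ (y j)) ∧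
      IsSparseCount μ₃ (fun z ↦ ∑ j, hitCount B x (y j) z)
        (fun z ↦ N ^ 2 * (μ₁.prod μ₂).real {p | (p.1, p.2, z) ∈ B}) (N ^ 2 * σ) ∧
      ∀ m ∈ Q,
        ‖(∑ i, e₁ m (x i)) / N - ∫ a, e₁ m a ∂μ₁‖ ≤ samplingFactor (2 * Q.card) / √N ∧
        ‖(∑ j, e₂ m (y j)) / N - ∫ b, e₂ m b ∂μ₂‖ ≤ samplingFactor (2 * Q.card) / √N ∧
        ‖∫ z, (N ^ 2 * (μ₁.prod μ₂).real {p | (p.1, p.2, z) ∈ B} -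
          (∑ j, hitCount B x (y j) z : ℕ)) • e₃ m z ∂μ₃‖ ≤
            2 * (N ^ 2 * σ) * (samplingFactor (2 * Q.card) / √N) := by
  have hcard : (Q.disjSum Q).card = 2 * Q.card := by rw [Finset.card_disjSum, two_mul]
  have hmF (m : ι) : Measurable fun x ↦ ∫ y, hitIntegral μ₃ B (e₃ m) x y ∂μ₂ :=
    (hB.measurable_hitIntegral (he₃ m)).stronglyMeasurable.integral_prod_right.measurable
  have hF (m : ι) (x : α) : ‖∫ y, hitIntegral μ₃ B (e₃ m) x y ∂μ₂‖ ≤ σ :=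
    (norm_integral_le_of_norm_le_const (.of_forall fun y ↦
      hB.norm_hitIntegral_le (he₃' m) x y)).trans_eq (by simp)
  obtain ⟨x, hxp, hxnear, hx⟩ := hB.exists_separated_sample (Q.disjSum Q)
    (g := Sum.elim e₁ fun m x ↦ ∫ y, hitIntegral μ₃ B (e₃ m) x y ∂μ₂)
    (c := Sum.elim (fun _ ↦ 1) fun _ ↦ σ) (by simp [he₁, hmF]) (by simp [he₁', hF]) hp₁ hN hσ
  have hmG (m : ι) : Measurable fun y ↦ (∑ i, hitIntegral μ₃ B (e₃ m) (x i) y) / N :=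
    (Finset.measurable_sum _ fun i _ ↦ (hB.measurable_hitIntegral (he₃ m)).comp
      (by fun_prop : Measurable fun y : β ↦ (x i, y))).div_const _
  obtain ⟨y, hyp, hy, hpairs⟩ := hB.exists_sample_sum_offDiag_le x (Q.disjSum Q)
    (g := Sum.elim e₂ fun m y ↦ (∑ i, hitIntegral μ₃ B (e₃ m) (x i) y) / N)
    (c := Sum.elim (fun _ ↦ 1) fun _ ↦ σ) (by simp [he₂, hmG])
    (by simp [he₂', hB.norm_hitIntegral_average_le (he₃' _) x, -norm_div, -Complex.norm_div]) hp₂ hN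
  rw [hcard] at hx hy
  have hS := hB.isSparseCount hxnear hpairs
  refine ⟨x, y, hxp, hyp, hS, fun m hm ↦ ⟨?_, ?_, ?_⟩⟩
  · simpa using hx (.inl m) (by simpa using hm)
  · simpa using hy (.inl m) (by simpa using hm)
  · exact hB.norm_integral_compensator_sub_count_le hS (he₃ m) (he₃' m) hN
      (hx (.inr m) (by simpa using hm)) (hy (.inr m) (by simpa using hm))

theorem exists_avoiding_samples (hB : IsSparseRelation μ₁ μ₂ μ₃ B near σ)
    [IsProbabilityMeasure μ₁] [IsProbabilityMeasure μ₂] [IsProbabilityMeasure μ₃]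
    {ι : Type*} (Q : Finset ι) {e₁ : ι → α → ℂ} {e₂ : ι → β → ℂ} {e₃ : ι → γ → ℂ}
    (he₁ : ∀ m, Measurable (e₁ m)) (he₁' : ∀ m x, ‖e₁ m x‖ ≤ 1)
    (he₂ : ∀ m, Measurable (e₂ m)) (he₂' : ∀ m y, ‖e₂ m y‖ ≤ 1)
    (he₃ : ∀ m, Measurable (e₃ m)) (he₃' : ∀ m z, ‖e₃ m z‖ ≤ 1) {m₀ : ι} (hm₀ : m₀ ∈ Q)
    (hone : e₃ m₀ = 1) {p₁ : α → Prop} {p₂ : β → Prop} {p₃ : γ → Prop} (hp₁ : ∀ᵐ x ∂μ₁, p₁ x)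
    (hp₂ : ∀ᵐ y ∂μ₂, p₂ y) (hp₃ : ∀ᵐ z ∂μ₃, p₃ z) (hN : 0 < N)
    (hσ : 4 * (N ^ 2 * σ) ≤ (1 : ℝ)) (hτ : samplingFactor (2 * Q.card) / √N ≤ 1) :
    ∃ (x : Fin N → α) (y : Fin N → β) (z : Fin N → γ),
      (∀ i, p₁ (x i)) ∧ (∀ j, p₂ (y j)) ∧ (∀ k, p₃ (z k)) ∧
      (∀ i j k, (x i, y j, z k) ∉ B) ∧ ∀ m ∈ Q,
        ‖(∑ i, e₁ m (x i)) / N - ∫ a, e₁ m a ∂μ₁‖ ≤ samplingFactor (2 * Q.card) / √N ∧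
        ‖(∑ j, e₂ m (y j)) / N - ∫ b, e₂ m b ∂μ₂‖ ≤ samplingFactor (2 * Q.card) / √N ∧
        ‖(∑ k, e₃ m (z k)) / N - ∫ c, e₃ m c ∂μ₃‖ ≤
          2 * (samplingFactor (2 * Q.card) / √N) + 4 * (N ^ 2 * σ) ^ 2 := by
  have hσ' : 2 * N ^ 2 * σ < 1 := by
    rw [← NNReal.coe_lt_coe]
    push_cast
    linarith
  obtain ⟨x, y, hxp, hyp, hS, hxy⟩ := hB.exists_balanced_samples Q he₁ he₁' he₂ he₂' he₃ he₃'
    hp₁ hp₂ hN hσ'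
  set τ := samplingFactor (2 * Q.card) / √N
  have hτ0 : 0 ≤ τ := div_nonneg (samplingFactor_nonneg _) (Real.sqrt_nonneg _)
  have hη0 : (0 : ℝ) ≤ N ^ 2 * σ := by positivity
  have hmass := (hxy m₀ hm₀).2.2
  simp only [hone, Pi.one_apply, integral_smul_const, norm_smul, norm_one, mul_one,
    Real.norm_eq_abs] at hmass
  obtain ⟨z, hzp, hzS, hz⟩ := hS.exists_sample hmass (by nlinarith) Q (fun m _ ↦ he₃ m)
    (fun m _ ↦ he₃' m) (fun m hm ↦ (hxy m hm).2.2) hp₃ hN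
  refine ⟨x, y, z, hxp, hyp, hzp, fun i j k hijk ↦ ?_, fun m hm ↦
    ⟨(hxy m hm).1, (hxy m hm).2.1, (hz m hm).trans ?_⟩⟩
  · have hzero : hitCount B x (y j) (z k) = 0 :=
      Finset.sum_eq_zero_iff.1 (hzS k) j (Finset.mem_univ j)
    have hi := Finset.sum_eq_zero_iff.1 hzero i (Finset.mem_univ i)
    simp [hijk] at hi
  · have hmono : samplingFactor Q.card / √N ≤ τ := div_le_div_of_nonneg_right
      (samplingFactor_mono (Finset.card_pos.2 ⟨m₀, hm₀⟩) (by lia)) (Real.sqrt_nonneg _)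
    nlinarith

end IsSparseRelation

end AvoidingSamples

section NearlyParallel

variable {V : Type*} [NormedAddCommGroup V] [NormedSpace ℝ V] {v a b : V} {x y : ℝ}

theorem norm_le_of_norm_sub_smul_le (hy : 0 ≤ y) (hb : ‖b - y • v‖ ≤ ‖v‖ / 4 * y) :
    ‖b‖ ≤ 5 / 4 * (‖v‖ * y) := by
  have hnorm : ‖y • v‖ = y * ‖v‖ := norm_smul_of_nonneg hy v
  linarith [norm_le_norm_add_norm_sub' b (y • v)]

theorem le_norm_of_norm_sub_smul_le (hx : 0 ≤ x) (ha : ‖a - x • v‖ ≤ ‖v‖ / 4 * x) :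
    3 / 4 * (‖v‖ * x) ≤ ‖a‖ := by
  have hnorm : ‖x • v‖ = x * ‖v‖ := norm_smul_of_nonneg hx v
  linarith [norm_le_norm_add_norm_sub a (x • v)]

theorem le_norm_add_sub_norm_of_norm_sub_smul_le (hx : 0 ≤ x) (hy : 0 ≤ y)
    (ha : ‖a - x • v‖ ≤ ‖v‖ / 4 * x) (hb : ‖b - y • v‖ ≤ ‖v‖ / 4 * y) :
    ‖v‖ / 4 * x ≤ ‖a + b‖ - ‖b‖ := by
  have hvx : 0 ≤ ‖v‖ * x := by positivity
  rcases hy.eq_or_lt with rfl | hy₀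
  · rw [zero_smul, sub_zero, mul_zero, norm_le_zero_iff] at hb
    rw [hb, add_zero, norm_zero, sub_zero]
    linarith [le_norm_of_norm_sub_smul_le hx ha]
  -- Eliminate `v`: up to small errors `y • (a + b)` is a multiple of `b`.
  have hsplit : (x + y) • b = y • (a + b) - y • (a - x • v) + x • (b - y • v) := by module
  have hnorm : (x + y) * ‖b‖ ≤ y * ‖a + b‖ + y * ‖a - x • v‖ + x * ‖b - y • v‖ := by
    rw [← norm_smul_of_nonneg (add_nonneg hx hy), hsplit, ← norm_smul_of_nonneg hy,
      ← norm_smul_of_nonneg hy, ← norm_smul_of_nonneg hx]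
    exact (norm_add_le _ _).trans (add_le_add_left (norm_sub_le _ _) _)
  refine le_of_mul_le_mul_left ?_ hy₀
  linarith [mul_le_mul_of_nonneg_left ha hy, mul_le_mul_of_nonneg_left hb hx,
    mul_le_mul_of_nonneg_left (le_norm_of_norm_sub_smul_le hy hb) hx]

end NearlyParallel

section RegularDistances

/-- The distances between points of the curve `γ` with parameters in `I` grow at rate at least
`c` and at most `K`. -/
structure RegularDistances {V : Type*} [NormedAddCommGroup V] (γ : ℝ → V) (I : Set ℝ)
    (c K : ℝ) : Prop where
  c_pos : 0 < c
  K_pos : 0 < K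
  lipschitz : ∀ s ∈ I, ∀ t ∈ I, ‖γ s - γ t‖ ≤ K * |s - t|
  growth_right : ∀ s ∈ I, ∀ t ∈ I, ∀ u ∈ I, s ≤ t → t ≤ u →
    c * (u - t) ≤ ‖γ s - γ u‖ - ‖γ s - γ t‖
  growth_left : ∀ s ∈ I, ∀ t ∈ I, ∀ u ∈ I, s ≤ t → t ≤ u →
    c * (t - s) ≤ ‖γ s - γ u‖ - ‖γ t - γ u‖

namespace RegularDistances

theorem of_norm_sub_sub_smul_le {V : Type*} [NormedAddCommGroup V] [NormedSpace ℝ V]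
    {γ : ℝ → V} {v : V} {I : Set ℝ} (hv : v ≠ 0)
    (hγ : ∀ s ∈ I, ∀ t ∈ I, ‖γ t - γ s - (t - s) • v‖ ≤ ‖v‖ / 4 * |t - s|) :
    RegularDistances γ I (‖v‖ / 4) (5 / 4 * ‖v‖) := by
  have : 0 < ‖v‖ := norm_pos_iff.mpr hv
  have hγ_le : ∀ s ∈ I, ∀ t ∈ I, s ≤ t → ‖γ t - γ s - (t - s) • v‖ ≤ ‖v‖ / 4 * (t - s) := by
    intro s hs t ht hst
    simpa only [abs_of_nonneg (sub_nonneg.mpr hst)] using hγ s hs t ht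
  refine ⟨by positivity, by positivity, fun s hs t ht ↦ ?_, fun s hs t ht u hu hst htu ↦ ?_,
    fun s hs t ht u hu hst htu ↦ ?_⟩
  · wlog hst : s ≤ t generalizing s t
    · rw [norm_sub_rev, abs_sub_comm]
      exact this t ht s hs (le_of_not_ge hst)
    rw [norm_sub_rev, abs_sub_comm, abs_of_nonneg (sub_nonneg.mpr hst), mul_assoc]
    exact norm_le_of_norm_sub_smul_le (sub_nonneg.mpr hst) (hγ_le s hs t ht hst)
  · simpa only [sub_add_sub_cancel, norm_sub_rev] using
      le_norm_add_sub_norm_of_norm_sub_smul_le (sub_nonneg.mpr htu) (sub_nonneg.mpr hst)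
        (hγ_le t ht u hu htu) (hγ_le s hs t ht hst)
  · simpa only [sub_add_sub_cancel', norm_sub_rev] using
      le_norm_add_sub_norm_of_norm_sub_smul_le (sub_nonneg.mpr hst) (sub_nonneg.mpr htu)
        (hγ_le s hs t ht hst) (hγ_le t ht u hu htu)

theorem exists_closedBall_of_hasStrictDerivAt {V : Type*} [NormedAddCommGroup V]
    [NormedSpace ℝ V] {γ : ℝ → V} {v : V} {t₀ : ℝ} (hγ : HasStrictDerivAt γ v t₀)
    (hv : v ≠ 0) :
    ∃ δ > 0, RegularDistances γ (Metric.closedBall t₀ δ) (‖v‖ / 4) (5 / 4 * ‖v‖) := by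
  have hsmall := hγ.isLittleO.def (c := ‖v‖ / 4) (by positivity)
  obtain ⟨δ, hδ, hball⟩ := Metric.nhds_basis_closedBall.eventually_iff.mp hsmall
  refine ⟨δ, hδ, of_norm_sub_sub_smul_le hv fun s hs t ht ↦ ?_⟩
  simpa using hball (x := (t, s)) (by simpa [Prod.dist_eq] using And.intro ht hs)

variable {V : Type*} [NormedAddCommGroup V] {γ : ℝ → V} {I J : Set ℝ} {c K : ℝ}

theorem mono (h : RegularDistances γ I c K) (hJ : J ⊆ I) : RegularDistances γ J c K where
  c_pos := h.c_pos
  K_pos := h.K_pos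
  lipschitz s hs t ht := h.lipschitz s (hJ hs) t (hJ ht)
  growth_right s hs t ht u hu := h.growth_right s (hJ hs) t (hJ ht) u (hJ hu)
  growth_left s hs t ht u hu := h.growth_left s (hJ hs) t (hJ ht) u (hJ hu)

theorem le_abs_sub_of_same_side (h : RegularDistances γ I c K) {s t u : ℝ} (hs : s ∈ I)
    (ht : t ∈ I) (hu : u ∈ I) (hside : (s ≤ t ∧ s ≤ u) ∨ (t ≤ s ∧ u ≤ s)) :
    c * |t - u| ≤ |‖γ s - γ t‖ - ‖γ s - γ u‖| := by
  wlog htu : t ≤ u generalizing t u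
  · rw [abs_sub_comm t, abs_sub_comm ‖γ s - γ t‖]
    exact this hu ht (hside.imp And.symm And.symm) (le_of_not_ge htu)
  rw [abs_sub_comm t, abs_of_nonneg (sub_nonneg.mpr htu)]
  rcases hside with ⟨hst, -⟩ | ⟨-, hus⟩
  · rw [abs_sub_comm]
    exact (h.growth_right s hs t ht u hu hst htu).trans (le_abs_self _)
  · rw [norm_sub_rev (γ s), norm_sub_rev (γ s)]
    exact (h.growth_left t ht u hu s hs htu hus).trans (le_abs_self _)

theorem le_abs_sub_of_between (h : RegularDistances γ I c K) {x y y' z : ℝ} (hx : x ∈ I)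
    (hy : y ∈ I) (hy' : y' ∈ I) (hz : z ∈ I) (hxy : x ≤ y) (hxy' : x ≤ y') (hyz : y ≤ z)
    (hyz' : y' ≤ z) :
    c * |y - y'| ≤ |(‖γ x - γ y‖ - ‖γ y - γ z‖) - (‖γ x - γ y'‖ - ‖γ y' - γ z‖)| := by
  wlog hyy : y ≤ y' generalizing y y'
  · rw [abs_sub_comm y, abs_sub_comm (‖γ x - γ y‖ - _)]
    exact this hy' hy hxy' hxy hyz' hyz (le_of_not_ge hyy)
  rw [abs_sub_comm y, abs_of_nonneg (sub_nonneg.mpr hyy), abs_sub_comm]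
  have hnonneg : 0 ≤ c * (y' - y) := mul_nonneg h.c_pos.le (sub_nonneg.mpr hyy)
  refine le_trans ?_ (le_abs_self _)
  linarith [h.growth_right x hx y hy y' hy' hxy hyy, h.growth_left y hy y' hy' z hz hyy hyz']

theorem lt_abs_of_apex_outside (h : RegularDistances γ I c K) {x y z ρ l : ℝ} (hx : x ∈ I)
    (hy : y ∈ I) (hz : z ∈ I) (hl : l < c * ρ) (hρ : ρ ≤ |x - z|)
    (hside : (y ≤ x ∧ y ≤ z) ∨ (x ≤ y ∧ z ≤ y)) : l < |‖γ x - γ y‖ - ‖γ y - γ z‖| := by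
  rw [norm_sub_rev (γ x)]
  exact hl.trans_le ((mul_le_mul_of_nonneg_left hρ h.c_pos.le).trans
    (h.le_abs_sub_of_same_side hy hx hz hside))

/-- The apex of an approximate isosceles triple must lie between the other two entries, where the
difference of the two distances is strictly monotone. -/
theorem apex_confined (h : RegularDistances γ I c K) {x y y' z ρ l : ℝ} (hx : x ∈ I) (hy : y ∈ I)
    (hy' : y' ∈ I) (hz : z ∈ I) (hl : l < c * ρ) (hρ : ρ ≤ |x - z|)
    (hside : (x ≤ y ∧ x ≤ y') ∨ (y ≤ x ∧ y' ≤ x)) (hside' : (z ≤ y ∧ z ≤ y') ∨ (y ≤ z ∧ y' ≤ z))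
    (hb : |‖γ x - γ y‖ - ‖γ y - γ z‖| ≤ l) (hb' : |‖γ x - γ y'‖ - ‖γ y' - γ z‖| ≤ l) :
    c * |y - y'| ≤ 2 * l := by
  have hdiff : |(‖γ x - γ y‖ - ‖γ y - γ z‖) - (‖γ x - γ y'‖ - ‖γ y' - γ z‖)| ≤ 2 * l := by
    linarith [abs_sub (‖γ x - γ y‖ - ‖γ y - γ z‖) (‖γ x - γ y'‖ - ‖γ y' - γ z‖)]
  have hinside : ¬((y ≤ x ∧ y ≤ z) ∨ (x ≤ y ∧ z ≤ y)) := fun hout ↦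
    (h.lt_abs_of_apex_outside hx hy hz hl hρ hout).not_ge hb
  rcases hside with ⟨hxy, hxy'⟩ | ⟨hyx, hyx'⟩ <;> rcases hside' with ⟨hzy, hzy'⟩ | ⟨hyz, hyz'⟩
  · exact absurd (Or.inr ⟨hxy, hzy⟩) hinside
  · exact (h.le_abs_sub_of_between hx hy hy' hz hxy hxy' hyz hyz').trans hdiff
  · refine (h.le_abs_sub_of_between hz hy hy' hx hzy hzy' hyx hyx').trans (le_trans ?_ hdiff)
    rw [norm_sub_rev (γ z) (γ y), norm_sub_rev (γ y) (γ x), norm_sub_rev (γ z) (γ y'),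
      norm_sub_rev (γ y') (γ x), ← abs_neg]
    exact le_of_eq (congrArg _ (by ring))
  · exact absurd (Or.inl ⟨hyx, hyz⟩) hinside

theorem abs_norm_sub_norm_le (h : RegularDistances γ I c K) {s s' t t' r : ℝ} (hs : s ∈ I)
    (hs' : s' ∈ I) (ht : t ∈ I) (ht' : t' ∈ I) (hss' : |s - s'| ≤ r) (htt' : |t - t'| ≤ r) :
    |‖γ s - γ t‖ - ‖γ s' - γ t'‖| ≤ 2 * K * r := by
  calc |‖γ s - γ t‖ - ‖γ s' - γ t'‖|
    _ ≤ ‖γ s - γ t - (γ s' - γ t')‖ := _root_.abs_norm_sub_norm_le _ _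
    _ = ‖(γ s - γ s') - (γ t - γ t')‖ := by rw [sub_sub_sub_comm]
    _ ≤ ‖γ s - γ s'‖ + ‖γ t - γ t'‖ := norm_sub_le _ _
    _ ≤ K * |s - s'| + K * |t - t'| :=
        add_le_add (h.lipschitz s hs s' hs') (h.lipschitz t ht t' ht')
    _ ≤ K * r + K * r := by
        have := h.K_pos.le
        gcongr
    _ = 2 * K * r := by ring

end RegularDistances

end RegularDistances

section SeparatedTriples

theorem same_side_of_separated {a b ρ s t u : ℝ} (hab : 3 * ρ ≤ |a - b|) (hs : |s - a| ≤ ρ)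
    (ht : |t - b| ≤ ρ) (hu : |u - b| ≤ ρ) : (s ≤ t ∧ s ≤ u) ∨ (t ≤ s ∧ u ≤ s) := by
  rw [abs_le] at hs ht hu
  rcases le_abs.mp hab with hba | hba
  · right; constructor <;> linarith
  · left; constructor <;> linarith

theorem le_abs_sub_of_separated {a b ρ s t : ℝ} (hab : 3 * ρ ≤ |a - b|) (hs : |s - a| ≤ ρ)
    (ht : |t - b| ≤ ρ) : ρ ≤ |s - t| := by
  have hsum : a - b = -(s - a) + (s - t) + (t - b) := by ring
  have htri := abs_add_three (-(s - a)) (s - t) (t - b)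
  rw [← hsum, abs_neg] at htri
  linarith

/-- Three well separated intervals `[a i - ρ, a i + ρ]` inside `I`. -/
structure IsSeparatedTriple (I : Set ℝ) (a : Fin 3 → ℝ) (ρ : ℝ) : Prop where
  pos : 0 < ρ
  subset : ∀ i, Icc (a i - ρ) (a i + ρ) ⊆ I
  sep : ∀ i j, i ≠ j → 3 * ρ ≤ |a i - a j|

theorem IsSeparatedTriple.mem {I : Set ℝ} {a : Fin 3 → ℝ} {ρ : ℝ} (h : IsSeparatedTriple I a ρ)
    {i : Fin 3} {s : ℝ} (hs : |s - a i| ≤ ρ) : s ∈ I := by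
  rw [abs_le] at hs
  exact h.subset i ⟨by linarith, by linarith⟩

end SeparatedTriples

section SeparatedBalls

open ProbabilityTheory Metric

/-- The index of the ball `closedBall (a i) ρ` containing `x`, and `none` outside these balls. -/
noncomputable def ballIndex (a : Fin 3 → ℝ) (ρ x : ℝ) : Option (Fin 3) :=
  open Classical in if h : ∃ i, x ∈ closedBall (a i) ρ then some h.choose else none

theorem preimage_ballIndex_none (a : Fin 3 → ℝ) (ρ : ℝ) :
    ballIndex a ρ ⁻¹' {none} = (⋃ i, closedBall (a i) ρ)ᶜ := by
  ext x
  simp [ballIndex]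

namespace IsSeparatedTriple

variable {I : Set ℝ} {a : Fin 3 → ℝ} {ρ : ℝ}

theorem ballIndex_eq_some_iff (ha : IsSeparatedTriple I a ρ) {x : ℝ} {i : Fin 3} :
    ballIndex a ρ x = some i ↔ |x - a i| ≤ ρ := by
  rw [← Real.dist_eq, ← mem_closedBall]
  refine ⟨fun hxi ↦ ?_, fun hxi ↦ ?_⟩
  · rw [ballIndex, Option.dite_none_right_eq_some] at hxi
    obtain ⟨hex, hchoose⟩ := hxi
    exact Option.some.inj hchoose ▸ hex.choose_spec
  · have hex : ∃ i, x ∈ closedBall (a i) ρ := ⟨i, hxi⟩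
    rw [ballIndex, dif_pos hex]
    by_contra hne
    have hdist := le_abs_sub_of_separated (ha.sep _ _ fun h ↦ hne (congrArg some h))
      (mem_closedBall.mp hex.choose_spec) (mem_closedBall.mp hxi)
    rw [sub_self, abs_zero] at hdist
    exact hdist.not_gt ha.pos

theorem preimage_ballIndex_some (ha : IsSeparatedTriple I a ρ) (i : Fin 3) :
    ballIndex a ρ ⁻¹' {some i} = closedBall (a i) ρ := by
  ext x
  simp [ha.ballIndex_eq_some_iff, Real.dist_eq]

theorem measurableSet_preimage_ballIndex (ha : IsSeparatedTriple I a ρ) (o : Option (Fin 3)) :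
    MeasurableSet (ballIndex a ρ ⁻¹' {o}) := by
  cases o with
  | none =>
    rw [preimage_ballIndex_none]
    exact (MeasurableSet.iUnion fun _ ↦ measurableSet_closedBall).compl
  | some i =>
    rw [ha.preimage_ballIndex_some]
    exact measurableSet_closedBall

end IsSeparatedTriple

/-- Lebesgue measure on `(0, 1]`, the fundamental domain of the circle. -/
noncomputable def unitVolume : Measure ℝ := volume.restrict (Ioc 0 1)

instance : IsProbabilityMeasure unitVolume := ⟨by simp [unitVolume]⟩

theorem integral_unitVolume (f : UnitAddCircle → ℂ) :
    ∫ x : ℝ, f x ∂unitVolume = ∫ x, f x ∂AddCircle.haarAddCircle := by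
  have h := UnitAddCircle.integral_preimage 0 f
  rwa [zero_add, AddCircle.volume_eq_smul_haarAddCircle, ENNReal.ofReal_one, one_smul] at h

theorem integral_fourier_unitVolume {n : ℤ} (hn : n ≠ 0) :
    ∫ x : ℝ, (fourier n (x : UnitAddCircle) : ℂ) ∂unitVolume = 0 := by
  have h := congrFun (fourierCoeff_fourier (T := 1) n) 0
  rw [fourierCoeff, Pi.single_eq_of_ne hn.symm] at h
  rw [integral_unitVolume fun x ↦ fourier n x, ← h]
  simp

namespace IsSeparatedTriple

variable {I : Set ℝ} {a : Fin 3 → ℝ} {ρ θ : ℝ}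

theorem unitVolume_closedBall (ha : IsSeparatedTriple I a ρ) (hθ : 0 < θ)
    (hI : I ⊆ Icc θ (1 - θ)) (i : Fin 3) :
    unitVolume (closedBall (a i) ρ) = ENNReal.ofReal (2 * ρ) := by
  have hsub : closedBall (a i) ρ ⊆ Ioc 0 1 := by
    rw [Real.closedBall_eq_Icc]
    refine (ha.subset i).trans (hI.trans fun x hx ↦ ⟨?_, ?_⟩) <;> linarith [hx.1, hx.2]
  rw [unitVolume, Measure.restrict_apply measurableSet_closedBall, inter_eq_left.mpr hsub,
    Real.volume_closedBall]

theorem isProbabilityMeasure_cond_ballIndex (ha : IsSeparatedTriple I a ρ)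
    (hθ : 0 < θ) (hI : I ⊆ Icc θ (1 - θ)) (o : Option (Fin 3)) :
    IsProbabilityMeasure unitVolume[|ballIndex a ρ ⁻¹' {o}] := by
  refine cond_isProbabilityMeasure (ne_of_gt ?_)
  cases o with
  | none =>
    have hsub : Ioo 0 θ ⊆ (⋃ i, closedBall (a i) ρ)ᶜ := by
      intro x hx hmem
      obtain ⟨i, hi⟩ := mem_iUnion.mp hmem
      rw [Real.closedBall_eq_Icc] at hi
      exact (hI (ha.subset i hi)).1.not_gt hx.2
    rw [preimage_ballIndex_none]
    refine lt_of_lt_of_le ?_ (measure_mono hsub)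
    have hθ₁ : θ ≤ 1 - θ := by
      have ha₀ := hI (ha.mem (i := 0) (s := a 0) (by simpa using ha.pos.le))
      exact ha₀.1.trans ha₀.2
    have hsub' : Ioo 0 θ ⊆ Ioc 0 1 := fun x hx ↦ ⟨hx.1, by linarith [hx.2]⟩
    rw [unitVolume, Measure.restrict_apply measurableSet_Ioo, inter_eq_left.mpr hsub']
    simpa using hθ
  | some i =>
    rw [ha.preimage_ballIndex_some, ha.unitVolume_closedBall hθ hI]
    simpa using ha.pos

theorem cond_ballIndex_le (ha : IsSeparatedTriple I a ρ) (hθ : 0 < θ)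
    (hI : I ⊆ Icc θ (1 - θ)) (i : Fin 3) {S : Set ℝ} {L : ℝ}
    (hS : ∀ y ∈ S, ∀ y' ∈ S, |y - y'| ≤ L) :
    unitVolume[|ballIndex a ρ ⁻¹' {some i}] S ≤ ENNReal.ofReal (L / (2 * ρ)) := by
  have hvol : unitVolume (closedBall (a i) ρ ∩ S) ≤ ENNReal.ofReal L :=
    calc unitVolume (closedBall (a i) ρ ∩ S) ≤ volume S :=
          (Measure.restrict_apply_le _ _).trans (measure_mono inter_subset_right)
      _ ≤ Metric.ediam S := Real.volume_le_diam S
      _ ≤ ENNReal.ofReal L := ediam_le_of_forall_dist_le hS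
  rw [ha.preimage_ballIndex_some, cond_apply measurableSet_closedBall,
    ha.unitVolume_closedBall hθ hI, mul_comm, ← div_eq_mul_inv,
    ENNReal.ofReal_div_of_pos (by linarith [ha.pos])]
  gcongr

end IsSeparatedTriple

end SeparatedBalls

section ApproximateIsosceles

open ProbabilityTheory Metric

variable {V : Type*} [NormedAddCommGroup V] {γ : ℝ → V} {I : Set ℝ} {c K : ℝ} {a : Fin 3 → ℝ}
  {ρ l θ : ℝ}

/-- The parameter triples in three given balls whose points on the curve `γ` form an isosceles
triangle with apex in the second place, up to an error `l`. -/
def approxIsosceles (γ : ℝ → V) (a : Fin 3 → ℝ) (ρ l : ℝ) : Set (ℝ × ℝ × ℝ) :=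
  {t | (|t.1 - a 0| ≤ ρ ∧ |t.2.1 - a 1| ≤ ρ ∧ |t.2.2 - a 2| ≤ ρ) ∧
    |‖γ t.1 - γ t.2.1‖ - ‖γ t.2.1 - γ t.2.2‖| ≤ l}

namespace RegularDistances

theorem continuousOn (h : RegularDistances γ I c K) : ContinuousOn γ I :=
  (LipschitzOnWith.of_dist_le_mul (K := K.toNNReal) fun s hs t ht ↦ by
    rw [dist_eq_norm, Real.dist_eq, Real.coe_toNNReal K h.K_pos.le]
    exact h.lipschitz s hs t ht).continuousOn

theorem isClosed_approxIsosceles (h : RegularDistances γ I c K) (ha : IsSeparatedTriple I a ρ) :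
    IsClosed (approxIsosceles γ a ρ l) := by
  set D : Set (ℝ × ℝ × ℝ) := {t | |t.1 - a 0| ≤ ρ ∧ |t.2.1 - a 1| ≤ ρ ∧ |t.2.2 - a 2| ≤ ρ}
  have hD_closed : IsClosed D := by
    have hcoord (i : Fin 3) {f : ℝ × ℝ × ℝ → ℝ} (hf : Continuous f) :
        IsClosed {t | |f t - a i| ≤ ρ} := isClosed_le (by fun_prop) continuous_const
    exact (hcoord 0 continuous_fst).inter
      ((hcoord 1 (continuous_fst.comp continuous_snd)).inter
        (hcoord 2 (continuous_snd.comp continuous_snd)))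
  have h₀ : ContinuousOn (fun t : ℝ × ℝ × ℝ ↦ γ t.1) D :=
    h.continuousOn.comp (by fun_prop) fun _ ht ↦ ha.mem ht.1
  have h₁ : ContinuousOn (fun t : ℝ × ℝ × ℝ ↦ γ t.2.1) D :=
    h.continuousOn.comp (by fun_prop) fun _ ht ↦ ha.mem ht.2.1
  have h₂ : ContinuousOn (fun t : ℝ × ℝ × ℝ ↦ γ t.2.2) D :=
    h.continuousOn.comp (by fun_prop) fun _ ht ↦ ha.mem ht.2.2
  exact ((h₀.sub h₁).norm.sub (h₁.sub h₂).norm).abs.preimage_isClosed_of_isClosed hD_closed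
    isClosed_Iic

theorem abs_sub_le_of_approxIsosceles_fst (h : RegularDistances γ I c K)
    (ha : IsSeparatedTriple I a ρ) {x x' y z : ℝ} (hxyz : (x, y, z) ∈ approxIsosceles γ a ρ l)
    (hxyz' : (x', y, z) ∈ approxIsosceles γ a ρ l) : |x - x'| ≤ 2 * l / c := by
  obtain ⟨⟨hx, hy, -⟩, hl⟩ := hxyz
  obtain ⟨⟨hx', -, -⟩, hl'⟩ := hxyz'
  have hgrowth := h.le_abs_sub_of_same_side (ha.mem hy) (ha.mem hx) (ha.mem hx')
    (same_side_of_separated (ha.sep 1 0 (by decide)) hy hx hx')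
  rw [norm_sub_rev (γ y), norm_sub_rev (γ y) (γ x')] at hgrowth
  rw [le_div_iff₀' h.c_pos]
  refine hgrowth.trans (abs_le.mpr ?_)
  constructor <;> linarith [abs_le.mp hl, abs_le.mp hl']

theorem abs_sub_le_of_approxIsosceles_snd (h : RegularDistances γ I c K)
    (ha : IsSeparatedTriple I a ρ) (hlc : l < c * ρ) {x y y' z : ℝ}
    (hxyz : (x, y, z) ∈ approxIsosceles γ a ρ l) (hxyz' : (x, y', z) ∈ approxIsosceles γ a ρ l) :
    |y - y'| ≤ 2 * l / c := by
  obtain ⟨⟨hx, hy, hz⟩, hl⟩ := hxyz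
  obtain ⟨⟨-, hy', -⟩, hl'⟩ := hxyz'
  rw [le_div_iff₀' h.c_pos]
  exact h.apex_confined (ha.mem hx) (ha.mem hy) (ha.mem hy') (ha.mem hz) hlc
    (le_abs_sub_of_separated (ha.sep 0 2 (by decide)) hx hz)
    (same_side_of_separated (ha.sep 0 1 (by decide)) hx hy hy')
    (same_side_of_separated (ha.sep 2 1 (by decide)) hz hy hy') hl hl'

theorem abs_sub_le_of_approxIsosceles_thd (h : RegularDistances γ I c K)
    (ha : IsSeparatedTriple I a ρ) {x y z z' : ℝ} (hxyz : (x, y, z) ∈ approxIsosceles γ a ρ l)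
    (hxyz' : (x, y, z') ∈ approxIsosceles γ a ρ l) : |z - z'| ≤ 2 * l / c := by
  obtain ⟨⟨-, hy, hz⟩, hl⟩ := hxyz
  obtain ⟨⟨-, -, hz'⟩, hl'⟩ := hxyz'
  rw [le_div_iff₀' h.c_pos]
  refine (h.le_abs_sub_of_same_side (ha.mem hy) (ha.mem hz) (ha.mem hz')
    (same_side_of_separated (ha.sep 1 2 (by decide)) hy hz hz')).trans (abs_le.mpr ?_)
  constructor <;> linarith [abs_le.mp hl, abs_le.mp hl']

theorem isSparseRelation_approxIsosceles (h : RegularDistances γ I c K)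
    (ha : IsSeparatedTriple I a ρ) (hθ : 0 < θ) (hI : I ⊆ Icc θ (1 - θ))
    (hl₀ : 0 ≤ l) (hl : l < c * ρ) :
    IsSparseRelation (unitVolume[|ballIndex a ρ ⁻¹' {some 0}])
      (unitVolume[|ballIndex a ρ ⁻¹' {some 1}]) (unitVolume[|ballIndex a ρ ⁻¹' {some 2}])
      (approxIsosceles γ a ρ l) {p | |p.1 - p.2| ≤ 2 * l / c} (2 * l / (c * ρ)).toNNReal := by
  have hc := h.c_pos
  have hρ := ha.pos
  have hsection (i : Fin 3) {S : Set ℝ} (hS : ∀ y ∈ S, ∀ y' ∈ S, |y - y'| ≤ 2 * (2 * l / c)) :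
      unitVolume[|ballIndex a ρ ⁻¹' {some i}] S ≤ (2 * l / (c * ρ)).toNNReal := by
    have hratio : 2 * (2 * l / c) / (2 * ρ) = 2 * l / (c * ρ) := by field_simp
    exact (ha.cond_ballIndex_le hθ hI i hS).trans_eq (congrArg ENNReal.ofReal hratio)
  have hdouble {u : ℝ} (hu : u ≤ 2 * l / c) : u ≤ 2 * (2 * l / c) := by
    have : 0 ≤ 2 * l / c := by positivity
    linarith
  refine ⟨(h.isClosed_approxIsosceles ha).measurableSet,
    (isClosed_le (by fun_prop) continuous_const).measurableSet, fun x ↦ hsection 0 ?_,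
    fun x z ↦ hsection 1 fun y hy y' hy' ↦
      hdouble (h.abs_sub_le_of_approxIsosceles_snd ha hl hy hy'),
    fun x y ↦ hsection 2 fun z hz z' hz' ↦
      hdouble (h.abs_sub_le_of_approxIsosceles_thd ha hz hz'),
    h.abs_sub_le_of_approxIsosceles_fst ha⟩
  intro y hy y' hy'
  calc |y - y'| ≤ |y - x| + |x - y'| := abs_sub_le y x y'
    _ ≤ 2 * (2 * l / c) := by
      rw [abs_sub_comm y, two_mul]
      exact add_le_add hy hy'

end RegularDistances

end ApproximateIsosceles

section AvoidingPoints

open ProbabilityTheory Filter Topology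

/-- No parameters `t i` within `ρ` of the centres `a i` and within `r` of the set `P` on the circle
give an isosceles triangle with apex `γ (t 1)`. -/
def AvoidsIsoscelesNear {V : Type*} [NormedAddCommGroup V] (γ : ℝ → V) (a : Fin 3 → ℝ) (ρ r : ℝ)
    (P : Set UnitAddCircle) : Prop :=
  ∀ t : Fin 3 → ℝ, (∀ i, |t i - a i| ≤ ρ) → (∀ i, ∃ y ∈ P, dist (t i : UnitAddCircle) y ≤ r) →
    ‖γ (t 0) - γ (t 1)‖ ≠ ‖γ (t 1) - γ (t 2)‖

variable {I : Set ℝ} {a : Fin 3 → ℝ} {ρ : ℝ}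

theorem IsSeparatedTriple.integral_unitVolume_eq_sum (ha : IsSeparatedTriple I a ρ) {f : ℝ → ℂ}
    (hf : Integrable f unitVolume) :
    ∫ x, f x ∂unitVolume = ∑ o, (unitVolume.real (ballIndex a ρ ⁻¹' {o}) : ℂ) *
      ∫ x, f x ∂unitVolume[|ballIndex a ρ ⁻¹' {o}] := by
  let _ : MeasurableSpace (Option (Fin 3)) := ⊤
  have hindex : Measurable (ballIndex a ρ) :=
    measurable_to_countable' fun o ↦ ha.measurableSet_preimage_ballIndex o
  have hlaw := sum_meas_smul_cond_fiber hindex unitVolume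
  have hint (o : Option (Fin 3)) : Integrable f
      (unitVolume (ballIndex a ρ ⁻¹' {o}) • unitVolume[|ballIndex a ρ ⁻¹' {o}]) := by
    rw [← hlaw, integrable_finsetSum_measure] at hf
    exact hf o (Finset.mem_univ o)
  conv_lhs => rw [← hlaw]
  rw [integral_finsetSum_measure fun o _ ↦ hint o]
  simp only [integral_smul_measure, measureReal_def, Complex.real_smul]

theorem IsSeparatedTriple.sum_measureReal_ballIndex (ha : IsSeparatedTriple I a ρ) :
    ∑ o, unitVolume.real (ballIndex a ρ ⁻¹' {o}) = 1 := by
  rw [sum_measureReal_preimage_singleton _ fun o _ ↦ ha.measurableSet_preimage_ballIndex o]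
  simp

theorem IsSeparatedTriple.norm_sum_average_le (ha : IsSeparatedTriple I a ρ) {f : ℝ → ℂ}
    (hf : Integrable f unitVolume) (hf₀ : ∫ x, f x ∂unitVolume = 0) {A : Option (Fin 3) → ℂ}
    {β : ℝ} (hA : ∀ o, ‖A o - ∫ x, f x ∂unitVolume[|ballIndex a ρ ⁻¹' {o}]‖ ≤ β) :
    ‖∑ o, (unitVolume.real (ballIndex a ρ ⁻¹' {o}) : ℂ) * A o‖ ≤ β := by
  have hcentre : ∑ o, (unitVolume.real (ballIndex a ρ ⁻¹' {o}) : ℂ) * A o =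
      ∑ o, (unitVolume.real (ballIndex a ρ ⁻¹' {o}) : ℂ) *
        (A o - ∫ x, f x ∂unitVolume[|ballIndex a ρ ⁻¹' {o}]) := by
    simp only [mul_sub, Finset.sum_sub_distrib]
    rw [← ha.integral_unitVolume_eq_sum hf, hf₀, sub_zero]
  rw [hcentre]
  calc _ ≤ ∑ o, unitVolume.real (ballIndex a ρ ⁻¹' {o}) * β := by
        refine norm_sum_le_of_le _ fun o _ ↦ ?_
        rw [norm_mul, Complex.norm_real, Real.norm_of_nonneg measureReal_nonneg]
        exact mul_le_mul_of_nonneg_left (hA o) measureReal_nonneg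
    _ = β := by rw [← Finset.sum_mul, ha.sum_measureReal_ballIndex, one_mul]

variable {V : Type*} [NormedAddCommGroup V] {γ : ℝ → V} {c K θ : ℝ}

theorem RegularDistances.exists_sample_ballIndex (h : RegularDistances γ I c K)
    (ha : IsSeparatedTriple I a ρ) (hθ : 0 < θ) (hI : I ⊆ Icc θ (1 - θ)) {l : ℝ}
    (hl₀ : 0 ≤ l) (hl : l < c * ρ) {Q : Finset ℤ} (hQ : 0 ∈ Q) {N : ℕ} (hN : 0 < N)
    (hσ : 4 * (N ^ 2 * (2 * l / (c * ρ))) ≤ 1) (hτ : samplingFactor (2 * Q.card) / √N ≤ 1) :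
    ∃ q : Option (Fin 3) → Fin N → ℝ,
      (∀ o j, q o j ∈ Ioc (0 : ℝ) 1 ∧ ballIndex a ρ (q o j) = o) ∧
      (∀ i j k, (q (some 0) i, q (some 1) j, q (some 2) k) ∉ approxIsosceles γ a ρ l) ∧
      ∀ n ∈ Q, ∀ o, ‖(∑ j, (fourier n (q o j : UnitAddCircle) : ℂ)) / N -
        ∫ x : ℝ, (fourier n (x : UnitAddCircle) : ℂ) ∂unitVolume[|ballIndex a ρ ⁻¹' {o}]‖ ≤
          2 * (samplingFactor (2 * Q.card) / √N) + 4 * (N ^ 2 * (2 * l / (c * ρ))) ^ 2 := by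
  have hρ := ha.pos
  have hc := h.c_pos
  have (o : Option (Fin 3)) := ha.isProbabilityMeasure_cond_ballIndex hθ hI o
  have hσ_coe : ((2 * l / (c * ρ)).toNNReal : ℝ) = 2 * l / (c * ρ) :=
    Real.coe_toNNReal _ (by positivity)
  have hp (o : Option (Fin 3)) : ∀ᵐ x ∂unitVolume[|ballIndex a ρ ⁻¹' {o}],
      x ∈ Ioc (0 : ℝ) 1 ∧ ballIndex a ρ x = o :=
    (Eventually.filter_mono cond_absolutelyContinuous.ae_le (ae_restrict_mem measurableSet_Ioc)).and
      (ae_cond_mem (ha.measurableSet_preimage_ballIndex o))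
  have hmeas (n : ℤ) : Measurable fun x : ℝ ↦ (fourier n (x : UnitAddCircle) : ℂ) := by fun_prop
  have hnorm (n : ℤ) (x : ℝ) : ‖(fourier n (x : UnitAddCircle) : ℂ)‖ ≤ 1 := by
    simp only [fourier_apply, Circle.norm_coe, le_refl]
  obtain ⟨x, y, z, hx, hy, hz, havoid, hxyz⟩ :=
    (h.isSparseRelation_approxIsosceles ha hθ hI hl₀ hl).exists_avoiding_samples Q hmeas hnorm hmeas
      hnorm hmeas hnorm hQ (by ext; simp) (hp (some 0)) (hp (some 1)) (hp (some 2)) hN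
      (by rwa [hσ_coe]) hτ
  rw [hσ_coe] at hxyz
  obtain ⟨u, hu, hu_sum, -⟩ := exists_sample_of_norm_le_one Q (fun n _ ↦ hmeas n)
    (fun n _ ↦ hnorm n) (O := fun _ _ ↦ 0) (o := 0) measurable_const (by simp) (hp none) hN
  have hτ_mono : samplingFactor Q.card / √N ≤ samplingFactor (2 * Q.card) / √N := by
    gcongr
    exact samplingFactor_mono (Finset.card_pos.mpr ⟨0, hQ⟩) (by linarith)
  have hτ_le : samplingFactor (2 * Q.card) / √N ≤
      2 * (samplingFactor (2 * Q.card) / √N) + 4 * (N ^ 2 * (2 * l / (c * ρ))) ^ 2 := by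
    have : 0 ≤ samplingFactor (2 * Q.card) / √N :=
      div_nonneg (samplingFactor_nonneg _) (Real.sqrt_nonneg _)
    linarith [sq_nonneg ((N : ℝ) ^ 2 * (2 * l / (c * ρ)))]
  refine ⟨fun o ↦ o.elim u ![x, y, z], ?_, havoid, fun n hn ↦ ?_⟩
  · simpa only [Option.forall, Fin.forall_fin_succ] using ⟨hu, hx, hy, hz, by simp⟩
  · obtain ⟨hxn, hyn, hzn⟩ := hxyz n hn
    have hun := (hu_sum n hn).trans hτ_mono
    simpa only [Option.forall, Fin.forall_fin_succ] using
      ⟨hun.trans hτ_le, hxn.trans hτ_le, hyn.trans hτ_le, hzn, by simp⟩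

theorem abs_sub_le_of_norm_coe_sub_le {s q r : ℝ} (hs : s ∈ Icc θ (1 - θ))
    (hq : q ∈ Ioc (0 : ℝ) 1) (hr : r < θ)
    (h : ‖(s : UnitAddCircle) - (q : UnitAddCircle)‖ ≤ r) :
    |s - q| ≤ r := by
  rw [← AddCircle.coe_sub, UnitAddCircle.norm_eq] at h
  have hround : round (s - q) = 0 := by
    have hbound := abs_le.mp h
    have hlt : (round (s - q) : ℝ) < 1 := by linarith [hs.2, hq.1]
    have hgt : (-1 : ℝ) < round (s - q) := by linarith [hs.1, hq.2]
    have hlt' : round (s - q) < 1 := by exact_mod_cast hlt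
    have hgt' : -1 < round (s - q) := by exact_mod_cast hgt
    omega
  rwa [hround, Int.cast_zero, sub_zero] at h

theorem RegularDistances.avoidsIsoscelesNear_range (h : RegularDistances γ I c K)
    (ha : IsSeparatedTriple I a ρ) (hI : I ⊆ Icc θ (1 - θ)) {r : ℝ} (hr : r < θ)
    (hrρ : r ≤ ρ / 2) {N : ℕ} {q : Option (Fin 3) → Fin N → ℝ}
    (hq : ∀ o j, q o j ∈ Ioc (0 : ℝ) 1 ∧ ballIndex a ρ (q o j) = o)
    (havoid : ∀ i j k,
      (q (some 0) i, q (some 1) j, q (some 2) k) ∉ approxIsosceles γ a ρ (4 * K * r)) :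
    AvoidsIsoscelesNear γ a (ρ / 2) r (range fun k : Option (Fin 3) × Fin N ↦
      (q k.1 k.2 : UnitAddCircle)) := by
  intro t ht hclose heq
  have ht' (i : Fin 3) : t i ∈ I := ha.mem ((ht i).trans (by linarith [ha.pos]))
  -- A sample point close to `t i` lies in the `i`-th ball, hence belongs to the `i`-th sample.
  have hsample (i : Fin 3) : ∃ j, |t i - q (some i) j| ≤ r ∧ |q (some i) j - a i| ≤ ρ := by
    obtain ⟨_, ⟨⟨o, j⟩, rfl⟩, hdist⟩ := hclose i
    rw [dist_eq_norm] at hdist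
    have hnear : |t i - q o j| ≤ r :=
      abs_sub_le_of_norm_coe_sub_le (hI (ht' i)) (hq o j).1 hr hdist
    have hball : |q o j - a i| ≤ ρ := by
      rw [abs_sub_comm] at hnear
      linarith [abs_sub_le (q o j) (t i) (a i), ht i]
    obtain rfl : o = some i := by rw [← (hq o j).2, ha.ballIndex_eq_some_iff]; exact hball
    exact ⟨j, hnear, hball⟩
  obtain ⟨j₀, hnear₀, hball₀⟩ := hsample 0
  obtain ⟨j₁, hnear₁, hball₁⟩ := hsample 1
  obtain ⟨j₂, hnear₂, hball₂⟩ := hsample 2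
  have h₀₁ := abs_le.mp <| h.abs_norm_sub_norm_le (ht' 0) (ha.mem hball₀) (ht' 1) (ha.mem hball₁)
    hnear₀ hnear₁
  have h₁₂ := abs_le.mp <| h.abs_norm_sub_norm_le (ht' 1) (ha.mem hball₁) (ht' 2) (ha.mem hball₂)
    hnear₁ hnear₂
  refine havoid j₀ j₁ j₂ ⟨⟨hball₀, hball₁, hball₂⟩, abs_le.mpr ?_⟩
  constructor <;> linarith

end AvoidingPoints

section AvoidingPointsAsymptotics

open ProbabilityTheory Filter Topology

variable {V : Type*} [NormedAddCommGroup V] {γ : ℝ → V} {I : Set ℝ} {a : Fin 3 → ℝ} {ρ c K θ : ℝ}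

/-- The weight of each of the `N` sample points of class `k.1`, equal to a share `1 / N` of the
length of that class. -/
noncomputable def ballIndexWeight (a : Fin 3 → ℝ) (ρ : ℝ) (N : ℕ)
    (k : Option (Fin 3) × Fin N) : ℝ :=
  unitVolume.real (ballIndex a ρ ⁻¹' {k.1}) / N

theorem ballIndexWeight_nonneg (a : Fin 3 → ℝ) (ρ : ℝ) {N : ℕ} (k : Option (Fin 3) × Fin N) :
    0 ≤ ballIndexWeight a ρ N k := by
  unfold ballIndexWeight
  positivity

theorem sum_ballIndexWeight_mul {N : ℕ} (f : Option (Fin 3) × Fin N → ℂ) :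
    ∑ k, (ballIndexWeight a ρ N k : ℂ) * f k =
      ∑ o, (unitVolume.real (ballIndex a ρ ⁻¹' {o}) : ℂ) * ((∑ j, f (o, j)) / N) := by
  rw [Fintype.sum_prod_type]
  refine Finset.sum_congr rfl fun o _ ↦ ?_
  rw [Finset.sum_div, Finset.mul_sum]
  refine Finset.sum_congr rfl fun j _ ↦ ?_
  rw [ballIndexWeight]
  push_cast
  ring

theorem IsSeparatedTriple.sum_ballIndexWeight (ha : IsSeparatedTriple I a ρ) {N : ℕ}
    (hN : 0 < N) : ∑ k, ballIndexWeight a ρ N k = 1 := by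
  have hN' : (N : ℂ) ≠ 0 := by exact_mod_cast hN.ne'
  have h := sum_ballIndexWeight_mul (a := a) (ρ := ρ) (N := N) fun _ ↦ 1
  simp only [mul_one, Finset.sum_const, Finset.card_univ, Fintype.card_fin, nsmul_eq_mul,
    div_self hN'] at h
  rw [← Complex.ofReal_inj]
  push_cast
  rw [h]
  exact_mod_cast ha.sum_measureReal_ballIndex

theorem RegularDistances.exists_avoiding_points (h : RegularDistances γ I c K)
    (ha : IsSeparatedTriple I a ρ) (hθ : 0 < θ) (hI : I ⊆ Icc θ (1 - θ)) {r : ℝ} (hr₀ : 0 ≤ r)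
    (hr : r < θ) (hrρ : r ≤ ρ / 2) (hl : 4 * K * r < c * ρ) {M N : ℕ} (hN : 0 < N)
    (hσ : 4 * (N ^ 2 * (2 * (4 * K * r) / (c * ρ))) ≤ 1)
    (hτ : samplingFactor (2 * (2 * M + 1)) / √N ≤ 1) :
    ∃ y : Option (Fin 3) × Fin N → UnitAddCircle,
      (∀ ξ : ℤ, ξ ≠ 0 → |ξ| ≤ M → ‖∑ k, (ballIndexWeight a ρ N k : ℂ) * fourier (-ξ) (y k)‖ ≤
        2 * (samplingFactor (2 * (2 * M + 1)) / √N) +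
          4 * (N ^ 2 * (2 * (4 * K * r) / (c * ρ))) ^ 2) ∧
      AvoidsIsoscelesNear γ a (ρ / 2) r (range y) := by
  have hcard : (Finset.Icc (-M : ℤ) M).card = 2 * M + 1 := by
    rw [Int.card_Icc]
    omega
  have hK := h.K_pos
  obtain ⟨q, hq, havoid, hsum⟩ := h.exists_sample_ballIndex ha hθ hI (by positivity) hl
    (Q := Finset.Icc (-M : ℤ) M) (by simp) hN hσ (by rwa [hcard])
  refine ⟨fun k ↦ q k.1 k.2, fun ξ hξ hξM ↦ ?_,
    h.avoidsIsoscelesNear_range ha hI hr hrρ hq havoid⟩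
  rw [sum_ballIndexWeight_mul]
  have hfourier : Integrable (fun x : ℝ ↦ (fourier (-ξ) (x : UnitAddCircle) : ℂ)) unitVolume :=
    .of_bound (C := 1) (by fun_prop) (.of_forall fun x ↦ by
      simp only [fourier_apply, Circle.norm_coe, le_refl])
  refine ha.norm_sum_average_le hfourier (integral_fourier_unitVolume (neg_ne_zero.mpr hξ)) ?_
  rw [← hcard]
  exact hsum (-ξ) (Finset.mem_Icc.mpr ⟨by linarith [le_abs_self ξ], by linarith [neg_abs_le ξ]⟩)

theorem tendsto_natCast_rpow_neg {y : ℝ} (hy : 0 < y) :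
    Tendsto (fun N : ℕ ↦ (N : ℝ) ^ (-y)) atTop (𝓝 0) :=
  (tendsto_rpow_neg_atTop hy).comp tendsto_natCast_atTop_atTop

theorem eventually_samplingFactor_cube_add_le (B : ℝ) {ε : ℝ} (hε : 0 < ε) :
    ∀ᶠ N : ℕ in atTop, 2 * samplingFactor (2 * (2 * N ^ 3 + 1)) + B ≤ (N : ℝ) ^ ε := by
  have hlog : ∀ᶠ N : ℕ in atTop, 12 * Real.log N ≤ 1 / 2 * (N : ℝ) ^ ε := by
    have := (isLittleO_log_rpow_atTop hε).bound (show (0 : ℝ) < 1 / 24 by norm_num)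
    filter_upwards [tendsto_natCast_atTop_atTop.eventually this] with N hN
    rw [Real.norm_of_nonneg (by positivity : (0 : ℝ) ≤ (N : ℝ) ^ ε)] at hN
    linarith [Real.le_norm_self (Real.log N)]
  have hconst : ∀ᶠ N : ℕ in atTop, 2 * (4 * (Real.log 48 + 1) + B) ≤ (N : ℝ) ^ ε :=
    ((tendsto_rpow_atTop hε).comp tendsto_natCast_atTop_atTop).eventually_ge_atTop _
  filter_upwards [hlog, hconst, eventually_ge_atTop 1] with N hlogN hconstN hN
  have hcube : (1 : ℝ) ≤ (N : ℝ) ^ 3 := one_le_pow₀ (by exact_mod_cast hN)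
  have hle : Real.log (8 * (2 * (2 * N ^ 3 + 1) : ℕ)) ≤ Real.log 48 + 3 * Real.log N := by
    push_cast
    calc _ ≤ Real.log (48 * (N : ℝ) ^ 3) := Real.log_le_log (by positivity) (by linarith)
      _ = Real.log 48 + 3 * Real.log N := by
        rw [Real.log_mul (by norm_num) (by positivity), Real.log_pow, Nat.cast_ofNat]
  unfold samplingFactor
  linarith

/-- With `r = N ^ (-9 / 4)`, random triples avoid an approximate isosceles relation of density
`O(N² r) = O(N ^ (-1 / 4))`, whose square is of the order of the sampling error `N ^ (-1 / 2)`. -/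
theorem RegularDistances.eventually_exists_avoiding_points (h : RegularDistances γ I c K)
    (ha : IsSeparatedTriple I a ρ) (hθ : 0 < θ) (hI : I ⊆ Icc θ (1 - θ)) {ε : ℝ}
    (hε : 0 < ε) :
    ∀ᶠ N : ℕ in atTop, ∃ y : Option (Fin 3) × Fin N → UnitAddCircle,
      (∀ ξ : ℤ, ξ ≠ 0 → |ξ| ≤ (N ^ 3 : ℕ) →
        ‖∑ k, (ballIndexWeight a ρ N k : ℂ) * fourier (-ξ) (y k)‖ ≤ (N : ℝ) ^ (-(1 / 2) + ε)) ∧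
      AvoidsIsoscelesNear γ a (ρ / 2) (N ^ (-(9 / 4) : ℝ)) (range y) := by
  have hρ := ha.pos
  have hc := h.c_pos
  have hK := h.K_pos
  set C := 8 * K / (c * ρ)
  filter_upwards [eventually_gt_atTop 1,
    (tendsto_natCast_rpow_neg (y := 9 / 4) (by norm_num)).eventually_lt_const
      (show 0 < min θ (min (ρ / 2) (c * ρ / (4 * K))) by positivity),
    (tendsto_natCast_rpow_neg (y := 1 / 4) (by norm_num)).eventually_lt_const
      (show 0 < 1 / (4 * C) by positivity),
    eventually_samplingFactor_cube_add_le 0 (ε := 1 / 2) (by norm_num),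
    eventually_samplingFactor_cube_add_le (4 * C ^ 2) hε] with N hN hr hσ hτ hsum
  obtain ⟨hr_theta, hr_half, hr_quot⟩ := by simpa only [lt_min_iff] using hr
  rw [lt_div_iff₀ (by positivity)] at hσ
  have hN₀ : (0 : ℝ) < N := by exact_mod_cast hN.pos
  set r := (N : ℝ) ^ (-(9 / 4) : ℝ)
  have hdensity : N ^ 2 * (2 * (4 * K * r) / (c * ρ)) = C * (N : ℝ) ^ (-(1 / 4) : ℝ) := by
    calc _ = C * ((N : ℝ) ^ (2 : ℝ) * r) := by rw [Real.rpow_two]; ring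
      _ = _ := by rw [← Real.rpow_add hN₀]; norm_num
  have hdensity_sq : (C * (N : ℝ) ^ (-(1 / 4) : ℝ)) ^ 2 = C ^ 2 * (N : ℝ) ^ (-(1 / 2) : ℝ) := by
    rw [mul_pow, ← Real.rpow_mul_natCast hN₀.le]
    norm_num
  obtain ⟨y, hy, havoid⟩ := h.exists_avoiding_points ha hθ hI (by positivity) hr_theta hr_half.le
    ((lt_div_iff₀' (by positivity)).mp hr_quot) hN.pos (M := N ^ 3)
    (by rw [hdensity]; linarith) <| by
      rw [div_le_one (by positivity), Real.sqrt_eq_rpow]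
      linarith [samplingFactor_nonneg (2 * (2 * N ^ 3 + 1))]
  refine ⟨y, fun ξ hξ hξN ↦ (hy ξ hξ hξN).trans ?_, havoid⟩
  rw [hdensity, hdensity_sq, Real.sqrt_eq_rpow, div_eq_mul_inv, ← Real.rpow_neg hN₀.le,
    Real.rpow_add hN₀]
  calc _ = (N : ℝ) ^ (-(1 / 2) : ℝ) * (2 * samplingFactor (2 * (2 * N ^ 3 + 1)) + 4 * C ^ 2) := by
        ring
    _ ≤ _ := by gcongr

end AvoidingPointsAsymptotics

section Tent

open AddCircle

theorem norm_fourier_apply (n : ℤ) (x : UnitAddCircle) : ‖fourier n x‖ = 1 := by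
  rw [fourier_apply, Circle.norm_coe]

theorem fourier_apply_add (n : ℤ) (x y : UnitAddCircle) :
    fourier n (x + y) = fourier n x * fourier n y := by
  simp only [fourier_apply, smul_add, AddCircle.toCircle_add, Circle.coe_mul]

/-- The Fourier coefficients of a real-valued function on the circle. -/
noncomputable def realFourierCoeff (f : UnitAddCircle → ℝ) (n : ℤ) : ℂ :=
  fourierCoeff (fun x ↦ (f x : ℂ)) n

theorem integrable_of_continuous {E : Type*} [NormedAddCommGroup E] {f : UnitAddCircle → E}
    (hf : Continuous f) {μ : Measure UnitAddCircle} [IsFiniteMeasure μ] : Integrable f μ :=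
  hf.integrable_of_hasCompactSupport (HasCompactSupport.of_compactSpace f)

theorem realFourierCoeff_zero (f : UnitAddCircle → ℝ) :
    realFourierCoeff f 0 = ((∫ x, f x ∂haarAddCircle : ℝ) : ℂ) := by
  rw [realFourierCoeff, fourierCoeff, ← integral_complex_ofReal]
  simp only [neg_zero, fourier_zero, one_smul]

theorem norm_realFourierCoeff_le {f : UnitAddCircle → ℝ} (hf : ∀ x, 0 ≤ f x) (n : ℤ) :
    ‖realFourierCoeff f n‖ ≤ ∫ x, f x ∂haarAddCircle := by
  refine (norm_integral_le_integral_norm _).trans_eq (integral_congr_ae (.of_forall fun x ↦ ?_))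
  simp only [norm_smul, norm_fourier_apply, one_mul, Complex.norm_of_nonneg (hf x)]

theorem realFourierCoeff_const_mul (c : ℝ) (f : UnitAddCircle → ℝ) (n : ℤ) :
    realFourierCoeff (fun x ↦ c * f x) n = c * realFourierCoeff f n := by
  simp only [realFourierCoeff, Complex.ofReal_mul]
  exact fourierCoeff.const_mul _ _ _

theorem realFourierCoeff_sum {ι : Type*} (s : Finset ι) {f : ι → UnitAddCircle → ℝ}
    (hf : ∀ i ∈ s, Continuous (f i)) (n : ℤ) :
    realFourierCoeff (fun x ↦ ∑ i ∈ s, f i x) n = ∑ i ∈ s, realFourierCoeff (f i) n := by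
  have h := fourierCoeff.sum s (fun i x ↦ ((f i x : ℝ) : ℂ)) fun i hi ↦
    integrable_of_continuous (Complex.continuous_ofReal.comp (hf i hi))
  simpa only [realFourierCoeff, Complex.ofReal_sum, Finset.sum_fn, Finset.sum_apply]
    using congrFun h n

theorem realFourierCoeff_comp_sub (f : UnitAddCircle → ℝ) (a : UnitAddCircle) (n : ℤ) :
    realFourierCoeff (fun x ↦ f (x - a)) n = fourier (-n) a * realFourierCoeff f n := by
  rw [realFourierCoeff, fourierCoeff, realFourierCoeff, fourierCoeff, ← integral_const_mul,
    ← integral_sub_right_eq_self (fun x ↦ fourier (-n) a * (fourier (-n) x • (f x : ℂ))) a]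
  refine integral_congr_ae (.of_forall fun x ↦ ?_)
  have hsplit : fourier (-n) x = fourier (-n) (x - a) * fourier (-n) a := by
    rw [← fourier_apply_add, sub_add_cancel]
  simp only [smul_eq_mul]
  rw [hsplit]
  ring

theorem realFourierCoeff_eq_intervalIntegral {f : UnitAddCircle → ℝ} {r : ℝ} (hr : 0 < r)
    (hr2 : r ≤ 1 / 2) (hf : ∀ x, r ≤ ‖x‖ → f x = 0) (n : ℤ) :
    realFourierCoeff f n =
      ∫ x in (-r)..r, Complex.exp (-(2 * Real.pi * Complex.I * n) * x) * (f x : ℂ) := by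
  rw [realFourierCoeff, fourierCoeff_eq_intervalIntegral _ n (-(1 / 2) : ℝ), div_one, one_smul,
    intervalIntegral.integral_of_le (by norm_num), intervalIntegral.integral_of_le (by linarith),
    setIntegral_eq_of_subset_of_forall_sdiff_eq_zero measurableSet_Ioc
      (s := Ioc (-r) r) (Ioc_subset_Ioc (by linarith) (by linarith)) fun x hx ↦ ?_]
  · refine setIntegral_congr_fun measurableSet_Ioc fun x _ ↦ ?_
    simp only [fourier_coe_apply, smul_eq_mul]
    congr 2
    push_cast
    ring
  · have hx_le : |x| ≤ 1 / 2 := abs_le.mpr ⟨by linarith [hx.1.1], by linarith [hx.1.2]⟩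
    have hx_ge : r ≤ |x| := by
      by_contra! hlt
      exact hx.2 ⟨(abs_lt.mp hlt).1, (abs_lt.mp hlt).2.le⟩
    rw [hf x, Complex.ofReal_zero, smul_zero]
    rwa [(AddCircle.norm_coe_eq_abs_iff 1 one_ne_zero).mpr (by simpa using hx_le)]

/-- The tent function of radius `r` and integral `1` on the circle, a bump whose Fourier
coefficients decay quadratically. -/
noncomputable def tent (r : ℝ) (x : UnitAddCircle) : ℝ := max 0 (r - ‖x‖) / r ^ 2

theorem continuous_tent (r : ℝ) : Continuous (tent r) := by
  unfold tent
  fun_prop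

theorem tent_nonneg (r : ℝ) (x : UnitAddCircle) : 0 ≤ tent r x := by
  unfold tent
  positivity

theorem tent_eq_zero {r : ℝ} {x : UnitAddCircle} (h : r ≤ ‖x‖) : tent r x = 0 := by
  rw [tent, max_eq_left (by linarith), zero_div]

theorem tent_coe {r x : ℝ} (hr2 : r ≤ 1 / 2) (hx : |x| ≤ r) :
    tent r (x : UnitAddCircle) = (r - |x|) / r ^ 2 := by
  rw [tent, (AddCircle.norm_coe_eq_abs_iff 1 one_ne_zero).mpr (by
    simpa using hx.trans hr2), max_eq_right (by linarith)]

theorem realFourierCoeff_tent_eq_integral {r : ℝ} (hr : 0 < r) (hr2 : r ≤ 1 / 2) (n : ℤ) :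
    realFourierCoeff (tent r) n =
      ((∫ x in (-r)..0, Complex.exp (-(2 * Real.pi * Complex.I * n) * x) * (r + 1 * x)) +
        ∫ x in (0 : ℝ)..r, Complex.exp (-(2 * Real.pi * Complex.I * n) * x) * (r + -1 * x)) /
          r ^ 2 := by
  have hcont : Continuous fun x : ℝ ↦ Complex.exp (-(2 * Real.pi * Complex.I * n) * x) *
      (tent r (x : UnitAddCircle) : ℂ) := by
    have htent := (continuous_tent r).comp (AddCircle.continuous_mk' 1)
    exact (by fun_prop : Continuous fun x : ℝ ↦
      Complex.exp (-(2 * Real.pi * Complex.I * n) * x)).mul (Complex.continuous_ofReal.comp htent)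
  rw [realFourierCoeff_eq_intervalIntegral hr hr2 (fun _ ↦ tent_eq_zero),
    ← intervalIntegral.integral_add_adjacent_intervals (hcont.intervalIntegrable (-r) 0)
      (hcont.intervalIntegrable 0 r), add_div, ← intervalIntegral.integral_div,
    ← intervalIntegral.integral_div]
  congr 1
  · refine intervalIntegral.integral_congr fun x hx ↦ ?_
    rw [uIcc_of_le (by linarith)] at hx
    have habs : |x| = -x := abs_of_nonpos hx.2
    simp only [tent_coe hr2 (habs.trans_le (by linarith [hx.1])), habs]
    push_cast
    ring
  · refine intervalIntegral.integral_congr fun x hx ↦ ?_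
    rw [uIcc_of_le hr.le] at hx
    have habs : |x| = x := abs_of_nonneg hx.1
    simp only [tent_coe hr2 (habs.trans_le hx.2), habs]
    push_cast
    ring

theorem integral_tent {r : ℝ} (hr : 0 < r) (hr2 : r ≤ 1 / 2) :
    ∫ x, tent r x ∂haarAddCircle = 1 := by
  have haffine (a b u v : ℝ) : ∫ x in a..b, ((u : ℂ) + v * x) =
      ((u * (b - a) + v * ((b ^ 2 - a ^ 2) / 2) : ℝ) : ℂ) := by
    calc _ = ((∫ x in a..b, (u + v * x) : ℝ) : ℂ) := by
          rw [← intervalIntegral.integral_ofReal]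
          push_cast
          rfl
      _ = _ := by
          rw [intervalIntegral.integral_add (by simp) ((by fun_prop : Continuous fun x ↦ v * x)
            |>.intervalIntegrable _ _), intervalIntegral.integral_const,
            intervalIntegral.integral_const_mul, integral_id, smul_eq_mul, mul_comm (b - a)]
  have h := realFourierCoeff_tent_eq_integral hr hr2 0
  have hneg := haffine (-r) 0 r 1
  have hpos := haffine 0 r r (-1)
  simp only [realFourierCoeff_zero, Int.cast_zero, mul_zero, neg_zero, zero_mul, Complex.exp_zero,
    one_mul] at h
  push_cast at hneg hpos
  simp only [one_mul] at hneg
  rw [hneg, hpos] at h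
  have hr' : (r : ℂ) ≠ 0 := by exact_mod_cast hr.ne'
  rw [← Complex.ofReal_inj, h]
  push_cast
  field_simp
  ring

theorem integral_exp_neg_mul_mul_affine {l : ℂ} (hl : l ≠ 0) (u v : ℂ) (a b : ℝ) :
    ∫ x in a..b, Complex.exp (-l * x) * (u + v * x) =
      Complex.exp (-l * a) * ((u + v * a) / l + v / l ^ 2) -
        Complex.exp (-l * b) * ((u + v * b) / l + v / l ^ 2) := by
  have hderiv (x : ℝ) : HasDerivAt
      (fun x : ℝ ↦ -(Complex.exp (-l * x) * ((u + v * x) / l + v / l ^ 2)))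
      (Complex.exp (-l * x) * (u + v * x)) x := by
    have hid : HasDerivAt (fun x : ℝ ↦ (x : ℂ)) 1 x := Complex.ofRealCLM.hasDerivAt
    have hexp := (hid.const_mul (-l)).cexp
    have haffine := (((hid.const_mul v).const_add u).div_const l).add_const (v / l ^ 2)
    convert! (hexp.mul haffine).neg using 1
    field_simp
    ring
  rw [intervalIntegral.integral_eq_sub_of_hasDerivAt (fun x _ ↦ hderiv x)
    (Continuous.intervalIntegrable (by fun_prop) _ _)]
  ring

theorem realFourierCoeff_tent {r : ℝ} (hr : 0 < r) (hr2 : r ≤ 1 / 2) {n : ℤ} (hn : n ≠ 0) :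
    realFourierCoeff (tent r) n =
      (Complex.exp ((2 * Real.pi * (n * r) : ℝ) * Complex.I) +
        Complex.exp ((-(2 * Real.pi * (n * r)) : ℝ) * Complex.I) - 2) /
          (2 * Real.pi * Complex.I * (n * r)) ^ 2 := by
  have hl : 2 * Real.pi * Complex.I * n ≠ 0 :=
    mul_ne_zero Complex.two_pi_I_ne_zero (by exact_mod_cast hn)
  have hexp_pos : Complex.exp ((2 * Real.pi * (n * r) : ℝ) * Complex.I) =
      Complex.exp (-(2 * Real.pi * Complex.I * n) * (-r : ℝ)) := by
    congr 1
    push_cast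
    ring
  have hexp_neg : Complex.exp ((-(2 * Real.pi * (n * r)) : ℝ) * Complex.I) =
      Complex.exp (-(2 * Real.pi * Complex.I * n) * r) := by
    congr 1
    push_cast
    ring
  rw [realFourierCoeff_tent_eq_integral hr hr2, integral_exp_neg_mul_mul_affine hl,
    integral_exp_neg_mul_mul_affine hl, hexp_pos, hexp_neg]
  have hr' : (r : ℂ) ≠ 0 := by exact_mod_cast hr.ne'
  have hn' : (n : ℂ) ≠ 0 := by exact_mod_cast hn
  push_cast
  simp only [mul_zero, Complex.exp_zero]
  field_simp
  ring

theorem norm_realFourierCoeff_tent_le_one {r : ℝ} (hr : 0 < r) (hr2 : r ≤ 1 / 2) (n : ℤ) :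
    ‖realFourierCoeff (tent r) n‖ ≤ 1 :=
  (norm_realFourierCoeff_le (tent_nonneg r) n).trans_eq (integral_tent hr hr2)

theorem norm_realFourierCoeff_tent_le {r : ℝ} (hr : 0 < r) (hr2 : r ≤ 1 / 2) {n : ℤ}
    (hn : n ≠ 0) : ‖realFourierCoeff (tent r) n‖ ≤ 1 / (r * |(n : ℝ)|) ^ 2 := by
  have : 0 < |(n : ℝ)| := abs_pos.mpr (by exact_mod_cast hn)
  have hnumerator (y : ℝ) :
      ‖Complex.exp (y * Complex.I) + Complex.exp ((-y : ℝ) * Complex.I) - 2‖ ≤ 4 := by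
    calc _ ≤ ‖Complex.exp (y * Complex.I)‖ + ‖Complex.exp ((-y : ℝ) * Complex.I)‖ + ‖(2 : ℂ)‖ :=
          norm_sub_le_of_le (norm_add_le _ _) le_rfl
      _ = 4 := by
          rw [Complex.norm_exp_ofReal_mul_I, Complex.norm_exp_ofReal_mul_I, Complex.norm_ofNat]
          norm_num
  have hdenominator : ‖(2 * Real.pi * Complex.I * (n * r) : ℂ) ^ 2‖ =
      4 * Real.pi ^ 2 * (r * |(n : ℝ)|) ^ 2 := by
    simp only [norm_pow, norm_mul, Complex.norm_ofNat, Complex.norm_I, Complex.norm_intCast,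
      Complex.norm_of_nonneg hr.le, Complex.norm_of_nonneg Real.pi_pos.le]
    ring
  rw [realFourierCoeff_tent hr hr2 hn, norm_div, hdenominator,
    div_le_div_iff₀ (by positivity) (by positivity)]
  have hpi : (1 : ℝ) ≤ Real.pi ^ 2 := one_le_pow₀ (by linarith [Real.pi_gt_three])
  calc _ ≤ 4 * (r * |(n : ℝ)|) ^ 2 := by gcongr; exact hnumerator _
    _ ≤ 4 * (r * |(n : ℝ)|) ^ 2 * Real.pi ^ 2 := le_mul_of_one_le_right (by positivity) hpi
    _ = _ := by ring

theorem norm_realFourierCoeff_tent_le_rpow {r : ℝ} (hr : 0 < r) (hr2 : r ≤ 1 / 2) {n : ℤ}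
    (hn : n ≠ 0) {s : ℝ} (hs0 : 0 ≤ s) (hs2 : s ≤ 2) :
    ‖realFourierCoeff (tent r) n‖ ≤ (r * |(n : ℝ)|) ^ (-s) := by
  have : 0 < |(n : ℝ)| := abs_pos.mpr (by exact_mod_cast hn)
  have hrn : 0 < r * |(n : ℝ)| := by positivity
  rcases le_total 1 (r * |(n : ℝ)|) with hge | hle
  · refine (norm_realFourierCoeff_tent_le hr hr2 hn).trans ?_
    rw [one_div, ← Real.rpow_natCast, ← Real.rpow_neg hrn.le]
    exact Real.rpow_le_rpow_of_exponent_le hge (by push_cast; linarith)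
  · exact (norm_realFourierCoeff_tent_le_one hr hr2 n).trans
      (Real.one_le_rpow_of_pos_of_le_one_of_nonpos hrn hle (by linarith))

end Tent

section QuadraticDecay

open AddCircle Filter

theorem summable_one_add_abs_int_rpow {p : ℝ} (hp : 1 < p) :
    Summable fun n : ℤ ↦ (1 + |(n : ℝ)|) ^ (-p) := by
  refine Summable.of_norm_bounded_eventually (Real.summable_abs_int_rpow hp) ?_
  filter_upwards [(finite_singleton (0 : ℤ)).compl_mem_cofinite] with n hn
  have hn' : 0 < |(n : ℝ)| := abs_pos.mpr (by exact_mod_cast hn)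
  rw [Real.norm_of_nonneg (by positivity)]
  exact Real.rpow_le_rpow_of_nonpos hn' (by linarith) (by linarith)

theorem summable_one_div_one_add_abs_int_sq :
    Summable fun n : ℤ ↦ 1 / (1 + |(n : ℝ)|) ^ 2 := by
  refine (summable_one_add_abs_int_rpow one_lt_two).congr fun n ↦ ?_
  rw [Real.rpow_neg (by positivity), one_div, Real.rpow_two]

theorem hasSum_int_comp_sub_left {f : ℤ → ℝ} {S : ℝ} (hf : HasSum f S) (ξ : ℤ) :
    HasSum (fun n ↦ f (ξ - n)) S :=
  (Equiv.subLeft ξ).hasSum_iff.mpr hf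

theorem one_add_abs_int_le_add (ξ η : ℤ) :
    1 + |(ξ : ℝ)| ≤ 1 + |(η : ℝ)| + |((ξ - η : ℤ) : ℝ)| := by
  have h := abs_add_le (η : ℝ) ((ξ - η : ℤ) : ℝ)
  rw [← Int.cast_add, add_sub_cancel] at h
  linarith

/-- The Fourier coefficients of `f` decay at least quadratically. -/
def HasQuadraticDecay (f : UnitAddCircle → ℝ) : Prop :=
  ∃ C : ℝ, ∀ n : ℤ, ‖realFourierCoeff f n‖ ≤ C * (1 / (1 + |(n : ℝ)|) ^ 2)

theorem HasQuadraticDecay.exists_nonneg {f : UnitAddCircle → ℝ} (h : HasQuadraticDecay f) :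
    ∃ C : ℝ, 0 ≤ C ∧ ∀ n : ℤ, ‖realFourierCoeff f n‖ ≤ C * (1 / (1 + |(n : ℝ)|) ^ 2) := by
  obtain ⟨C, hC⟩ := h
  exact ⟨C, by simpa using (norm_nonneg _).trans (hC 0), hC⟩

theorem HasQuadraticDecay.summable {f : UnitAddCircle → ℝ} (h : HasQuadraticDecay f) :
    Summable (realFourierCoeff f) := by
  obtain ⟨C, hC⟩ := h
  exact .of_norm_bounded (summable_one_div_one_add_abs_int_sq.mul_left C) hC

theorem hasSum_realFourierCoeff_mul_fourier {F : UnitAddCircle → ℝ} (hF : Continuous F)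
    (hsum : Summable (realFourierCoeff F)) (x : UnitAddCircle) :
    HasSum (fun η ↦ realFourierCoeff F η * fourier η x) (F x : ℂ) := by
  let FC : C(UnitAddCircle, ℂ) := ⟨fun x ↦ (F x : ℂ), Complex.continuous_ofReal.comp hF⟩
  exact has_pointwise_sum_fourier_series_of_summable (f := FC) hsum x

theorem realFourierCoeff_sub (f : UnitAddCircle → ℝ) (ξ η : ℤ) :
    realFourierCoeff f (ξ - η) = ∫ x, fourier (-ξ) x * (f x * fourier η x) ∂haarAddCircle := by
  refine integral_congr_ae (.of_forall fun x ↦ ?_)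
  have hsplit : fourier (-(ξ - η)) x = fourier (-ξ) x * fourier η x := by
    rw [← fourier_add, neg_sub', sub_neg_eq_add]
  simp only [hsplit, smul_eq_mul]
  ring

theorem hasSum_realFourierCoeff_mul {f F : UnitAddCircle → ℝ} (hf : Continuous f)
    (hF : Continuous F) (hsum : Summable (realFourierCoeff F)) (ξ : ℤ) :
    HasSum (fun η ↦ realFourierCoeff F η * realFourierCoeff f (ξ - η))
      (realFourierCoeff (fun x ↦ f x * F x) ξ) := by
  let term (η : ℤ) (x : UnitAddCircle) : ℂ :=
    realFourierCoeff F η * (fourier (-ξ) x * (f x * fourier η x))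
  have hterm_cont (η : ℤ) : Continuous (term η) := by
    have hfC : Continuous fun x : UnitAddCircle ↦ (f x : ℂ) := Complex.continuous_ofReal.comp hf
    have hξ := (fourier (T := (1 : ℝ)) (-ξ)).continuous
    have hη := (fourier (T := (1 : ℝ)) η).continuous
    exact continuous_const.mul (hξ.mul (hfC.mul hη))
  have hterm_norm (η : ℤ) : ∫ x, ‖term η x‖ ∂haarAddCircle =
      ‖realFourierCoeff F η‖ * ∫ x, ‖f x‖ ∂haarAddCircle := by
    rw [← integral_const_mul]
    refine integral_congr_ae (.of_forall fun x ↦ ?_)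
    simp only [term, norm_mul, norm_fourier_apply, Complex.norm_real, one_mul, mul_one]
  have hterm_tsum (x : UnitAddCircle) :
      ∑' η, term η x = fourier (-ξ) x • ((f x * F x : ℝ) : ℂ) := by
    have hx := ((hasSum_realFourierCoeff_mul_fourier hF hsum x).mul_left
      (fourier (-ξ) x * (f x : ℂ))).tsum_eq
    rw [smul_eq_mul, Complex.ofReal_mul, ← mul_assoc, ← hx]
    exact tsum_congr fun η ↦ by ring
  have hintegral := hasSum_integral_of_summable_integral_norm (F := term)
    (fun η ↦ integrable_of_continuous (μ := haarAddCircle) (hterm_cont η))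
    (by simpa only [hterm_norm] using hsum.norm.mul_right _)
  simp only [hterm_tsum, term, integral_const_mul, ← realFourierCoeff_sub] at hintegral
  exact hintegral

theorem one_div_sq_mul_one_div_sq_le {x y z : ℝ} (hx : 0 < x) (hy : 0 < y) (hz : 0 < z)
    (hxyz : z ≤ x + y) :
    1 / x ^ 2 * (1 / y ^ 2) ≤ 2 * (1 / z ^ 2) * (1 / x ^ 2 + 1 / y ^ 2) := by
  have hsq : z ^ 2 ≤ 2 * (x ^ 2 + y ^ 2) := by nlinarith [sq_nonneg (x - y)]
  calc 1 / x ^ 2 * (1 / y ^ 2)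
      ≤ 2 * (x ^ 2 + y ^ 2) / z ^ 2 * (1 / x ^ 2 * (1 / y ^ 2)) :=
        le_mul_of_one_le_left (by positivity) ((one_le_div (by positivity)).mpr hsq)
    _ = _ := by
        field_simp
        ring

theorem HasQuadraticDecay.mul {f F : UnitAddCircle → ℝ} (hf : Continuous f) (hF : Continuous F)
    (hf_decay : HasQuadraticDecay f) (hF_decay : HasQuadraticDecay F) :
    HasQuadraticDecay fun x ↦ f x * F x := by
  obtain ⟨C, hC₀, hC⟩ := hf_decay.exists_nonneg
  obtain ⟨D, hD₀, hD⟩ := hF_decay.exists_nonneg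
  obtain ⟨S, hS⟩ := summable_one_div_one_add_abs_int_sq
  refine ⟨4 * C * D * S, fun ξ ↦ ?_⟩
  have hbound := (hS.add (hasSum_int_comp_sub_left hS ξ)).mul_left
    (2 * C * D * (1 / (1 + |(ξ : ℝ)|) ^ 2))
  have hterm (η : ℤ) : ‖realFourierCoeff F η * realFourierCoeff f (ξ - η)‖ ≤
      2 * C * D * (1 / (1 + |(ξ : ℝ)|) ^ 2) *
        (1 / (1 + |(η : ℝ)|) ^ 2 + 1 / (1 + |((ξ - η : ℤ) : ℝ)|) ^ 2) := by
    calc _ ≤ D * (1 / (1 + |(η : ℝ)|) ^ 2) * (C * (1 / (1 + |((ξ - η : ℤ) : ℝ)|) ^ 2)) :=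
          norm_mul_le_of_le (hD η) (hC (ξ - η))
      _ = C * D * (1 / (1 + |(η : ℝ)|) ^ 2 * (1 / (1 + |((ξ - η : ℤ) : ℝ)|) ^ 2)) := by ring
      _ ≤ C * D * (2 * (1 / (1 + |(ξ : ℝ)|) ^ 2) *
          (1 / (1 + |(η : ℝ)|) ^ 2 + 1 / (1 + |((ξ - η : ℤ) : ℝ)|) ^ 2)) := by
        have hadd := one_add_abs_int_le_add ξ η
        refine mul_le_mul_of_nonneg_left ?_ (by positivity)
        apply one_div_sq_mul_one_div_sq_le <;> first | positivity | linarith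
      _ = _ := by ring
  exact ((hasSum_realFourierCoeff_mul hf hF hF_decay.summable ξ).norm_le_of_bounded hbound
    hterm).trans_eq (by ring)

theorem rpow_neg_mul_one_div_sq_le {x y z s : ℝ} (hx : 0 < x) (hy : 1 ≤ y) (hz : 0 < z)
    (hzxy : z ≤ 2 * x * y) (hs₀ : 0 ≤ s) (hs : s ≤ 1 / 2) :
    x ^ (-s) * (1 / y ^ 2) ≤ 2 * z ^ (-s) * y ^ (-(3 / 2) : ℝ) := by
  have hy₀ : 0 < y := by linarith
  have hzs : z ^ s ≤ 2 * (x ^ s * y ^ s) := by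
    calc z ^ s ≤ (2 * x * y) ^ s := Real.rpow_le_rpow hz.le hzxy hs₀
      _ = 2 ^ s * (x ^ s * y ^ s) := by
        rw [mul_assoc, Real.mul_rpow zero_le_two (by positivity), Real.mul_rpow hx.le hy₀.le]
      _ ≤ 2 ^ (1 : ℝ) * (x ^ s * y ^ s) := by
        gcongr
        · exact one_le_two
        · linarith
      _ = _ := by rw [Real.rpow_one]
  have hx_le : x ^ (-s) ≤ 2 * z ^ (-s) * y ^ s := by
    rw [Real.rpow_neg hx.le, Real.rpow_neg hz.le, inv_le_iff_one_le_mul₀ (by positivity)]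
    calc 1 = (z ^ s)⁻¹ * z ^ s := (inv_mul_cancel₀ (by positivity)).symm
      _ ≤ (z ^ s)⁻¹ * (2 * (x ^ s * y ^ s)) := by gcongr
      _ = _ := by ring
  calc _ ≤ 2 * z ^ (-s) * y ^ s * (1 / y ^ 2) := by gcongr
    _ = 2 * z ^ (-s) * y ^ (s - 2) := by
      rw [Real.rpow_sub hy₀, Real.rpow_two]
      ring
    _ ≤ _ := by
      gcongr
      linarith

theorem HasQuadraticDecay.exists_norm_mul_sub_le {f : UnitAddCircle → ℝ} (hf : Continuous f)
    (hf_decay : HasQuadraticDecay f) :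
    ∃ A : ℝ, 0 < A ∧ ∀ (F : UnitAddCircle → ℝ) (δ s : ℝ), Continuous F →
      Summable (realFourierCoeff F) → realFourierCoeff F 0 = 1 → 0 ≤ s → s ≤ 1 / 2 → 0 ≤ δ →
      (∀ n : ℤ, n ≠ 0 → ‖realFourierCoeff F n‖ ≤ δ * |(n : ℝ)| ^ (-s)) →
      ∀ ξ : ℤ, ‖realFourierCoeff (fun x ↦ f x * F x) ξ - realFourierCoeff f ξ‖ ≤
        A * δ * (1 + |(ξ : ℝ)|) ^ (-s) := by
  obtain ⟨C, hC₀, hC⟩ := hf_decay.exists_nonneg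
  obtain ⟨S, hS⟩ := summable_one_add_abs_int_rpow (p := 3 / 2) (by norm_num)
  have hS₀ : 0 ≤ S := hS.nonneg fun n ↦ by positivity
  refine ⟨2 * C * S + 1, by positivity, fun F δ s hF hsum hF₀ hs₀ hs hδ hdecay ξ ↦ ?_⟩
  have hbound := (hasSum_int_comp_sub_left hS ξ).mul_left (2 * C * δ * (1 + |(ξ : ℝ)|) ^ (-s))
  -- The term `η = 0` of the convolution is the coefficient of `f` itself.
  have hdiff := hasSum_ite_sub_hasSum (hasSum_realFourierCoeff_mul hf hF hsum ξ) 0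
  rw [hF₀, one_mul, sub_zero] at hdiff
  refine (hdiff.norm_le_of_bounded hbound fun η ↦ ?_).trans ?_
  · split_ifs with hη
    · rw [norm_zero]
      positivity
    have hη' : 1 ≤ |(η : ℝ)| := by exact_mod_cast Int.one_le_abs hη
    calc _ ≤ δ * |(η : ℝ)| ^ (-s) * (C * (1 / (1 + |((ξ - η : ℤ) : ℝ)|) ^ 2)) :=
          norm_mul_le_of_le (hdecay η hη) (hC (ξ - η))
      _ = C * δ * (|(η : ℝ)| ^ (-s) * (1 / (1 + |((ξ - η : ℤ) : ℝ)|) ^ 2)) := by ring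
      _ ≤ C * δ * (2 * (1 + |(ξ : ℝ)|) ^ (-s) * (1 + |((ξ - η : ℤ) : ℝ)|) ^ (-(3 / 2) : ℝ)) := by
        refine mul_le_mul_of_nonneg_left ?_ (by positivity)
        have hdist := abs_nonneg ((ξ - η : ℤ) : ℝ)
        apply rpow_neg_mul_one_div_sq_le <;>
          first | positivity | linarith | nlinarith [one_add_abs_int_le_add ξ η]
      _ = _ := by ring
  · have : 0 ≤ δ * (1 + |(ξ : ℝ)|) ^ (-s) := by positivity
    linarith

end QuadraticDecay

section TentSum

open AddCircle

variable {κ : Type*} [Fintype κ] {r : ℝ} {w : κ → ℝ} {y : κ → UnitAddCircle} {x : UnitAddCircle}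

/-- The superposition with weights `w` of tents of radius `r` centred at the points `y`. -/
noncomputable def tentSum (r : ℝ) (w : κ → ℝ) (y : κ → UnitAddCircle) (x : UnitAddCircle) : ℝ :=
  ∑ k, w k * tent r (x - y k)

theorem continuous_tentSum (r : ℝ) (w : κ → ℝ) (y : κ → UnitAddCircle) :
    Continuous (tentSum r w y) := by
  have := continuous_tent r
  unfold tentSum
  fun_prop

theorem tentSum_nonneg (hw : ∀ k, 0 ≤ w k) : 0 ≤ tentSum r w y x :=
  Finset.sum_nonneg fun k _ ↦ mul_nonneg (hw k) (tent_nonneg _ _)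

theorem exists_dist_le_of_tentSum_ne_zero (h : tentSum r w y x ≠ 0) : ∃ k, dist x (y k) ≤ r := by
  obtain ⟨k, -, hk⟩ := Finset.exists_ne_zero_of_sum_ne_zero h
  refine ⟨k, ?_⟩
  by_contra! hlt
  rw [dist_eq_norm] at hlt
  exact right_ne_zero_of_mul hk (tent_eq_zero hlt.le)

theorem realFourierCoeff_tentSum (r : ℝ) (w : κ → ℝ) (y : κ → UnitAddCircle) (n : ℤ) :
    realFourierCoeff (tentSum r w y) n =
      (∑ k, (w k : ℂ) * fourier (-n) (y k)) * realFourierCoeff (tent r) n := by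
  have hc (k : κ) : Continuous fun x ↦ w k * tent r (x - y k) := by
    have := continuous_tent r
    fun_prop
  unfold tentSum
  rw [realFourierCoeff_sum _ fun k _ ↦ hc k, Finset.sum_mul]
  refine Finset.sum_congr rfl fun k _ ↦ ?_
  rw [realFourierCoeff_const_mul, realFourierCoeff_comp_sub, mul_assoc]

theorem realFourierCoeff_tentSum_zero (hr : 0 < r) (hr2 : r ≤ 1 / 2) (hw1 : ∑ k, w k = 1)
    (y : κ → UnitAddCircle) : realFourierCoeff (tentSum r w y) 0 = 1 := by
  rw [realFourierCoeff_tentSum, realFourierCoeff_zero, integral_tent hr hr2]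
  simp only [neg_zero, fourier_zero, mul_one, Complex.ofReal_one]
  exact_mod_cast hw1

theorem norm_sum_mul_fourier_le_one (hw : ∀ k, 0 ≤ w k) (hw1 : ∑ k, w k = 1)
    (y : κ → UnitAddCircle) (n : ℤ) : ‖∑ k, (w k : ℂ) * fourier n (y k)‖ ≤ 1 := by
  refine (norm_sum_le_of_le _ fun k _ ↦ ?_).trans hw1.le
  rw [norm_mul, Complex.norm_of_nonneg (hw k), norm_fourier_apply, mul_one]

theorem norm_realFourierCoeff_tentSum_le (hw : ∀ k, 0 ≤ w k) (hw1 : ∑ k, w k = 1)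
    (y : κ → UnitAddCircle) (n : ℤ) :
    ‖realFourierCoeff (tentSum r w y) n‖ ≤ ‖realFourierCoeff (tent r) n‖ := by
  rw [realFourierCoeff_tentSum, norm_mul]
  exact mul_le_of_le_one_left (norm_nonneg _) (norm_sum_mul_fourier_le_one hw hw1 y _)

theorem hasQuadraticDecay_tent (hr : 0 < r) (hr2 : r ≤ 1 / 2) : HasQuadraticDecay (tent r) := by
  refine ⟨4 / r ^ 2, fun n ↦ ?_⟩
  rw [div_mul_div_comm, mul_one]
  rcases eq_or_ne n 0 with rfl | hn
  · refine (norm_realFourierCoeff_tent_le_one hr hr2 0).trans ?_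
    rw [Int.cast_zero, abs_zero, add_zero, one_pow, mul_one, one_le_div (by positivity)]
    nlinarith
  · have hn1 : 1 ≤ |(n : ℝ)| := by exact_mod_cast Int.one_le_abs hn
    refine (norm_realFourierCoeff_tent_le hr hr2 hn).trans ?_
    rw [div_le_div_iff₀ (by positivity) (by positivity), one_mul, mul_pow]
    calc r ^ 2 * (1 + |(n : ℝ)|) ^ 2 ≤ r ^ 2 * (2 * |(n : ℝ)|) ^ 2 := by gcongr; linarith
      _ = 4 * (r ^ 2 * |(n : ℝ)| ^ 2) := by ring

theorem hasQuadraticDecay_tentSum (hr : 0 < r) (hr2 : r ≤ 1 / 2) (hw : ∀ k, 0 ≤ w k)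
    (hw1 : ∑ k, w k = 1) (y : κ → UnitAddCircle) : HasQuadraticDecay (tentSum r w y) :=
  (hasQuadraticDecay_tent hr hr2).imp fun _ h n ↦
    (norm_realFourierCoeff_tentSum_le hw hw1 y n).trans (h n)

end TentSum

section Multiplier

open AddCircle Filter Topology

variable {κ : Type*} [Fintype κ] {w : κ → ℝ} {y : κ → UnitAddCircle} {N : ℕ} {s : ℝ} {n : ℤ}

theorem natCast_rpow_rpow (N : ℕ) (x y : ℝ) : ((N : ℝ) ^ x) ^ y = (N : ℝ) ^ (x * y) :=
  (Real.rpow_mul N.cast_nonneg x y).symm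

theorem norm_realFourierCoeff_tentSum_le_of_norm_sum_le (hN : 0 < N)
    (hr2 : (N : ℝ) ^ (-(9 / 4) : ℝ) ≤ 1 / 2) (hs0 : 0 ≤ s) (hs2 : s ≤ 2) (hn : n ≠ 0) {ε : ℝ}
    (h : ‖∑ k, (w k : ℂ) * fourier (-n) (y k)‖ ≤ (N : ℝ) ^ (-(1 / 2) + ε)) :
    ‖realFourierCoeff (tentSum ((N : ℝ) ^ (-(9 / 4) : ℝ)) w y) n‖ ≤
      (N : ℝ) ^ (-(1 / 2 - 9 / 4 * s - ε)) * |(n : ℝ)| ^ (-s) := by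
  have hN0 : (0 : ℝ) < N := by exact_mod_cast hN
  have htent := norm_realFourierCoeff_tent_le_rpow (by positivity) hr2 hn hs0 hs2
  rw [Real.mul_rpow (by positivity) (abs_nonneg _), natCast_rpow_rpow] at htent
  rw [realFourierCoeff_tentSum]
  calc _ ≤ (N : ℝ) ^ (-(1 / 2) + ε) * ((N : ℝ) ^ (-(9 / 4) * -s) * |(n : ℝ)| ^ (-s)) :=
        norm_mul_le_of_le h htent
    _ = _ := by
      rw [← mul_assoc, ← Real.rpow_add hN0]
      ring_nf

theorem norm_realFourierCoeff_tentSum_le_of_pow_three_le_abs (hN : 0 < N)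
    (hr2 : (N : ℝ) ^ (-(9 / 4) : ℝ) ≤ 1 / 2) (hw : ∀ k, 0 ≤ w k) (hw1 : ∑ k, w k = 1)
    (hs : s ≤ 1 / 3) (hn : (N : ℝ) ^ 3 ≤ |(n : ℝ)|) :
    ‖realFourierCoeff (tentSum ((N : ℝ) ^ (-(9 / 4) : ℝ)) w y) n‖ ≤
      (N : ℝ) ^ (-(1 / 2) : ℝ) * |(n : ℝ)| ^ (-s) := by
  have hN1 : (1 : ℝ) ≤ N := by exact_mod_cast hN
  have hN0 : (0 : ℝ) < N := by linarith
  have hn0 : 0 < |(n : ℝ)| := (pow_pos hN0 3).trans_le hn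
  have hn' : n ≠ 0 := by rintro rfl; simp at hn0
  have htent := norm_realFourierCoeff_tent_le_rpow (by positivity) hr2 hn' zero_le_two le_rfl
  rw [Real.mul_rpow (by positivity) (abs_nonneg _), natCast_rpow_rpow] at htent
  have htail : |(n : ℝ)| ^ (-2 + s) ≤ (N : ℝ) ^ (3 * (-2 + s)) := by
    rw [Real.rpow_mul hN0.le]
    exact Real.rpow_le_rpow_of_nonpos (by positivity) (by exact_mod_cast hn) (by linarith)
  calc _ ≤ (N : ℝ) ^ (-(9 / 4) * -2 : ℝ) * |(n : ℝ)| ^ (-2 : ℝ) :=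
        (norm_realFourierCoeff_tentSum_le hw hw1 y n).trans htent
    _ = (N : ℝ) ^ (-(9 / 4) * -2 : ℝ) * |(n : ℝ)| ^ (-2 + s) * |(n : ℝ)| ^ (-s) := by
      rw [mul_assoc, ← Real.rpow_add hn0, add_neg_cancel_right]
    _ ≤ (N : ℝ) ^ (-(9 / 4) * -2 : ℝ) * (N : ℝ) ^ (3 * (-2 + s)) * |(n : ℝ)| ^ (-s) := by gcongr
    _ = (N : ℝ) ^ (-(9 / 4) * -2 + 3 * (-2 + s)) * |(n : ℝ)| ^ (-s) := by rw [Real.rpow_add hN0]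
    _ ≤ _ := by gcongr; linarith

/-- Nonnegative continuous functions on the circle whose Fourier coefficients decay at least
quadratically: the densities of the measures approximating the Salem measure. -/
structure IsDecayingDensity (f : UnitAddCircle → ℝ) : Prop where
  continuous : Continuous f
  nonneg : ∀ x, 0 ≤ f x
  decay : HasQuadraticDecay f

theorem IsDecayingDensity.mul {f g : UnitAddCircle → ℝ} (hf : IsDecayingDensity f)
    (hg : IsDecayingDensity g) : IsDecayingDensity fun x ↦ f x * g x :=
  ⟨hf.continuous.mul hg.continuous, fun x ↦ mul_nonneg (hf.nonneg x) (hg.nonneg x),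
    hf.decay.mul hf.continuous hg.continuous hg.decay⟩

theorem IsDecayingDensity.comp_sub {f : UnitAddCircle → ℝ} (hf : IsDecayingDensity f)
    (a : UnitAddCircle) : IsDecayingDensity fun x ↦ f (x - a) where
  continuous := hf.continuous.comp (continuous_sub_right a)
  nonneg x := hf.nonneg (x - a)
  decay := hf.decay.imp fun _ h n ↦ by
    rw [realFourierCoeff_comp_sub, norm_mul, norm_fourier_apply, one_mul]
    exact h n

theorem isDecayingDensity_tent {r : ℝ} (hr : 0 < r) (hr2 : r ≤ 1 / 2) :
    IsDecayingDensity (tent r) :=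
  ⟨continuous_tent r, tent_nonneg r, hasQuadraticDecay_tent hr hr2⟩

theorem isDecayingDensity_tentSum {r : ℝ} (hr : 0 < r) (hr2 : r ≤ 1 / 2) (hw : ∀ k, 0 ≤ w k)
    (hw1 : ∑ k, w k = 1) (y : κ → UnitAddCircle) : IsDecayingDensity (tentSum r w y) :=
  ⟨continuous_tentSum _ _ _, fun _ ↦ tentSum_nonneg hw, hasQuadraticDecay_tentSum hr hr2 hw hw1 y⟩

theorem eventually_card_image_mul_rpow_le [DecidableEq UnitAddCircle] {p δ : ℝ} (hp : 4 / 9 < p)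
    (hδ : 0 < δ) : ∀ᶠ N : ℕ in atTop, ∀ y : Option (Fin 3) × Fin N → UnitAddCircle,
      (Finset.univ.image y).card * ((N : ℝ) ^ (-(9 / 4) : ℝ)) ^ p ≤ δ := by
  have hlim := tendsto_natCast_rpow_neg (show 0 < 9 / 4 * p - 1 by linarith)
  filter_upwards [eventually_gt_atTop 0, hlim.eventually_lt_const (show 0 < δ / 4 by positivity)]
    with N hN hδN y
  have hN0 : (0 : ℝ) < N := by exact_mod_cast hN
  have hcard : (Finset.univ.image y).card ≤ 4 * N := by
    simpa using Finset.card_image_le (s := Finset.univ) (f := y)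
  calc _ ≤ ((4 * N : ℕ) : ℝ) * (N : ℝ) ^ (-(9 / 4) * p) := by
        rw [natCast_rpow_rpow]
        gcongr
    _ = 4 * (N : ℝ) ^ (-(9 / 4 * p - 1)) := by
      rw [neg_sub, sub_eq_add_neg, Real.rpow_add hN0, Real.rpow_one, ← neg_mul]
      push_cast
      ring
    _ ≤ δ := by linarith

/-- A multiplier: a density of mean one, the other Fourier coefficients of which are at most
`δ |n| ^ (-s)`, and which is supported on the balls of radius `r ≤ δ` around finitely many points
`P` with `|P| r ^ p ≤ δ`. -/
structure IsMultiplier (F : UnitAddCircle → ℝ) (r : ℝ) (P : Finset UnitAddCircle) (δ s p : ℝ) :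
    Prop extends IsDecayingDensity F where
  coeff_zero : realFourierCoeff F 0 = 1
  norm_coeff_le : ∀ n : ℤ, n ≠ 0 → ‖realFourierCoeff F n‖ ≤ δ * |(n : ℝ)| ^ (-s)
  radius_pos : 0 < r
  radius_le : r ≤ δ
  card_mul_rpow_le : P.card * r ^ p ≤ δ
  exists_dist_le : ∀ x, F x ≠ 0 → ∃ y ∈ P, dist x y ≤ r

theorem RegularDistances.exists_multiplier {V : Type*} [NormedAddCommGroup V] {γ : ℝ → V}
    {I : Set ℝ} {c K θ : ℝ} (h : RegularDistances γ I c K) (hθ : 0 < θ)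
    (hI : I ⊆ Icc θ (1 - θ)) {a : Fin 3 → ℝ} {ρ : ℝ} (ha : IsSeparatedTriple I a ρ) {s p δ : ℝ}
    (hs0 : 0 ≤ s) (hs : s < 2 / 9) (hp : 4 / 9 < p) (hδ : 0 < δ) :
    ∃ F r P, IsMultiplier F r P δ s p ∧ AvoidsIsoscelesNear γ a (ρ / 2) r P := by
  classical
  set ε := (1 / 2 - 9 / 4 * s) / 2 with hε
  have hε0 : 0 < ε := by linarith
  have hlim {y b : ℝ} (hy : 0 < y) (hb : 0 < b) : ∀ᶠ N : ℕ in atTop, (N : ℝ) ^ (-y) < b :=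
    (tendsto_natCast_rpow_neg hy).eventually_lt_const hb
  obtain ⟨N, ⟨y, hexp, havoid⟩, hN, hr2, hrδ, hlow, hhigh, hcard⟩ :=
    ((h.eventually_exists_avoiding_points ha hθ hI hε0).and <| (eventually_gt_atTop 0).and <|
      (hlim (y := 9 / 4) (by norm_num) one_half_pos).and <|
      (hlim (y := 9 / 4) (by norm_num) hδ).and <| (hlim hε0 hδ).and <|
      (hlim one_half_pos hδ).and <| eventually_card_image_mul_rpow_le hp hδ).exists
  have hr0 : 0 < (N : ℝ) ^ (-(9 / 4) : ℝ) := by positivity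
  have hw := ballIndexWeight_nonneg a ρ (N := N)
  have hw1 := ha.sum_ballIndexWeight hN
  refine ⟨tentSum ((N : ℝ) ^ (-(9 / 4) : ℝ)) (ballIndexWeight a ρ N) y, _, Finset.univ.image y,
    { toIsDecayingDensity := isDecayingDensity_tentSum hr0 hr2.le hw hw1 y
      coeff_zero := realFourierCoeff_tentSum_zero hr0 hr2.le hw1 y
      norm_coeff_le := fun n hn ↦ ?_
      radius_pos := hr0
      radius_le := hrδ.le
      card_mul_rpow_le := hcard y
      exists_dist_le := fun x hx ↦ ?_ }, by simpa using havoid⟩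
  · rcases le_total |n| (N ^ 3 : ℕ) with hnN | hnN
    · refine (norm_realFourierCoeff_tentSum_le_of_norm_sum_le hN hr2.le hs0 (by linarith) hn
        (hexp n hn hnN)).trans ?_
      rw [show 1 / 2 - 9 / 4 * s - ε = ε by rw [hε]; ring]
      gcongr
    · have hn3 : (N : ℝ) ^ 3 ≤ |(n : ℝ)| := by exact_mod_cast hnN
      refine (norm_realFourierCoeff_tentSum_le_of_pow_three_le_abs (s := s) hN hr2.le hw hw1
        (by linarith) hn3).trans ?_
      gcongr
  · obtain ⟨k, hk⟩ := exists_dist_le_of_tentSum_ne_zero hx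
    exact ⟨y k, Finset.mem_image_of_mem y (Finset.mem_univ k), hk⟩

end Multiplier

section Energy

open AddCircle Filter

theorem exists_coe_eq_and_abs_eq_norm (x : UnitAddCircle) :
    ∃ z : ℝ, (z : UnitAddCircle) = x ∧ |z| = ‖x‖ := by
  obtain ⟨y, rfl⟩ := QuotientAddGroup.mk_surjective x
  refine ⟨y - round y, ?_, (UnitAddCircle.norm_eq).symm⟩
  have hround : ((round y : ℝ) : UnitAddCircle) = 0 := by
    rw [← zsmul_one (round y), AddCircle.coe_zsmul, AddCircle.coe_period, smul_zero]
  rw [AddCircle.coe_sub, hround, sub_zero]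

theorem half_le_re_fourier {n : ℤ} {x : UnitAddCircle} (h : |(n : ℝ)| * ‖x‖ ≤ 1 / 6) :
    1 / 2 ≤ (fourier n x).re := by
  obtain ⟨z, rfl, hz⟩ := exists_coe_eq_and_abs_eq_norm x
  have hexp : (2 * Real.pi * Complex.I * n * z / (1 : ℝ) : ℂ) =
      ((2 * Real.pi * (n * z) : ℝ) : ℂ) * Complex.I := by
    push_cast
    ring
  have hangle : |2 * Real.pi * (n * z)| ≤ Real.pi / 3 := by
    rw [abs_mul, abs_of_pos Real.two_pi_pos, abs_mul, hz]
    linarith [mul_le_mul_of_nonneg_left h Real.two_pi_pos.le]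
  rw [fourier_coe_apply, hexp, Complex.exp_ofReal_mul_I_re, ← Real.cos_abs,
    ← Real.cos_pi_div_three]
  exact Real.cos_le_cos_of_nonneg_of_le_pi (abs_nonneg _) (by linarith [Real.pi_pos]) hangle

theorem sq_div_four_le_norm_sum_fourier_sq {M : ℕ} {x : UnitAddCircle} (hx : M * ‖x‖ ≤ 1 / 6) :
    (M : ℝ) ^ 2 / 4 ≤ ‖∑ n ∈ Finset.range M, fourier (n : ℤ) x‖ ^ 2 := by
  have hre : ∀ n ∈ Finset.range M, (1 / 2 : ℝ) ≤ (fourier (n : ℤ) x).re := fun n hn ↦ by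
    have hnM : (n : ℝ) ≤ M := by exact_mod_cast (Finset.mem_range.mp hn).le
    refine half_le_re_fourier (le_trans ?_ hx)
    rw [Int.cast_natCast, Nat.abs_cast]
    gcongr
  have hsum : (M : ℝ) / 2 ≤ (∑ n ∈ Finset.range M, fourier (n : ℤ) x).re := by
    rw [Complex.re_sum]
    simpa [div_eq_mul_inv] using Finset.card_nsmul_le_sum _ _ _ hre
  calc (M : ℝ) ^ 2 / 4 = (M / 2) ^ 2 := by ring
    _ ≤ _ := pow_le_pow_left₀ (by positivity) (hsum.trans (Complex.re_le_norm _)) 2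

theorem measureFourierCoeff_neg (ν : Measure UnitAddCircle) (k : ℤ) :
    measureFourierCoeff ν (-k) = starRingEnd ℂ (measureFourierCoeff ν k) := by
  unfold measureFourierCoeff
  rw [← integral_conj]
  simp only [← fourier_neg]

variable {ν : Measure UnitAddCircle} {s C ε : ℝ} {M : ℕ}

theorem norm_measureFourierCoeff_sq_le {k : ℤ}
    (hC : ‖measureFourierCoeff ν k‖ * |(k : ℝ)| ^ (s / 2) ≤ C) (hs1 : s ≤ 1) (hε : 0 ≤ ε)
    (hk : k ≠ 0) (hkM : |(k : ℝ)| ≤ M) :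
    ‖measureFourierCoeff ν k‖ ^ 2 ≤ C ^ 2 * (M : ℝ) ^ (1 + ε - s) * |(k : ℝ)| ^ (-(1 + ε)) := by
  have hk0 : 0 < |(k : ℝ)| := abs_pos.mpr (by exact_mod_cast hk)
  have hdecay : ‖measureFourierCoeff ν k‖ ≤ C * |(k : ℝ)| ^ (-(s / 2)) := by
    rwa [Real.rpow_neg hk0.le, ← div_eq_mul_inv, le_div_iff₀ (by positivity)]
  have hsq : (|(k : ℝ)| ^ (-(s / 2))) ^ 2 = |(k : ℝ)| ^ (1 + ε - s) * |(k : ℝ)| ^ (-(1 + ε)) := by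
    rw [← Real.rpow_mul_natCast hk0.le, ← Real.rpow_add hk0]
    congr 1
    push_cast
    ring
  calc _ ≤ (C * |(k : ℝ)| ^ (-(s / 2))) ^ 2 := by gcongr
    _ = C ^ 2 * |(k : ℝ)| ^ (1 + ε - s) * |(k : ℝ)| ^ (-(1 + ε)) := by
      rw [mul_pow, hsq, mul_assoc]
    _ ≤ _ := by
      gcongr
      linarith

variable [IsProbabilityMeasure ν]

theorem norm_measureFourierCoeff_le_one (ν : Measure UnitAddCircle) [IsProbabilityMeasure ν]
    (k : ℤ) : ‖measureFourierCoeff ν k‖ ≤ 1 := by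
  refine (norm_integral_le_of_norm_le_const (C := 1)
    (.of_forall fun x ↦ (norm_fourier_apply (-k) x).le)).trans_eq ?_
  rw [probReal_univ, one_mul]

theorem norm_sum_fourier_sub_sq (M : ℕ) (x y : UnitAddCircle) :
    ((‖∑ n ∈ Finset.range M, fourier (n : ℤ) (x - y)‖ ^ 2 : ℝ) : ℂ) =
      ∑ n ∈ Finset.range M, ∑ m ∈ Finset.range M,
        fourier (-((m : ℤ) - n)) x * fourier (-((n : ℤ) - m)) y := by
  rw [← Complex.normSq_eq_norm_sq, ← Complex.mul_conj, map_sum, Finset.sum_mul_sum]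
  refine Finset.sum_congr rfl fun n _ ↦ Finset.sum_congr rfl fun m _ ↦ ?_
  rw [← fourier_neg, ← fourier_add, sub_eq_add_neg x, fourier_apply_add, neg_sub, neg_sub,
    ← sub_eq_add_neg]
  congr 1
  simp only [fourier_apply]
  rw [smul_neg, ← neg_smul, neg_sub]

theorem integral_norm_sum_fourier_sub_sq (ν : Measure UnitAddCircle) [IsProbabilityMeasure ν]
    (M : ℕ) :
    ∫ p : UnitAddCircle × UnitAddCircle,
      ‖∑ n ∈ Finset.range M, fourier (n : ℤ) (p.1 - p.2)‖ ^ 2 ∂(ν.prod ν) =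
    ∑ n ∈ Finset.range M, ∑ m ∈ Finset.range M, ‖measureFourierCoeff ν ((n : ℤ) - m)‖ ^ 2 := by
  have hint (n m : ℕ) : Integrable (fun p : UnitAddCircle × UnitAddCircle ↦
      fourier (-((m : ℤ) - n)) p.1 * fourier (-((n : ℤ) - m)) p.2) (ν.prod ν) := by
    refine Continuous.integrable_of_hasCompactSupport ?_ (.of_compactSpace _)
    exact ((map_continuous (fourier _)).comp continuous_fst).mul
      ((map_continuous (fourier _)).comp continuous_snd)
  rw [← Complex.ofReal_inj, ← integral_complex_ofReal]
  simp only [norm_sum_fourier_sub_sq]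
  rw [integral_finsetSum _ fun n _ ↦ integrable_finsetSum _ fun m _ ↦ hint n m]
  push_cast
  refine Finset.sum_congr rfl fun n _ ↦ ?_
  rw [integral_finsetSum _ fun m _ ↦ hint n m]
  refine Finset.sum_congr rfl fun m _ ↦ ?_
  rw [integral_prod_mul (fun x ↦ fourier (-((m : ℤ) - n)) x) fun x ↦ fourier (-((n : ℤ) - m)) x,
    ← Complex.conj_mul', ← measureFourierCoeff_neg]
  simp only [measureFourierCoeff, neg_sub]

theorem sum_norm_measureFourierCoeff_sq_le
    (hC : ∀ ξ : ℤ, ‖measureFourierCoeff ν ξ‖ * |(ξ : ℝ)| ^ (s / 2) ≤ C) (hs1 : s ≤ 1)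
    (hε : 0 < ε) {n : ℕ} (hn : n < M) :
    ∑ m ∈ Finset.range M, ‖measureFourierCoeff ν ((n : ℤ) - m)‖ ^ 2 ≤
      (1 + C ^ 2 * ∑' k : ℤ, |(k : ℝ)| ^ (-(1 + ε))) * (M : ℝ) ^ (1 + ε - s) := by
  have hsum := Real.summable_abs_int_rpow (b := 1 + ε) (by linarith)
  have hM : 1 ≤ (M : ℝ) ^ (1 + ε - s) :=
    Real.one_le_rpow (by exact_mod_cast Nat.one_le_of_lt hn) (by linarith)
  set B := C ^ 2 * (M : ℝ) ^ (1 + ε - s) with hB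
  have hterm : ∀ m ∈ Finset.range M, ‖measureFourierCoeff ν ((n : ℤ) - m)‖ ^ 2 ≤
      (if m = n then 1 else 0) + B * |(((n : ℤ) - m : ℤ) : ℝ)| ^ (-(1 + ε)) := by
    intro m hm
    have hmM := Finset.mem_range.mp hm
    split_ifs with hmn
    · have hle := pow_le_one₀ (n := 2) (norm_nonneg _)
        (norm_measureFourierCoeff_le_one ν ((n : ℤ) - m))
      exact hle.trans (le_add_of_nonneg_right (by positivity))
    · have hle : |(n : ℤ) - m| ≤ M := abs_le.mpr ⟨by lia, by lia⟩
      rw [zero_add]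
      exact norm_measureFourierCoeff_sq_le (hC _) hs1 hε.le (by lia) (by exact_mod_cast hle)
  have htail : ∑ m ∈ Finset.range M, |(((n : ℤ) - m : ℤ) : ℝ)| ^ (-(1 + ε)) ≤
      ∑' k : ℤ, |(k : ℝ)| ^ (-(1 + ε)) := by
    have hinj : Function.Injective fun m : ℕ ↦ (n : ℤ) - m := fun a b hab ↦ by simpa using hab
    have := hsum.sum_le_tsum ((Finset.range M).map ⟨_, hinj⟩) fun k _ ↦ by positivity
    rwa [Finset.sum_map] at this
  calc _ ≤ 1 + B * ∑ m ∈ Finset.range M, |(((n : ℤ) - m : ℤ) : ℝ)| ^ (-(1 + ε)) := by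
        refine (Finset.sum_le_sum hterm).trans_eq ?_
        rw [Finset.sum_add_distrib, Finset.sum_ite_eq', if_pos (Finset.mem_range.mpr hn),
          ← Finset.mul_sum]
    _ ≤ (M : ℝ) ^ (1 + ε - s) + B * ∑' k : ℤ, |(k : ℝ)| ^ (-(1 + ε)) := by gcongr
    _ = _ := by rw [hB]; ring

theorem sq_div_four_mul_measureReal_dist_le (ν : Measure UnitAddCircle) [IsProbabilityMeasure ν]
    (hM : 0 < M) :
    (M : ℝ) ^ 2 / 4 * (ν.prod ν).real {p | dist p.1 p.2 ≤ 1 / (8 * M)} ≤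
      ∫ p : UnitAddCircle × UnitAddCircle,
        ‖∑ n ∈ Finset.range M, fourier (n : ℤ) (p.1 - p.2)‖ ^ 2 ∂(ν.prod ν) := by
  have hcont : Continuous fun p : UnitAddCircle × UnitAddCircle ↦
      ‖∑ n ∈ Finset.range M, fourier (n : ℤ) (p.1 - p.2)‖ ^ 2 := by
    refine (continuous_finsetSum _ fun n _ ↦ ?_).norm.pow 2
    exact (map_continuous (fourier _)).comp (by fun_prop)
  refine le_trans ?_ (mul_meas_ge_le_integral_of_nonneg (Eventually.of_forall fun p ↦ by positivity)
    (hcont.integrable_of_hasCompactSupport (.of_compactSpace _)) ((M : ℝ) ^ 2 / 4))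
  refine mul_le_mul_of_nonneg_left (measureReal_mono fun p hp ↦ ?_) (by positivity)
  refine sq_div_four_le_norm_sum_fourier_sq ?_
  rw [mem_ofPred_eq, dist_eq_norm, le_div_iff₀ (by positivity)] at hp
  linarith

theorem exists_prod_measureReal_dist_le_rpow (hs1 : s ≤ 1)
    (hC : ∀ ξ : ℤ, ‖measureFourierCoeff ν ξ‖ * |(ξ : ℝ)| ^ (s / 2) ≤ C) (hε : 0 < ε) :
    ∃ A : ℝ, ∀ M : ℕ, 0 < M →
      (ν.prod ν).real {p | dist p.1 p.2 ≤ 1 / (8 * M)} ≤ A * (M : ℝ) ^ (ε - s) := by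
  set Z := ∑' k : ℤ, |(k : ℝ)| ^ (-(1 + ε))
  refine ⟨4 * (1 + C ^ 2 * Z), fun M hM ↦ ?_⟩
  have hM0 : (0 : ℝ) < M := by exact_mod_cast hM
  have henergy : (M : ℝ) ^ 2 / 4 * (ν.prod ν).real {p | dist p.1 p.2 ≤ 1 / (8 * M)} ≤
      M * ((1 + C ^ 2 * Z) * (M : ℝ) ^ (1 + ε - s)) := by
    refine (sq_div_four_mul_measureReal_dist_le ν hM).trans ?_
    rw [integral_norm_sum_fourier_sub_sq]
    refine (Finset.sum_le_card_nsmul _ _ _ fun n hn ↦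
      sum_norm_measureFourierCoeff_sq_le hC hs1 hε (Finset.mem_range.mp hn)).trans_eq ?_
    rw [Finset.card_range, nsmul_eq_mul]
  refine le_of_mul_le_mul_left (henergy.trans_eq ?_) (show 0 < (M : ℝ) ^ 2 / 4 by positivity)
  rw [add_sub_assoc, Real.rpow_add hM0, Real.rpow_one]
  ring

end Energy

section RieszEnergy

open Filter Topology NNReal

variable {X : Type*} [EMetricSpace X] [MeasurableSpace X] [BorelSpace X] {ν : Measure X}
  {S A : Set X} {B : ℝ≥0∞} {t : ℝ≥0}

theorem measure_closedEBall_le_of_lintegral_edist_rpow_neg_le {x : X}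
    (h : ∫⁻ y, edist x y ^ (-t : ℝ) ∂ν ≤ B) {r : ℝ≥0∞} (hr0 : 0 < r) (hr : r ≠ ⊤) :
    ν (Metric.closedEBall x r) ≤ B * r ^ (t : ℝ) := by
  have hsub : Metric.closedEBall x r ⊆ {y | r ^ (-t : ℝ) ≤ edist x y ^ (-t : ℝ)} := fun y hy ↦ by
    rw [Metric.mem_closedEBall'] at hy
    rw [mem_ofPred_eq, ENNReal.rpow_neg, ENNReal.rpow_neg]
    gcongr
  calc _ ≤ (∫⁻ y, edist x y ^ (-t : ℝ) ∂ν) / r ^ (-t : ℝ) := by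
        refine (measure_mono hsub).trans (meas_ge_le_lintegral_div (by fun_prop) ?_ ?_)
        · simp [ENNReal.rpow_eq_zero_iff, hr0.ne', hr]
        · simp [ENNReal.rpow_eq_top_iff, hr0.ne', hr]
    _ ≤ B * r ^ (t : ℝ) := by
      rw [div_eq_mul_inv, ← ENNReal.rpow_neg, neg_neg]
      gcongr

theorem inv_smul_restrict_le_hausdorffMeasure (hS : MeasurableSet S) (hB0 : B ≠ 0) (hB : B ≠ ⊤)
    (h : ∀ x ∈ S, ∀ r > 0, r ≠ ⊤ → ν (Metric.closedEBall x r) ≤ B * r ^ (t : ℝ)) :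
    B⁻¹ • ν.restrict S ≤ μH[(t : ℝ)] := by
  refine Measure.le_hausdorffMeasure _ _ 1 one_pos fun U hU ↦ ?_
  rw [Measure.smul_apply, smul_eq_mul, Measure.restrict_apply' hS, ENNReal.inv_mul_le_iff hB0 hB]
  rcases (U ∩ S).eq_empty_or_nonempty with he | ⟨x, hxU, hxS⟩
  · simp [he]
  have hball (r : ℝ≥0∞) (hr : Metric.ediam U < r) (hr' : r < ⊤) :
      ν (U ∩ S) ≤ B * r ^ (t : ℝ) := by
    have hsub : U ∩ S ⊆ Metric.closedEBall x r := fun y hy ↦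
      (Metric.edist_le_ediam_of_mem hy.1 hxU).trans hr.le
    exact (measure_mono hsub).trans (h x hxS r (zero_le.trans_lt hr) hr'.ne)
  have hlim : Tendsto (fun r : ℝ≥0∞ ↦ B * r ^ (t : ℝ)) (𝓝[>] Metric.ediam U)
      (𝓝 (B * Metric.ediam U ^ (t : ℝ))) :=
    (ENNReal.Tendsto.const_mul (ENNReal.continuous_rpow_const.tendsto _)
      (Or.inr hB)).mono_left nhdsWithin_le_nhds
  have : (𝓝[>] Metric.ediam U).NeBot :=
    nhdsGT_neBot_of_exists_gt ⟨⊤, hU.trans_lt ENNReal.one_lt_top⟩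
  refine ge_of_tendsto hlim ?_
  filter_upwards [Ioo_mem_nhdsGT (hU.trans_lt ENNReal.one_lt_top)] with r hr
    using hball r hr.1 hr.2

theorem le_dimH_of_lintegral_lintegral_edist_rpow_neg_ne_top [SecondCountableTopology X]
    [SFinite ν] (h : ∫⁻ x, ∫⁻ y, edist x y ^ (-t : ℝ) ∂ν ∂ν ≠ ⊤) (hA : ν A ≠ 0) :
    t ≤ dimH A := by
  set U : X → ℝ≥0∞ := fun x ↦ ∫⁻ y, edist x y ^ (-t : ℝ) ∂ν
  have hUm : Measurable U := by
    have : Measurable (Function.uncurry fun x y : X ↦ edist x y ^ (-t : ℝ)) :=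
      measurable_edist.pow_const _
    exact this.lintegral_prod_right'
  obtain ⟨n, hn⟩ : ∃ n : ℕ, ν (A ∩ {x | U x ≤ n + 1}) ≠ 0 := by
    by_contra! hnull
    refine hA (measure_mono_null_ae ?_ (measure_iUnion_null hnull))
    filter_upwards [ae_lt_top hUm h] with x hx hxA
    obtain ⟨n, hn⟩ := ENNReal.exists_nat_gt hx.ne
    exact mem_iUnion.mpr ⟨n, hxA, hn.le.trans le_self_add⟩
  have hle := inv_smul_restrict_le_hausdorffMeasure (ν := ν) (t := t) (B := n + 1)
    (measurableSet_le hUm measurable_const) (by simp) (by finiteness) fun x hx r hr0 hr ↦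
      measure_closedEBall_le_of_lintegral_edist_rpow_neg_le hx hr0 hr
  refine le_dimH_of_hausdorffMeasure_ne_zero ((lt_of_lt_of_le ?_ (hle A)).ne')
  rw [Measure.smul_apply, smul_eq_mul,
    Measure.restrict_apply' (measurableSet_le hUm measurable_const)]
  exact ENNReal.mul_pos (by simp) hn

theorem exists_nat_inv_mul_pow_le_and_le {x : ℝ} (hx0 : 0 < x) (hx : x ≤ 1 / 8) :
    ∃ k : ℕ, 1 / (16 * 2 ^ k) ≤ x ∧ x ≤ 1 / (8 * 2 ^ k) := by
  obtain ⟨k, hk, hk'⟩ := exists_nat_pow_near_of_lt_one (x := 8 * x) (y := (1 / 2 : ℝ))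
    (by positivity) (by linarith) (by norm_num) (by norm_num)
  rw [pow_succ, one_div_pow] at hk
  rw [one_div_pow] at hk'
  refine ⟨k, ?_, ?_⟩
  · rw [mul_comm, ← div_div]
    linarith
  · rw [mul_comm, ← div_div]
    linarith

theorem edist_rpow_neg_le_add_tsum {X : Type*} [PseudoMetricSpace X] (t : ℝ≥0) (x y : X) :
    edist x y ^ (-t : ℝ) ≤ 8 ^ (t : ℝ) + ∑' k : ℕ,
      {p : X × X | dist p.1 p.2 ≤ 1 / (8 * 2 ^ k)}.indicator
        (fun _ ↦ (16 * 2 ^ k : ℝ≥0∞) ^ (t : ℝ)) (x, y) := by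
  rw [ENNReal.rpow_neg, ← ENNReal.inv_rpow]
  rcases lt_or_ge (1 / 8) (dist x y) with hfar | hnear
  · refine le_add_of_le_of_nonneg ?_ zero_le
    gcongr
    rw [ENNReal.inv_le_iff_inv_le, edist_dist, ENNReal.le_ofReal_iff_toReal_le (by simp) (by simp)]
    simpa using hfar.le
  refine le_add_of_nonneg_of_le zero_le ?_
  rcases dist_nonneg.eq_or_lt (a := (0 : ℝ)) (b := dist x y) with h0 | hpos
  · have hmem (k : ℕ) : (x, y) ∈ {p : X × X | dist p.1 p.2 ≤ 1 / (8 * 2 ^ k)} := by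
      rw [mem_ofPred_eq, ← h0]
      positivity
    refine le_top.trans_eq (Eq.symm <| top_le_iff.mp ?_)
    rw [← ENNReal.tsum_const_eq_top_of_ne_zero (α := ℕ) one_ne_zero]
    refine ENNReal.tsum_le_tsum fun k ↦ ?_
    rw [indicator_of_mem (hmem k)]
    have hbase : (1 : ℝ≥0∞) ≤ 16 * 2 ^ k :=
      one_le_mul (by norm_num) (one_le_pow₀ one_le_two)
    exact (ENNReal.one_rpow _).ge.trans (ENNReal.rpow_le_rpow hbase t.coe_nonneg)
  · obtain ⟨k, hk, hk'⟩ := exists_nat_inv_mul_pow_le_and_le hpos hnear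
    refine le_trans ?_ (ENNReal.le_tsum k)
    rw [indicator_of_mem (by exact hk')]
    gcongr
    rw [ENNReal.inv_le_iff_inv_le, edist_dist, ENNReal.le_ofReal_iff_toReal_le (by simp) (by simp)]
    simpa using hk

end RieszEnergy

section FourierDimLeHausdorffDim

open NNReal

theorem lintegral_lintegral_edist_rpow_neg_le {X : Type*} [PseudoMetricSpace X]
    [SecondCountableTopology X] [MeasurableSpace X] [BorelSpace X] (ν : Measure X)
    [IsProbabilityMeasure ν] (t : ℝ≥0) :
    ∫⁻ x, ∫⁻ y, edist x y ^ (-t : ℝ) ∂ν ∂ν ≤ 8 ^ (t : ℝ) + ∑' k : ℕ, (16 * 2 ^ k) ^ (t : ℝ) *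
      (ν.prod ν) {p : X × X | dist p.1 p.2 ≤ 1 / (8 * 2 ^ k)} := by
  have hD (k : ℕ) : MeasurableSet {p : X × X | dist p.1 p.2 ≤ 1 / (8 * 2 ^ k)} :=
    measurableSet_le measurable_dist measurable_const
  calc ∫⁻ x, ∫⁻ y, edist x y ^ (-t : ℝ) ∂ν ∂ν
      = ∫⁻ p : X × X, edist p.1 p.2 ^ (-t : ℝ) ∂(ν.prod ν) :=
        (lintegral_prod _ (measurable_edist.pow_const _).aemeasurable).symm
    _ ≤ ∫⁻ p : X × X, (8 ^ (t : ℝ) + ∑' k : ℕ,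
          {p : X × X | dist p.1 p.2 ≤ 1 / (8 * 2 ^ k)}.indicator
            (fun _ ↦ (16 * 2 ^ k : ℝ≥0∞) ^ (t : ℝ)) p) ∂(ν.prod ν) :=
        lintegral_mono fun p ↦ edist_rpow_neg_le_add_tsum t p.1 p.2
    _ = _ := by
      rw [lintegral_add_left measurable_const, lintegral_const, measure_univ, mul_one,
        lintegral_tsum fun k ↦ (measurable_const.indicator (hD k)).aemeasurable]
      simp only [lintegral_indicator_const (hD _)]

theorem lintegral_lintegral_edist_rpow_neg_ne_top (ν : Measure UnitAddCircle)
    [IsProbabilityMeasure ν] {s : ℝ} (hs : s ∈ fourierDecayExponents ν) {t : ℝ≥0} (hts : t < s) :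
    ∫⁻ x, ∫⁻ y, edist x y ^ (-t : ℝ) ∂ν ∂ν ≠ ⊤ := by
  obtain ⟨⟨-, hs1⟩, C, hC⟩ := hs
  obtain ⟨A, hA⟩ := exists_prod_measureReal_dist_le_rpow hs1 hC
    (show 0 < (s - t) / 2 by linarith)
  set q : ℝ := 2 ^ (-((s - t) / 2)) with hq
  have hq0 : 0 ≤ q := by positivity
  have hq1 : q < 1 := Real.rpow_lt_one_of_one_lt_of_neg one_lt_two (by linarith)
  have hterm (k : ℕ) : (16 * 2 ^ k) ^ (t : ℝ) *
      (ν.prod ν) {p | dist p.1 p.2 ≤ 1 / (8 * 2 ^ k)} ≤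
        ENNReal.ofReal (16 ^ (t : ℝ) * A * q ^ k) := by
    have hscale := hA (2 ^ k) (by positivity)
    push_cast at hscale
    calc _ = ENNReal.ofReal ((16 * 2 ^ k) ^ (t : ℝ)) *
          ENNReal.ofReal ((ν.prod ν).real {p | dist p.1 p.2 ≤ 1 / (8 * 2 ^ k)}) := by
          rw [ofReal_measureReal, ← ENNReal.ofReal_rpow_of_pos (by positivity),
            ENNReal.ofReal_mul (by norm_num), ENNReal.ofReal_pow (by norm_num)]
          norm_num
      _ ≤ ENNReal.ofReal ((16 * 2 ^ k) ^ (t : ℝ) * (A * (2 ^ k) ^ ((s - t) / 2 - s))) := by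
        rw [← ENNReal.ofReal_mul (by positivity)]
        gcongr
      _ = _ := by
        have hpow : ((2 : ℝ) ^ k) ^ (t : ℝ) * (2 ^ k) ^ ((s - t) / 2 - s) = q ^ k := by
          rw [← Real.rpow_add (by positivity), ← Real.rpow_pow_comm zero_le_two, hq]
          ring_nf
        rw [Real.mul_rpow (by norm_num) (by positivity), ← hpow]
        ring_nf
  refine ne_top_of_le_ne_top ?_ (lintegral_lintegral_edist_rpow_neg_le ν t)
  refine ENNReal.add_ne_top.mpr ⟨by finiteness, ne_top_of_le_ne_top ?_ (ENNReal.tsum_le_tsum hterm)⟩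
  exact ((summable_geometric_of_lt_one hq0 hq1).mul_left _).tsum_ofReal_ne_top

theorem le_dimH_of_mem_fourierDecayExponents (ν : Measure UnitAddCircle) [IsProbabilityMeasure ν]
    {s : ℝ} (hs : s ∈ fourierDecayExponents ν) {A : Set UnitAddCircle} (hA : ν.support ⊆ A) :
    ENNReal.ofReal s ≤ dimH A := by
  have hνA : ν A ≠ 0 := by
    have hsupp : ν ν.support = 1 := by
      rw [← prob_compl_eq_zero_iff Measure.isClosed_support.measurableSet]
      exact Measure.measure_compl_support
    exact (one_pos.trans_le (hsupp ▸ measure_mono hA)).ne'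
  refine ENNReal.le_of_forall_nnreal_lt fun t ht ↦ ?_
  rw [← ENNReal.ofReal_coe_nnreal] at ht
  have hts : (t : ℝ) < s := (ENNReal.ofReal_lt_ofReal_iff_of_nonneg t.coe_nonneg).mp ht
  exact le_dimH_of_lintegral_lintegral_edist_rpow_neg_ne_top
    (lintegral_lintegral_edist_rpow_neg_ne_top ν hs hts) hνA

theorem setFourierDim_le_dimH (A : Set UnitAddCircle) : setFourierDim A ≤ dimH A :=
  iSup₂_le fun μ hμ ↦ iSup₂_le fun _ hs ↦ le_dimH_of_mem_fourierDecayExponents μ hs hμ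

end FourierDimLeHausdorffDim

section WeakLimits

open AddCircle Filter Topology

/-- The measure with density `f` with respect to the Haar measure of the circle, normalized to have
mass `1`. -/
noncomputable def normalizedDensity (f : UnitAddCircle → ℝ) : Measure UnitAddCircle :=
  haarAddCircle.withDensity fun x ↦ ENNReal.ofReal (f x / ∫ y, f y ∂haarAddCircle)

variable {f : UnitAddCircle → ℝ}

theorem isProbabilityMeasure_normalizedDensity (hf : Continuous f) (hf0 : ∀ x, 0 ≤ f x)
    (hmass : 0 < ∫ x, f x ∂haarAddCircle) : IsProbabilityMeasure (normalizedDensity f) := by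
  constructor
  rw [normalizedDensity, withDensity_apply _ MeasurableSet.univ, Measure.restrict_univ,
    ← ofReal_integral_eq_lintegral_ofReal ((integrable_of_continuous hf).div_const _)
      (.of_forall fun x ↦ div_nonneg (hf0 x) hmass.le),
    integral_div, div_self hmass.ne', ENNReal.ofReal_one]

theorem measureFourierCoeff_normalizedDensity (hf : Continuous f) (hf0 : ∀ x, 0 ≤ f x) (ξ : ℤ) :
    measureFourierCoeff (normalizedDensity f) ξ =
      realFourierCoeff f ξ / ((∫ x, f x ∂haarAddCircle : ℝ) : ℂ) := by
  rw [measureFourierCoeff, normalizedDensity, integral_withDensity_eq_integral_toReal_smul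
    (by fun_prop) (.of_forall fun x ↦ ENNReal.ofReal_lt_top), realFourierCoeff, fourierCoeff,
    ← integral_div]
  refine integral_congr_ae (.of_forall fun x ↦ ?_)
  dsimp only
  rw [ENNReal.toReal_ofReal (div_nonneg (hf0 x) (integral_nonneg hf0)), smul_eq_mul,
    Complex.real_smul, Complex.ofReal_div]
  ring

theorem normalizedDensity_compl_eq_zero {S : Set UnitAddCircle} (hS : MeasurableSet S)
    (h : ∀ x, f x ≠ 0 → x ∈ S) : normalizedDensity f Sᶜ = 0 := by
  have hzero (x : UnitAddCircle) (hx : x ∈ Sᶜ) : f x = 0 := by_contra fun hne ↦ hx (h x hne)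
  rw [normalizedDensity, withDensity_apply _ hS.compl, setLIntegral_congr_fun (g := fun _ ↦ 0)
    hS.compl fun x hx ↦ by rw [hzero x hx, zero_div, ENNReal.ofReal_zero], lintegral_zero]

variable {ι : Type*} {l : Filter ι}

theorem tendsto_measureFourierCoeff {μ : ι → ProbabilityMeasure UnitAddCircle}
    {ν : ProbabilityMeasure UnitAddCircle} (h : Tendsto μ l (𝓝 ν)) (ξ : ℤ) :
    Tendsto (fun j ↦ measureFourierCoeff (μ j : Measure UnitAddCircle) ξ) l
      (𝓝 (measureFourierCoeff (ν : Measure UnitAddCircle) ξ)) :=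
  (ProbabilityMeasure.tendsto_iff_forall_integral_rclike_tendsto ℂ).mp h
    (BoundedContinuousFunction.mkOfCompact (fourier (-ξ)))

theorem support_subset_of_tendsto {X : Type*} [MeasurableSpace X] [TopologicalSpace X]
    [HereditarilyLindelofSpace X] [HasOuterApproxClosed X] [OpensMeasurableSpace X] [NeBot l]
    {μ : ι → ProbabilityMeasure X} {ν : ProbabilityMeasure X} (h : Tendsto μ l (𝓝 ν)) {S : Set X}
    (hS : IsClosed S) (hμ : ∀ᶠ j in l, (μ j : Measure X) Sᶜ = 0) :
    (ν : Measure X).support ⊆ S := by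
  refine Measure.support_subset_of_isClosed hS (mem_ae_iff.mpr (nonpos_iff_eq_zero.mp ?_))
  calc (ν : Measure X) Sᶜ ≤ liminf (fun j ↦ (μ j : Measure X) Sᶜ) l :=
        ProbabilityMeasure.le_liminf_measure_open_of_tendsto h hS.isOpen_compl
    _ = 0 := by rw [liminf_congr hμ, liminf_const]

theorem exists_limit_measure {f : ℕ → UnitAddCircle → ℝ} (hf : ∀ j, Continuous (f j))
    (hf0 : ∀ j x, 0 ≤ f j x) {m : ℝ} (hm : 0 < m) (hmass : ∀ j, m ≤ ∫ x, f j x ∂haarAddCircle) :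
    ∃ ν : ProbabilityMeasure UnitAddCircle,
      (∀ (ξ : ℤ) (B : ℝ), (∀ᶠ j in atTop, ‖realFourierCoeff (f j) ξ‖ ≤ B) →
        ‖measureFourierCoeff (ν : Measure UnitAddCircle) ξ‖ ≤ B / m) ∧
      ∀ S : Set UnitAddCircle, IsClosed S → (∀ᶠ j in atTop, ∀ x, f j x ≠ 0 → x ∈ S) →
        (ν : Measure UnitAddCircle).support ⊆ S := by
  set μ : ℕ → ProbabilityMeasure UnitAddCircle := fun j ↦ ⟨normalizedDensity (f j),
    isProbabilityMeasure_normalizedDensity (hf j) (hf0 j) (hm.trans_le (hmass j))⟩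
  set L : Ultrafilter ℕ := Ultrafilter.of atTop
  have hL : (L : Filter ℕ) ≤ atTop := Ultrafilter.of_le _
  obtain ⟨ν, -, hν⟩ := isCompact_univ.ultrafilter_le_nhds (L.map μ) (by simp)
  have hlim : Tendsto μ L (𝓝 ν) := hν
  refine ⟨ν, fun ξ B hB ↦ le_of_tendsto (tendsto_measureFourierCoeff hlim ξ).norm ?_,
    fun S hS h ↦ support_subset_of_tendsto hlim hS ?_⟩
  · filter_upwards [hL hB] with j hj
    have hcoeff : measureFourierCoeff (μ j : Measure UnitAddCircle) ξ =
        realFourierCoeff (f j) ξ / ((∫ x, f j x ∂haarAddCircle : ℝ) : ℂ) :=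
      measureFourierCoeff_normalizedDensity (hf j) (hf0 j) ξ
    rw [hcoeff, norm_div, Complex.norm_of_nonneg (integral_nonneg (hf0 j))]
    exact div_le_div₀ ((norm_nonneg _).trans hj) hj hm (hmass j)
  · filter_upwards [hL h] with j hj using normalizedDensity_compl_eq_zero hS.measurableSet hj

end WeakLimits

section HausdorffUpperBound

open Filter Topology

variable {X : Type*}

theorem ediam_closedBall_le [PseudoMetricSpace X] (y : X) {r : ℝ} (hr : 0 ≤ r) :
    Metric.ediam (Metric.closedBall y r) ≤ ENNReal.ofReal (2 * r) := by
  rw [← Metric.closedEBall_ofReal hr, ENNReal.ofReal_mul zero_le_two, ENNReal.ofReal_ofNat]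
  exact Metric.ediam_closedEBall_le

theorem sum_ediam_closedBall_rpow_le [PseudoMetricSpace X] {P : Finset X} {r p q : ℝ} (hr : 0 < r)
    (hr1 : r ≤ 1) (hq : 0 ≤ q) (hpq : p ≤ q) (hP : P.card * r ^ p ≤ 1) :
    ∑ y : P, Metric.ediam (Metric.closedBall (y : X) r) ^ q ≤ ENNReal.ofReal (2 ^ q) := by
  have hcard : P.card * r ^ q ≤ 1 := by
    refine le_trans ?_ hP
    gcongr ?_ * ?_
    exact Real.rpow_le_rpow_of_exponent_ge hr hr1 hpq
  calc ∑ y : P, Metric.ediam (Metric.closedBall (y : X) r) ^ q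
      ≤ ∑ _y : P, ENNReal.ofReal ((2 * r) ^ q) := by
        refine Finset.sum_le_sum fun y _ ↦ ?_
        rw [← ENNReal.ofReal_rpow_of_pos (by positivity)]
        gcongr
        exact ediam_closedBall_le _ hr.le
    _ = ENNReal.ofReal (2 ^ q * (P.card * r ^ q)) := by
        rw [Finset.sum_const, Finset.card_univ, Fintype.card_coe, nsmul_eq_mul,
          ← ENNReal.ofReal_natCast, ← ENNReal.ofReal_mul (by positivity),
          Real.mul_rpow zero_le_two hr.le, mul_left_comm]
    _ ≤ ENNReal.ofReal (2 ^ q) := by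
        gcongr
        exact mul_le_of_le_one_right (by positivity) hcard

theorem dimH_le_of_covers [MetricSpace X] {S : Set X} {d : ℝ} (hd : 0 ≤ d) {P : ℕ → Finset X}
    {r p : ℕ → ℝ} (hr : ∀ k, 0 < r k) (hr0 : Tendsto r atTop (𝓝 0)) (hp : Tendsto p atTop (𝓝 d))
    (hP : ∀ k, (P k).card * r k ^ p k ≤ 1)
    (hS : ∀ k, S ⊆ ⋃ y ∈ P k, Metric.closedBall y (r k)) : dimH S ≤ ENNReal.ofReal d := by
  borelize X
  suffices hexp : ∀ q, d < q → dimH S ≤ ENNReal.ofReal q by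
    have hlim : Tendsto ENNReal.ofReal (𝓝[>] d) (𝓝 (ENNReal.ofReal d)) :=
      (ENNReal.continuous_ofReal.tendsto d).mono_left nhdsWithin_le_nhds
    exact ge_of_tendsto hlim (eventually_mem_nhdsWithin.mono hexp)
  intro q hq
  have hq0 : 0 ≤ q := hd.trans hq.le
  refine dimH_le_of_hausdorffMeasure_ne_top (d := q.toNNReal) ?_
  rw [Real.coe_toNNReal _ hq0]
  have hdiam : Tendsto (fun k ↦ ENNReal.ofReal (2 * r k)) atTop (𝓝 0) := by
    simpa using ENNReal.tendsto_ofReal (hr0.const_mul 2)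
  refine ne_top_of_le_ne_top (ENNReal.ofReal_ne_top (r := 2 ^ q)) ?_
  calc μH[q] S ≤ liminf (fun k ↦ ∑ y : P k, Metric.ediam (Metric.closedBall (y : X) (r k)) ^ q)
        atTop := Measure.hausdorffMeasure_le_liminf_sum q S _ hdiam _
          (.of_forall fun k y ↦ ediam_closedBall_le _ (hr k).le)
          (.of_forall fun k ↦ (hS k).trans_eq (biUnion_eq_iUnion _ _))
    _ ≤ liminf (fun _ : ℕ ↦ ENNReal.ofReal (2 ^ q)) atTop := by
        refine liminf_le_liminf ?_
        filter_upwards [hp.eventually_lt_const hq, hr0.eventually_lt_const one_pos] with k hk hk1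
        exact sum_ediam_closedBall_rpow_le (hr k) hk1.le hq0 hk.le (hP k)
    _ = ENNReal.ofReal (2 ^ q) := liminf_const _

end HausdorffUpperBound

section RationalTriples

open Filter Topology Metric

theorem exists_rat_isSeparatedTriple {I : Set ℝ} {t : Fin 3 → ℝ} (ht : ∀ i, t i ∈ interior I)
    (hinj : Function.Injective t) :
    ∃ (a : Fin 3 → ℚ) (ρ : ℚ), IsSeparatedTriple I (fun i ↦ (a i : ℝ)) ρ ∧
      ∀ i, |t i - a i| ≤ ρ / 2 := by
  have hball : ∀ᶠ ε in 𝓝[>] (0 : ℝ), ∀ i, closedBall (t i) ε ⊆ I :=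
    eventually_all.mpr fun i ↦ nhdsWithin_le_nhds <|
      eventually_closedBall_subset (mem_interior_iff_mem_nhds.mp (ht i))
  have hsep : ∀ᶠ ε in 𝓝[>] (0 : ℝ), ∀ i j, i ≠ j → ε < |t i - t j| := by
    simp only [eventually_all]
    exact fun i j hij ↦ nhdsWithin_le_nhds <|
      eventually_lt_nhds (abs_pos.mpr (sub_ne_zero.mpr (hinj.ne hij)))
  obtain ⟨ε, hεI, hεt, hε⟩ := (hball.and (hsep.and eventually_mem_nhdsWithin)).exists
  obtain ⟨ρ, hρ0, hρ⟩ := exists_rat_btwn (show (0 : ℝ) < ε / 4 from div_pos hε four_pos)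
  choose a ha using fun i ↦ exists_rat_near (t i) (show (0 : ℝ) < ρ / 2 by linarith)
  refine ⟨a, ρ, ⟨hρ0, fun i x hx ↦ hεI i ?_, fun i j hij ↦ ?_⟩, fun i ↦ (ha i).le⟩
  · rw [← Real.closedBall_eq_Icc, mem_closedBall, Real.dist_eq] at hx
    rw [mem_closedBall, Real.dist_eq]
    linarith [abs_sub_le x (a i) (t i), ha i, abs_sub_comm (t i) (a i)]
  · linarith [hεt i j hij, ha i, ha j, abs_sub_le (t i) (a i) (t j),
      abs_sub_le (a i : ℝ) (a j) (t j), abs_sub_comm (t j) (a j)]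

end RationalTriples

section Refinements

open AddCircle Filter Topology

/-- `g` refines the density `f` up to the error `δ`: the Fourier coefficients change by at most
`δ (1 + |ξ|) ^ (-s)`, and the support shrinks to balls of radius `r ≤ δ` around finitely many points
`P` with `|P| r ^ p ≤ δ`. -/
structure IsRefinement (f g : UnitAddCircle → ℝ) (r : ℝ) (P : Finset UnitAddCircle) (δ s p : ℝ) :
    Prop extends IsDecayingDensity g where
  norm_coeff_sub_le : ∀ ξ : ℤ,
    ‖realFourierCoeff g ξ - realFourierCoeff f ξ‖ ≤ δ * (1 + |(ξ : ℝ)|) ^ (-s)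
  radius_pos : 0 < r
  radius_le : r ≤ δ
  card_mul_rpow_le : P.card * r ^ p ≤ δ
  ne_zero : ∀ x, g x ≠ 0 → f x ≠ 0
  exists_dist_le : ∀ x, g x ≠ 0 → ∃ y ∈ P, dist x y ≤ r

theorem RegularDistances.exists_refinement {V : Type*} [NormedAddCommGroup V] {γ : ℝ → V}
    {I : Set ℝ} {c K θ : ℝ} (h : RegularDistances γ I c K) (hθ : 0 < θ)
    (hI : I ⊆ Icc θ (1 - θ)) {a : Fin 3 → ℝ} {ρ : ℝ} (ha : IsSeparatedTriple I a ρ) {s p δ : ℝ}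
    (hs0 : 0 ≤ s) (hs : s < 2 / 9) (hp : 4 / 9 < p) (hδ : 0 < δ) {f : UnitAddCircle → ℝ}
    (hf : IsDecayingDensity f) :
    ∃ g r P, IsRefinement f g r P δ s p ∧ AvoidsIsoscelesNear γ a (ρ / 2) r P := by
  obtain ⟨A, hA, hAf⟩ := hf.decay.exists_norm_mul_sub_le hf.continuous
  have hδ' : 0 < min δ (δ / A) := lt_min hδ (div_pos hδ hA)
  obtain ⟨F, r, P, hF, havoid⟩ := h.exists_multiplier hθ hI ha hs0 hs hp hδ'
  refine ⟨fun x ↦ f x * F x, r, P,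
    { toIsDecayingDensity := hf.mul hF.toIsDecayingDensity
      norm_coeff_sub_le := fun ξ ↦ ?_
      radius_pos := hF.radius_pos
      radius_le := hF.radius_le.trans (min_le_left _ _)
      card_mul_rpow_le := hF.card_mul_rpow_le.trans (min_le_left _ _)
      ne_zero := fun x ↦ left_ne_zero_of_mul
      exists_dist_le := fun x hx ↦ hF.exists_dist_le x (right_ne_zero_of_mul hx) }, havoid⟩
  refine (hAf F _ s hF.continuous hF.decay.summable hF.coeff_zero hs0 (by linarith) hδ'.le
    hF.norm_coeff_le ξ).trans ?_
  gcongr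
  exact (le_div_iff₀' hA).mp (min_le_right _ _)

/-- A sequence of successive refinements, with errors `2 ^ (-k - 2)` and increasing exponents `s`,
which starts from a density of mass `1`. -/
structure IsRefiningSequence (f : ℕ → UnitAddCircle → ℝ) (r : ℕ → ℝ) (P : ℕ → Finset UnitAddCircle)
    (s p : ℕ → ℝ) : Prop where
  zero : IsDecayingDensity (f 0)
  integral_zero : ∫ x, f 0 x ∂haarAddCircle = 1
  monotone : Monotone s
  step : ∀ k, IsRefinement (f k) (f (k + 1)) (r k) (P k) ((1 / 2) ^ (k + 2)) (s k) (p k)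

theorem RegularDistances.exists_isRefiningSequence {V : Type*} [NormedAddCommGroup V] {γ : ℝ → V}
    {I : Set ℝ} {c K θ : ℝ} (h : RegularDistances γ I c K) (hθ : 0 < θ)
    (hI : I ⊆ Icc θ (1 - θ)) {a : ℕ → Fin 3 → ℝ} {ρ : ℕ → ℝ}
    (ha : ∀ k, IsSeparatedTriple I (a k) (ρ k)) {s p : ℕ → ℝ} (hs0 : ∀ k, 0 ≤ s k)
    (hs : ∀ k, s k < 2 / 9) (hsm : Monotone s) (hp : ∀ k, 4 / 9 < p k) {f₀ : UnitAddCircle → ℝ}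
    (hf₀ : IsDecayingDensity f₀) (hint : ∫ x, f₀ x ∂haarAddCircle = 1) :
    ∃ f r P, f 0 = f₀ ∧ IsRefiningSequence f r P s p ∧
      ∀ k, AvoidsIsoscelesNear γ (a k) (ρ k / 2) (r k) (P k) := by
  choose g r P hg havoid using fun (k : ℕ) (f : {f // IsDecayingDensity f}) ↦
    h.exists_refinement hθ hI (ha k) (hs0 k) (hs k) (hp k) (δ := (1 / 2) ^ (k + 2)) (by positivity)
      f.2
  let f : ℕ → {f // IsDecayingDensity f} := fun k ↦
    Nat.rec ⟨f₀, hf₀⟩ (fun k f ↦ ⟨g k f, (hg k f).toIsDecayingDensity⟩) k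
  exact ⟨fun k ↦ (f k).1, fun k ↦ r k (f k), fun k ↦ P k (f k), rfl,
    ⟨hf₀, hint, hsm, fun k ↦ hg k (f k)⟩, fun k ↦ havoid k (f k)⟩

theorem sum_Ico_half_pow_add_two_le (k j : ℕ) :
    ∑ i ∈ Finset.Ico k j, (1 / 2 : ℝ) ^ (i + 2) ≤ 1 / 2 := by
  calc ∑ i ∈ Finset.Ico k j, (1 / 2 : ℝ) ^ (i + 2)
      ≤ ∑ i ∈ Finset.range j, (1 / 2 : ℝ) ^ (i + 2) := by
        rw [Finset.range_eq_Ico]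
        gcongr
        exact k.zero_le
    _ = (∑ i ∈ Finset.range j, (1 / 2 : ℝ) ^ i) * (1 / 2) ^ 2 := by
        simp only [pow_add, Finset.sum_mul]
    _ ≤ 2 * (1 / 2) ^ 2 := by
        gcongr
        exact sum_geometric_two_le j
    _ = 1 / 2 := by norm_num

namespace IsRefiningSequence

variable {f : ℕ → UnitAddCircle → ℝ} {r s p : ℕ → ℝ} {P : ℕ → Finset UnitAddCircle}

theorem isDecayingDensity (h : IsRefiningSequence f r P s p) : ∀ k, IsDecayingDensity (f k)
  | 0 => h.zero
  | k + 1 => (h.step k).toIsDecayingDensity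

theorem ne_zero_of_le (h : IsRefiningSequence f r P s p) {k j : ℕ} (hkj : k ≤ j)
    {x : UnitAddCircle} (hx : f j x ≠ 0) : f k x ≠ 0 := by
  induction j, hkj using Nat.le_induction with
  | base => exact hx
  | succ j _ ih => exact ih ((h.step j).ne_zero x hx)

theorem norm_realFourierCoeff_sub_le (h : IsRefiningSequence f r P s p) {k j : ℕ} (hkj : k ≤ j)
    (ξ : ℤ) : ‖realFourierCoeff (f j) ξ - realFourierCoeff (f k) ξ‖ ≤
      1 / 2 * (1 + |(ξ : ℝ)|) ^ (-s k) := by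
  rw [← dist_eq_norm, dist_comm]
  refine (dist_le_Ico_sum_of_dist_le (f := fun i ↦ realFourierCoeff (f i) ξ)
    (d := fun i ↦ (1 / 2) ^ (i + 2) * (1 + |(ξ : ℝ)|) ^ (-s k)) hkj fun {i} hki _ ↦ ?_).trans ?_
  · rw [dist_comm, dist_eq_norm]
    refine ((h.step i).norm_coeff_sub_le ξ).trans ?_
    gcongr
    · linarith [abs_nonneg (ξ : ℝ)]
    · exact h.monotone hki
  · rw [← Finset.sum_mul]
    gcongr
    exact sum_Ico_half_pow_add_two_le k j

theorem half_le_integral (h : IsRefiningSequence f r P s p) (j : ℕ) :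
    1 / 2 ≤ ∫ x, f j x ∂haarAddCircle := by
  have hdiff := h.norm_realFourierCoeff_sub_le j.zero_le 0
  rw [realFourierCoeff_zero, realFourierCoeff_zero, h.integral_zero, ← Complex.ofReal_sub,
    Complex.norm_real, Int.cast_zero, abs_zero, add_zero, Real.one_rpow, mul_one] at hdiff
  linarith [neg_le_of_abs_le hdiff]

theorem exists_norm_realFourierCoeff_le (h : IsRefiningSequence f r P s p) {k : ℕ}
    (hs : s k ≤ 2) : ∃ C, ∀ j ≥ k, ∀ ξ : ℤ,
      ‖realFourierCoeff (f j) ξ‖ ≤ C * (1 + |(ξ : ℝ)|) ^ (-s k) := by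
  obtain ⟨C, hC0, hC⟩ := (h.isDecayingDensity k).decay.exists_nonneg
  refine ⟨C + 1 / 2, fun j hj ξ ↦ ?_⟩
  have hdecay : 1 / (1 + |(ξ : ℝ)|) ^ 2 ≤ (1 + |(ξ : ℝ)|) ^ (-s k) := by
    rw [one_div, ← Real.rpow_natCast, ← Real.rpow_neg (by positivity)]
    gcongr
    · linarith [abs_nonneg (ξ : ℝ)]
    · exact_mod_cast hs
  calc ‖realFourierCoeff (f j) ξ‖
      ≤ ‖realFourierCoeff (f k) ξ‖ + ‖realFourierCoeff (f j) ξ - realFourierCoeff (f k) ξ‖ :=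
        norm_le_norm_add_norm_sub' _ _
    _ ≤ C * (1 + |(ξ : ℝ)|) ^ (-s k) + 1 / 2 * (1 + |(ξ : ℝ)|) ^ (-s k) := by
        gcongr
        · exact (hC ξ).trans (by gcongr)
        · exact h.norm_realFourierCoeff_sub_le hj ξ
    _ = (C + 1 / 2) * (1 + |(ξ : ℝ)|) ^ (-s k) := (add_mul _ _ _).symm

theorem exists_measure (h : IsRefiningSequence f r P s p) (hs : ∀ k, s k ≤ 2) :
    ∃ ν : ProbabilityMeasure UnitAddCircle,
      (∀ k, ∃ C, ∀ ξ : ℤ,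
        ‖measureFourierCoeff (ν : Measure UnitAddCircle) ξ‖ ≤ C * (1 + |(ξ : ℝ)|) ^ (-s k)) ∧
      (∀ k, (ν : Measure UnitAddCircle).support ⊆ ⋃ y ∈ P k, Metric.closedBall y (r k)) ∧
      (ν : Measure UnitAddCircle).support ⊆ tsupport (f 0) := by
  obtain ⟨ν, hcoeff, hsupp⟩ := exists_limit_measure (fun j ↦ (h.isDecayingDensity j).continuous)
    (fun j ↦ (h.isDecayingDensity j).nonneg) one_half_pos h.half_le_integral
  refine ⟨ν, fun k ↦ ?_, fun k ↦ ?_, ?_⟩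
  · obtain ⟨C, hC⟩ := h.exists_norm_realFourierCoeff_le (hs k)
    refine ⟨C / (1 / 2), fun ξ ↦ (hcoeff ξ _ ?_).trans_eq (mul_div_right_comm _ _ _)⟩
    filter_upwards [eventually_ge_atTop k] with j hj using hC j hj ξ
  · refine hsupp _ ((P k).finite_toSet.isClosed_biUnion fun y _ ↦ Metric.isClosed_closedBall) ?_
    filter_upwards [eventually_gt_atTop k] with j hj x hx
    obtain ⟨y, hy, hxy⟩ := (h.step k).exists_dist_le x (h.ne_zero_of_le hj hx)
    exact mem_biUnion hy hxy
  · exact hsupp _ (isClosed_tsupport _) (.of_forall fun j x hx ↦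
      subset_tsupport _ (h.ne_zero_of_le j.zero_le hx))

end IsRefiningSequence

end Refinements

section SalemMeasure

open AddCircle Filter Topology

theorem ofReal_two_mul_le_measureFourierDim {ν : Measure UnitAddCircle} {s C : ℝ} (hs0 : 0 ≤ s)
    (hs : s ≤ 1 / 2)
    (h : ∀ ξ : ℤ, ‖measureFourierCoeff ν ξ‖ ≤ C * (1 + |(ξ : ℝ)|) ^ (-s)) :
    ENNReal.ofReal (2 * s) ≤ measureFourierDim ν := by
  refine le_iSup₂_of_le (2 * s) ⟨⟨by linarith, by linarith⟩, C, fun ξ ↦ ?_⟩ le_rfl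
  rw [mul_div_cancel_left₀ s two_ne_zero]
  calc ‖measureFourierCoeff ν ξ‖ * |(ξ : ℝ)| ^ s
      ≤ C * (1 + |(ξ : ℝ)|) ^ (-s) * (1 + |(ξ : ℝ)|) ^ s := by
        refine mul_le_mul (h ξ) ?_ (by positivity) ((norm_nonneg _).trans (h ξ))
        gcongr
        exact le_add_of_nonneg_left zero_le_one
    _ = C := by
        rw [mul_assoc, ← Real.rpow_add (by positivity), neg_add_cancel, Real.rpow_zero, mul_one]

theorem exists_seq_isSeparatedTriple {I : Set ℝ} (hI : (interior I).Nonempty) :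
    ∃ (a : ℕ → Fin 3 → ℝ) (ρ : ℕ → ℝ), (∀ k, IsSeparatedTriple I (a k) (ρ k)) ∧
      ∀ t : Fin 3 → ℝ, (∀ i, t i ∈ interior I) → Function.Injective t →
        ∃ k, ∀ i, |t i - a k i| ≤ ρ k / 2 := by
  let T := {q : (Fin 3 → ℚ) × ℚ // IsSeparatedTriple I (fun i ↦ (q.1 i : ℝ)) q.2}
  have : Nonempty T := by
    obtain ⟨t₀, ht₀⟩ := hI
    let t := (infinite_of_mem_nhds t₀ (isOpen_interior.mem_nhds ht₀)).natEmbedding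
    obtain ⟨a, ρ, h, -⟩ := exists_rat_isSeparatedTriple (t := fun i : Fin 3 ↦ (t i : ℝ))
      (fun i ↦ (t i).2) (Subtype.val_injective.comp (t.injective.comp Fin.val_injective))
    exact ⟨⟨(a, ρ), h⟩⟩
  obtain ⟨q, hq⟩ := exists_surjective_nat T
  refine ⟨fun k i ↦ (q k).1.1 i, fun k ↦ (q k).1.2, fun k ↦ (q k).2, fun t ht hinj ↦ ?_⟩
  obtain ⟨a, ρ, h, hclose⟩ := exists_rat_isSeparatedTriple ht hinj
  obtain ⟨k, hk⟩ := hq ⟨(a, ρ), h⟩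
  exact ⟨k, by simpa only [hk] using hclose⟩

theorem RegularDistances.exists_salem_measure {V : Type*} [NormedAddCommGroup V] {γ : ℝ → V}
    {I : Set ℝ} {c K θ : ℝ} (h : RegularDistances γ I c K) (hθ : 0 < θ)
    (hI : I ⊆ Icc θ (1 - θ)) (hI' : (interior I).Nonempty) {f₀ : UnitAddCircle → ℝ}
    (hf₀ : IsDecayingDensity f₀) (hint : ∫ x, f₀ x ∂haarAddCircle = 1) :
    ∃ ν : ProbabilityMeasure UnitAddCircle,
      ENNReal.ofReal (4 / 9) ≤ measureFourierDim (ν : Measure UnitAddCircle) ∧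
      dimH (ν : Measure UnitAddCircle).support ≤ ENNReal.ofReal (4 / 9) ∧
      (ν : Measure UnitAddCircle).support ⊆ tsupport f₀ ∧
      ∀ t : Fin 3 → ℝ, (∀ i, t i ∈ interior I) → Function.Injective t →
        (∀ i, (t i : UnitAddCircle) ∈ (ν : Measure UnitAddCircle).support) →
        ‖γ (t 0) - γ (t 1)‖ ≠ ‖γ (t 1) - γ (t 2)‖ := by
  obtain ⟨a, ρ, ha, hexh⟩ := exists_seq_isSeparatedTriple hI'
  obtain ⟨s, hsm, hs, hslim⟩ := exists_seq_strictMono_tendsto' (show (0 : ℝ) < 2 / 9 by norm_num)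
  obtain ⟨p, -, hp, hplim⟩ := exists_seq_strictAnti_tendsto' (show (4 / 9 : ℝ) < 1 by norm_num)
  obtain ⟨f, r, P, rfl, hf, havoid⟩ := h.exists_isRefiningSequence hθ hI ha (fun k ↦ (hs k).1.le)
    (fun k ↦ (hs k).2) hsm.monotone (fun k ↦ (hp k).1) hf₀ hint
  obtain ⟨ν, hcoeff, hcover, hsupp⟩ := hf.exists_measure fun k ↦ by linarith [(hs k).2]
  refine ⟨ν, ?_, ?_, hsupp, fun t ht hinj hts ↦ ?_⟩
  · have hlim := ENNReal.tendsto_ofReal (hslim.const_mul 2)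
    rw [show (2 * (2 / 9) : ℝ) = 4 / 9 by norm_num] at hlim
    refine le_of_tendsto' hlim fun k ↦ ?_
    obtain ⟨C, hC⟩ := hcoeff k
    exact ofReal_two_mul_le_measureFourierDim (hs k).1.le (by linarith [(hs k).2]) hC
  · have hr0 : Tendsto r atTop (𝓝 0) := squeeze_zero (fun k ↦ (hf.step k).radius_pos.le)
      (fun k ↦ (hf.step k).radius_le) ((tendsto_add_atTop_iff_nat 2).mpr
        (tendsto_pow_atTop_nhds_zero_of_lt_one one_half_pos.le one_half_lt_one))
    exact dimH_le_of_covers (by norm_num) (fun k ↦ (hf.step k).radius_pos) hr0 hplim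
      (fun k ↦ (hf.step k).card_mul_rpow_le.trans (pow_le_one₀ one_half_pos.le one_half_lt_one.le))
      hcover
  · obtain ⟨k, hk⟩ := hexh t ht hinj
    exact havoid k t hk fun i ↦ by simpa using hcover k (hts i)

end SalemMeasure

section SalemSet

open AddCircle

theorem isSalemSet_support {ν : ProbabilityMeasure UnitAddCircle} {d : ℝ≥0∞}
    (hF : d ≤ measureFourierDim (ν : Measure UnitAddCircle))
    (hH : dimH (ν : Measure UnitAddCircle).support ≤ d) :
    IsSalemSet (ν : Measure UnitAddCircle).support ∧
      setFourierDim (ν : Measure UnitAddCircle).support = d := by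
  have hd : d ≤ setFourierDim (ν : Measure UnitAddCircle).support :=
    le_iSup₂_of_le ν subset_rfl hF
  have hle := setFourierDim_le_dimH (ν : Measure UnitAddCircle).support
  exact ⟨⟨Measure.isClosed_support.measurableSet, hle.antisymm (hH.trans hd)⟩,
    (hle.trans hH).antisymm hd⟩

theorem circleImage_setOf_closedBall_and_coe_mem {S : Set UnitAddCircle} {t₀ r : ℝ}
    (hS : S ⊆ Metric.closedBall (t₀ : UnitAddCircle) r) :
    circleImage {t : ℝ | t ∈ Metric.closedBall t₀ r ∧ (t : UnitAddCircle) ∈ S} = S := by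
  refine subset_antisymm (image_subset_iff.mpr fun _ ht ↦ ht.2) fun x hx ↦ ?_
  obtain ⟨z, hz, hzx⟩ := exists_coe_eq_and_abs_eq_norm (x - t₀)
  have htx : ((t₀ + z : ℝ) : UnitAddCircle) = x := by rw [coe_add, hz, add_sub_cancel]
  refine ⟨t₀ + z, ⟨?_, htx.symm ▸ hx⟩, htx⟩
  rw [Metric.mem_closedBall, Real.dist_eq, add_sub_cancel_left, hzx, ← dist_eq_norm]
  exact hS hx

theorem injective_vecCons₃ {α : Type*} {x y z : α} (hxy : x ≠ y) (hyz : y ≠ z) (hxz : x ≠ z) :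
    Function.Injective ![x, y, z] := by
  intro i j hij
  fin_cases i <;> fin_cases j <;> simp_all

theorem tsupport_tent_comp_sub_subset (r : ℝ) (a : UnitAddCircle) :
    tsupport (fun x ↦ tent r (x - a)) ⊆ Metric.closedBall a r := by
  refine closure_minimal (fun x hx ↦ ?_) Metric.isClosed_closedBall
  contrapose! hx
  rw [Metric.mem_closedBall, not_le, dist_eq_norm] at hx
  exact Function.notMem_support.mpr (tent_eq_zero hx.le)

theorem RegularDistances.exists_isSalemSet {V : Type*} [NormedAddCommGroup V] {γ : ℝ → V}
    {c K t₀ η : ℝ} (hη : 0 < η) (hη₀ : η < t₀) (hη₁ : η < 1 - t₀)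
    (h : RegularDistances γ (Metric.closedBall t₀ η) c K) :
    ∃ E ⊆ Icc (0 : ℝ) 1, IsSalemSet (circleImage E) ∧ setFourierDim (circleImage E) = 4 / 9 ∧
      ∀ t₁ ∈ E, ∀ t₂ ∈ E, ∀ t₃ ∈ E, t₁ ≠ t₂ → t₂ ≠ t₃ → t₁ ≠ t₃ →
        ‖γ t₁ - γ t₂‖ ≠ ‖γ t₂ - γ t₃‖ := by
  have hη2 : 0 < η / 2 := half_pos hη
  have hη2' : η / 2 ≤ 1 / 2 := by linarith
  have hθ : 0 < min (t₀ - η) (1 - t₀ - η) := lt_min (by linarith) (by linarith)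
  have hI : Metric.closedBall t₀ η ⊆
      Icc (min (t₀ - η) (1 - t₀ - η)) (1 - min (t₀ - η) (1 - t₀ - η)) := by
    rw [Real.closedBall_eq_Icc]
    exact Icc_subset_Icc (min_le_left _ _) (by linarith [min_le_right (t₀ - η) (1 - t₀ - η)])
  have hint : interior (Metric.closedBall t₀ η) = Metric.ball t₀ η :=
    interior_closedBall t₀ hη.ne'
  obtain ⟨ν, hF, hH, hsupp, havoid⟩ := h.exists_salem_measure hθ hI
    (hint ▸ Metric.nonempty_ball.mpr hη)
    ((isDecayingDensity_tent hη2 hη2').comp_sub (t₀ : UnitAddCircle))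
    ((integral_sub_right_eq_self (tent (η / 2)) (t₀ : UnitAddCircle)).trans
      (integral_tent hη2 hη2'))
  have himage := circleImage_setOf_closedBall_and_coe_mem
    (hsupp.trans (tsupport_tent_comp_sub_subset _ _))
  have hball : Metric.closedBall t₀ (η / 2) ⊆ Metric.ball t₀ η :=
    Metric.closedBall_subset_ball (half_lt_self hη)
  have hsalem := isSalemSet_support hF hH
  rw [ENNReal.ofReal_div_of_pos (by norm_num), ENNReal.ofReal_ofNat, ENNReal.ofReal_ofNat] at hsalem
  refine ⟨_, fun t ht ↦ ?_, himage.symm ▸ hsalem.1, himage.symm ▸ hsalem.2,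
    fun t₁ h₁ t₂ h₂ t₃ h₃ h₁₂ h₂₃ h₁₃ ↦
      havoid ![t₁, t₂, t₃] ?_ (injective_vecCons₃ h₁₂ h₂₃ h₁₃) ?_⟩
  · have := hI (Metric.ball_subset_closedBall (hball ht.1))
    exact ⟨hθ.le.trans this.1, by linarith [this.2]⟩
  · rw [hint]
    exact Fin.forall_fin_succ.mpr ⟨hball h₁.1, Fin.forall_fin_two.mpr ⟨hball h₂.1, hball h₃.1⟩⟩
  · exact Fin.forall_fin_succ.mpr ⟨h₁.2, Fin.forall_fin_two.mpr ⟨h₂.2, h₃.2⟩⟩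

end SalemSet

theorem mainTheorem5_general {V : Type*} [NormedAddCommGroup V] [NormedSpace ℝ V] {γ : ℝ → V}
    {v : V} {t₀ : ℝ} (ht₀ : t₀ ∈ Ioo (0 : ℝ) 1) (hγ : HasStrictDerivAt γ v t₀) (hv : v ≠ 0) :
    ∃ E ⊆ Icc (0 : ℝ) 1, IsSalemSet (circleImage E) ∧ setFourierDim (circleImage E) = 4 / 9 ∧
      ∀ t₁ ∈ E, ∀ t₂ ∈ E, ∀ t₃ ∈ E, t₁ ≠ t₂ → t₂ ≠ t₃ → t₁ ≠ t₃ →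
        ‖γ t₁ - γ t₂‖ ≠ ‖γ t₂ - γ t₃‖ := by
  obtain ⟨δ, hδ, hreg⟩ := RegularDistances.exists_closedBall_of_hasStrictDerivAt hγ hv
  obtain ⟨η, hη, hηlt⟩ := exists_between (lt_min hδ (lt_min ht₀.1 (sub_pos.mpr ht₀.2)))
  obtain ⟨hηδ, hη₀, hη₁⟩ : η < δ ∧ η < t₀ ∧ η < 1 - t₀ := by simpa only [lt_min_iff] using hηlt
  exact (hreg.mono (Metric.closedBall_subset_closedBall hηδ.le)).exists_isSalemSet hη hη₀ hη₁

theorem mainTheorem5 (d : ℕ) (γ : ℝ → EuclideanSpace ℝ (Fin d))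
    (hγ : ContDiffOn ℝ ∞ γ (Icc (0 : ℝ) 1))
    (hγ' : ∀ t ∈ Icc (0 : ℝ) 1, derivWithin γ (Icc (0 : ℝ) 1) t ≠ 0) :
    ∃ E : Set ℝ, E ⊆ Icc (0 : ℝ) 1 ∧ IsSalemSet (circleImage E) ∧
      setFourierDim (circleImage E) = 4 / 9 ∧ AvoidsIsoscelesTriangles γ E := by
  have hmid : (1 / 2 : ℝ) ∈ Ioo (0 : ℝ) 1 := by norm_num
  have hnhds : Icc (0 : ℝ) 1 ∈ nhds (1 / 2 : ℝ) := Icc_mem_nhds hmid.1 hmid.2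
  have hderiv := hγ' _ (Ioo_subset_Icc_self hmid)
  rw [derivWithin_of_mem_nhds hnhds] at hderiv
  exact mainTheorem5_general hmid ((hγ.contDiffAt hnhds).hasStrictDerivAt (by simp)) hderiv
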